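/- **Setting.** Let $A=(a_{ij})_{i,j\in I}$ be the Cartan matrix of a simple finite-dimensional complex Lie algebra, let $d_i$ be positive integers with $d_ia_{ij}=d_ja_{ji}$, let $q\in\mathbb C^*$ not be a root of unity, and put $q_i=q^{d_i}$, $q_{ij}=q^{d_ia_{ij}}$. Let $g_{ij}(t)=\sum_{n\ge0}g^{(ij)}_nt^n$ be the Taylor series at $0$ of $(q_{ij}t-1)/(t-q_{ij})$. Fix $\kappa\in\mathbb C^*$ (for instance $\kappa=-1/(q+q^{-1})$). Let $\overline U^+$ be the $\mathbb C$-algebra generated by $x^+_{i,n}$ $(i\in I,\ n\in\mathbb Z)$, $\varphi_{i,-k}$ $(k\ge0)$, $\varphi_{i,0}^{-1}$ and $q^{\pm c/2}$, subject only to: $q^{\pm c/2}$ are central and mutually inverse, $\varphi_{i,0}$ and $\varphi_{i,0}^{-1}$ are mutually inverse, and the $\varphi_{i,0}$ commute with each other. Let $\overline U^-$ be the same algebra with the generators renamed $x^-_{i,n}$, $\psi_{i,k}$ $(k\ge0)$, $\psi_{i,0}^{-1}$, $q^{\pm c'/2}$; in the formulas for $\overline U^-$ we write $c$ for $c'$.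 Put $x_i^\pm(z)=\sum_nx^\pm_{i,n}z^{-n}$, $\varphi_i(z)=\sum_{k\ge0}\varphi_{i,-k}z^k$, $\psi_i(z)=\sum_{k\ge0}\psi_{i,k}z^{-k}$, $c_1=c\otimes1$, $c_2=1\otimes c$. The coproducts $\Delta$ are the algebra morphisms into the completed tensor squares given by $$\begin{aligned}\Delta(x_i^+(z))&=x_i^+(z)\otimes1+\varphi_i(zq^{c_1/2})\otimes x_i^+(zq^{c_1}),&\Delta(\varphi_i(z))&=\varphi_i(zq^{-c_2/2})\otimes\varphi_i(zq^{c_1/2}),\\ \Delta(x_i^-(z))&=1\otimes x_i^-(z)+x_i^-(zq^{c_2})\otimes\psi_i(zq^{c_2/2}),&\Delta(\psi_i(z))&=\psi_i(zq^{c_2/2})\otimes\psi_i(zq^{-c_1/2}),\end{aligned}$$ $q^{\pm c/2}$, $\varphi_{i,0}^{-1}$, $\psi_{i,0}^{-1}$ being group-like. Here, for the loop grading in which $x^\pm_{i,n}$, $\varphi_{i,-k}$, $\psi_{i,k}$ have degrees $n$, $-k$, $k$ and the other generators degree $0$, infinite sums of tensors are allowed when the loop degree of the first factor tends to $-\infty$.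 The counit is $1$ on $q^{\pm c/2}$, $\varphi_i(z)$, $\psi_i(z)$ and $0$ on $x_i^\pm(z)$. The antipodes are the anti-morphisms with $S(q^{c/2})=q^{-c/2}$, $S(\varphi_i(z))=\varphi_i(z)^{-1}$, $S(\psi_i(z))=\psi_i(z)^{-1}$, $S(x_i^+(z))=-\varphi_i(zq^{-c/2})^{-1}x_i^+(zq^{-c})$, $S(x_i^-(z))=-x_i^-(zq^{-c})\psi_i(zq^{-c/2})^{-1}$, with values in the inverse limit of the quotients by the two-sided ideals $\overline U^\pm_N$ spanned by the words of degree $>N$, where $\varphi_{i,-k}$ and $\psi_{i,k}$ have degree $k$ and the other generators degree $0$. A two-sided ideal $I$ of $\overline U^\pm$ is called a *weak Hopf ideal* if $\varepsilon(I)=0$, if for every $a\in I$ each component of $\Delta(a)$ with respect to the loop degree of the first factor lies in $I\otimes\overline U^\pm+\overline U^\pm\otimes I$, and if $S(I)$ is contained in the closure of $I$ in the completed algebra. There is exactly one bilinear form $\langle\cdot,\cdot\rangle:\overline U^+\times\overline U^-\to\mathbb C$, called the *weak Hopf pairing*, such that $$\langle a,bb'\rangle=\sum\langle a_{(1)},b\rangle\langle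 a_{(2)},b'\rangle,\quad\langle aa',b\rangle=\sum\langle a,b_{(2)}\rangle\langle a',b_{(1)}\rangle,\quad\langle a,1\rangle=\varepsilon(a),\quad\langle1,b\rangle=\varepsilon(b),$$ where in each sum only finitely many components (with respect to the loop degree of the first factor) of the coproduct contribute, which is graded by the root lattice ($x^\pm_{i,n}$ having degree $\pm\alpha_i$, the other generators degree $0$, and elements of degrees $\alpha$ and $-\beta$ with $\alpha\ne\beta$ being orthogonal), and which has the values $$\langle q^{\pm c/2},q^{\pm c'/2}\rangle=1,\quad\langle q^{\pm c/2},\psi_{i,k}\rangle=\langle\varphi_{i,-k},q^{\pm c'/2}\rangle=\delta_{k,0},\quad\langle q^{\pm c/2},\psi_{i,0}^{-1}\rangle=\langle\varphi_{i,0}^{-1},q^{\pm c'/2}\rangle=1,$$ $$\langle q^{\pm c/2},x^-_{i,n}\rangle=\langle x^+_{i,n},q^{\pm c'/2}\rangle=0,\quad\langle\varphi_{i,-k},x^-_{j,n}\rangle=\langle x^+_{j,n},\psi_{i,k}\rangle=0,$$ $$\langle\varphi_{i,-k},\psi_{j,l}\rangle=\delta_{k,l}\,g^{(ij)}_k,\quad\langle\varphi_{i,0}^{-1},\psi_{j,0}\rangle=\langle\varphi_{i,0},\psi_{j,0}^{-1}\rangle=(g^{(ij)}_0)^{-1},\quad\langle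 x^+_{i,n},x^-_{j,m}\rangle=\kappa\,\delta_{i,j}\,\delta_{n,-m}.$$ **Proposition 7.** For all $i\neq j$, all the coefficients of the Serre series $$\sum_{r=0}^{1-a_{ij}}(-1)^r\begin{bmatrix}1-a_{ij}\\r\end{bmatrix}_{q_i}\mathrm{Sym}_z\bigl(x_i^\pm(z_1)\cdots x_i^\pm(z_r)\,x_j^\pm(w)\,x_i^\pm(z_{r+1})\cdots x_i^\pm(z_{1-a_{ij}})\bigr)$$ lie in the annihilator ideals of the weak Hopf pairing: in the left kernel for $+$, in the right kernel for $-$. Moreover, the two-sided ideal of $\overline U^+$ generated by the coefficients of $$\varphi_i(z)\varphi_j(w)-\varphi_j(w)\varphi_i(z),\qquad\varphi_i(z)x_j^+(w)-g_{ij}(zw^{-1}q^{-c/2})\,x_j^+(w)\varphi_i(z),$$ $$(z-q_{ij}w)x_i^+(z)x_j^+(w)-(q_{ij}z-w)x_j^+(w)x_i^+(z)$$ for all $i,j$, and of the Serre series for $i\ne j$, is a weak Hopf ideal; and so is the two-sided ideal of $\overline U^-$ generated by the coefficients of $$\psi_i(z)\psi_j(w)-\psi_j(w)\psi_i(z),\qquad\psi_i(z)x_j^-(w)-g_{ij}(wz^{-1}q^{c/2})\,x_j^-(w)\psi_i(z),$$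 $$(z-q_{ij}^{-1}w)x_i^-(z)x_j^-(w)-(q_{ij}^{-1}z-w)x_j^-(w)x_i^-(z)$$ for all $i,j$, and of the Serre series for $i\neq j$. -/

import Mathlib

open scoped TensorProduct

noncomputable section

namespace QAffine

universe u

/-! ### Cartan data and `q`-numbers -/

/-- `A` is the Cartan matrix of a simple finite-dimensional complex Lie algebra and the positive
integers `d i` symmetrize it: `(α_i | α_j) = d i * A i j`, so `d i = (α_i | α_i) / 2`. -/
structure IsSimpleCartan {ι : Type u} [Fintype ι] (A : Matrix ι ι ℤ) (d : ι → ℕ) : Prop where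
  nonempty : Nonempty ι
  diag : ∀ i, A i i = 2
  offDiag : ∀ i j, i ≠ j → A i j ≤ 0
  d_pos : ∀ i, 0 < d i
  symm : ∀ i j, (d i : ℤ) * A i j = (d j : ℤ) * A j i
  posDef : (Matrix.of fun i j => ((d i : ℝ) * (A i j : ℝ))).PosDef
  indecomposable : ∀ s : Set ι, s.Nonempty → sᶜ.Nonempty → ∃ i ∈ s, ∃ j ∈ sᶜ, A i j ≠ 0

/-- `q_{ij} = q ^ (α_i | α_j)`. -/
def qij {ι : Type u} (A : Matrix ι ι ℤ) (d : ι → ℕ) (q : ℂ) (i j : ι) : ℂ :=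
  q ^ ((d i : ℤ) * A i j)

/-- `[n]_q = (q ^ n - q ^ (-n)) / (q - q⁻¹)`. -/
def qInt (q : ℂ) (n : ℕ) : ℂ := (q ^ n - q⁻¹ ^ n) / (q - q⁻¹)

/-- `[n]_q! = [1]_q [2]_q ⋯ [n]_q`. -/
def qFactorial (q : ℂ) (n : ℕ) : ℂ := ∏ k ∈ Finset.range n, qInt q (k + 1)

/-- The quantum binomial coefficient. -/
def qBinom (q : ℂ) (n p : ℕ) : ℂ := qFactorial q n / (qFactorial q p * qFactorial q (n - p))

/-- The Taylor series at `0` of `(Q t - 1) / (t - Q)`. For `Q = q_{ij}` this is `g_{ij}(t)`. -/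
def gSeries (Q : ℂ) : PowerSeries ℂ :=
  (PowerSeries.C Q * PowerSeries.X - 1) * (PowerSeries.X - PowerSeries.C Q)⁻¹

/-! ### The free Borel algebra -/

/-- Names of generators. In the positive algebra `x i n`, `h i k`, `hinv i`, `c`, `cinv` stand for
`x⁺_{i,n}`, `φ_{i,-k}`, `φ_{i,0}⁻¹`, `q^{c/2}`, `q^{-c/2}`; in the negative algebra they stand for
`x⁻_{i,n}`, `ψ_{i,k}`, `ψ_{i,0}⁻¹`, `q^{c'/2}`, `q^{-c'/2}`. -/
inductive Gen (ι : Type u) : Type u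
  | x (i : ι) (n : ℤ)
  | h (i : ι) (k : ℕ)
  | hinv (i : ι)
  | c
  | cinv

/-- The relations that hold in the free Borel algebra: the `h i 0` generate a commutative Laurent
polynomial ring, and `c` is central and invertible. -/
inductive Rel (ι : Type u) : FreeAlgebra ℂ (Gen ι) → FreeAlgebra ℂ (Gen ι) → Prop
  | c_cinv : Rel ι (FreeAlgebra.ι ℂ Gen.c * FreeAlgebra.ι ℂ Gen.cinv) 1
  | cinv_c : Rel ι (FreeAlgebra.ι ℂ Gen.cinv * FreeAlgebra.ι ℂ Gen.c) 1
  | c_comm (g : Gen ι) : Rel ι (FreeAlgebra.ι ℂ Gen.c * FreeAlgebra.ι ℂ g)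
      (FreeAlgebra.ι ℂ g * FreeAlgebra.ι ℂ Gen.c)
  | h_hinv (i : ι) : Rel ι (FreeAlgebra.ι ℂ (Gen.h i 0) * FreeAlgebra.ι ℂ (Gen.hinv i)) 1
  | hinv_h (i : ι) : Rel ι (FreeAlgebra.ι ℂ (Gen.hinv i) * FreeAlgebra.ι ℂ (Gen.h i 0)) 1
  | h_comm (i j : ι) : Rel ι (FreeAlgebra.ι ℂ (Gen.h i 0) * FreeAlgebra.ι ℂ (Gen.h j 0))
      (FreeAlgebra.ι ℂ (Gen.h j 0) * FreeAlgebra.ι ℂ (Gen.h i 0))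

/-- The free Borel algebra `Ū_q(𝔟^±)`: no relations but those in `Rel`. -/
def Borel (ι : Type u) : Type u := RingQuot (Rel ι)

instance (ι : Type u) : Ring (Borel ι) := inferInstanceAs (Ring (RingQuot (Rel ι)))

instance (ι : Type u) : Algebra ℂ (Borel ι) := RingQuot.instAlgebra (Rel ι)

/-- The quotient map. -/
def mk (ι : Type u) : FreeAlgebra ℂ (Gen ι) →ₐ[ℂ] Borel ι := RingQuot.mkAlgHom ℂ (Rel ι)

lemma mk_surjective (ι : Type u) : Function.Surjective (mk ι) :=
  RingQuot.mkAlgHom_surjective ℂ (Rel ι)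

lemma mk_rel {ι : Type u} {a b : FreeAlgebra ℂ (Gen ι)} (hab : Rel ι a b) : mk ι a = mk ι b :=
  RingQuot.mkAlgHom_rel ℂ hab

/-- The class of a generator. -/
def gen {ι : Type u} (g : Gen ι) : Borel ι := mk ι (FreeAlgebra.ι ℂ g)

/-- `X i n` is `x^±_{i,n}`. -/
def X {ι : Type u} (i : ι) (n : ℤ) : Borel ι := gen (Gen.x i n)

/-- `H i k` is `φ_{i,-k}` in the positive and `ψ_{i,k}` in the negative algebra. -/
def H {ι : Type u} (i : ι) (k : ℕ) : Borel ι := gen (Gen.h i k)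

/-- `Hinv i` is the inverse of `H i 0`. -/
def Hinv {ι : Type u} (i : ι) : Borel ι := gen (Gen.hinv i)

lemma c_mul_cinv {ι : Type u} : (gen Gen.c : Borel ι) * gen Gen.cinv = 1 := by
  simpa [gen] using mk_rel (Rel.c_cinv (ι := ι))

lemma cinv_mul_c {ι : Type u} : (gen Gen.cinv : Borel ι) * gen Gen.c = 1 := by
  simpa [gen] using mk_rel (Rel.cinv_c (ι := ι))

lemma H_mul_Hinv {ι : Type u} (i : ι) : H i 0 * Hinv i = 1 := by
  simpa [gen, H, Hinv] using mk_rel (Rel.h_hinv i)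

lemma Hinv_mul_H {ι : Type u} (i : ι) : Hinv i * H i 0 = 1 := by
  simpa [gen, H, Hinv] using mk_rel (Rel.hinv_h i)

lemma H_comm {ι : Type u} (i j : ι) : H i 0 * H j 0 = H j 0 * H i 0 := by
  simpa [gen, H] using mk_rel (Rel.h_comm i j)

lemma c_comm_gen {ι : Type u} (g : Gen ι) : gen Gen.c * gen g = gen g * gen Gen.c := by
  simpa [gen] using mk_rel (Rel.c_comm g)

lemma c_comm {ι : Type u} (a : Borel ι) : gen Gen.c * a = a * gen Gen.c := by
  obtain ⟨a, rfl⟩ := mk_surjective ι a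
  induction a using FreeAlgebra.induction with
  | grade0 r => simp only [AlgHom.commutes]; exact (Algebra.commutes r _).symm
  | grade1 g => exact c_comm_gen g
  | mul a b ha hb => rw [map_mul, ← mul_assoc, ha, mul_assoc, hb, mul_assoc]
  | add a b ha hb => rw [map_add, mul_add, add_mul, ha, hb]

lemma cinv_comm {ι : Type u} (a : Borel ι) : gen Gen.cinv * a = a * gen Gen.cinv := by
  calc gen Gen.cinv * a = gen Gen.cinv * (a * gen Gen.c) * gen Gen.cinv := by
        rw [mul_assoc, mul_assoc, c_mul_cinv, mul_one]
    _ = a * gen Gen.cinv := by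
        rw [← c_comm, ← mul_assoc, cinv_mul_c, one_mul]

/-- `q^{c/2}` as a unit. -/
def cUnit {ι : Type u} : (Borel ι)ˣ := ⟨gen Gen.c, gen Gen.cinv, c_mul_cinv, cinv_mul_c⟩

/-- `cpow m` is `q^{m c/2}`. -/
def cpow {ι : Type u} (m : ℤ) : Borel ι := ((cUnit ^ m : (Borel ι)ˣ) : Borel ι)

/-- A choice of images of the generators that respects the relations in `Rel`. -/
structure Admissible {ι : Type u} {T : Type*} [Ring T] [Algebra ℂ T] (f : Gen ι → T) : Prop where
  c_cinv : f Gen.c * f Gen.cinv = 1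
  cinv_c : f Gen.cinv * f Gen.c = 1
  c_comm : ∀ g, f Gen.c * f g = f g * f Gen.c
  h_hinv : ∀ i, f (Gen.h i 0) * f (Gen.hinv i) = 1
  hinv_h : ∀ i, f (Gen.hinv i) * f (Gen.h i 0) = 1
  h_comm : ∀ i j, f (Gen.h i 0) * f (Gen.h j 0) = f (Gen.h j 0) * f (Gen.h i 0)

/-- The algebra morphism with prescribed values on the generators. -/
def lift {ι : Type u} {T : Type*} [Ring T] [Algebra ℂ T] (f : Gen ι → T) (hf : Admissible f) :
    Borel ι →ₐ[ℂ] T :=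
  RingQuot.liftAlgHom (A := FreeAlgebra ℂ (Gen ι)) (s := Rel ι) ℂ ⟨FreeAlgebra.lift ℂ f, by
    intro a b hab
    cases hab with
    | c_cinv => simpa using hf.c_cinv
    | cinv_c => simpa using hf.cinv_c
    | c_comm g => simpa using hf.c_comm g
    | h_hinv i => simpa using hf.h_hinv i
    | hinv_h i => simpa using hf.hinv_h i
    | h_comm i j => simpa using hf.h_comm i j⟩

lemma lift_gen {ι : Type u} {T : Type*} [Ring T] [Algebra ℂ T] (f : Gen ι → T)
    (hf : Admissible f) (g : Gen ι) : lift f hf (gen g) = f g := by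
  refine (RingQuot.liftAlgHom_mkAlgHom_apply ℂ (FreeAlgebra.lift ℂ f) _ _).trans ?_
  exact FreeAlgebra.lift_ι_apply f g

/-! ### Gradings and filtrations -/

/-- The product of a word in the generators. -/
def word {ι : Type u} (w : List (Gen ι)) : Borel ι := (w.map gen).prod

/-- The weight of a generator: `α_i` for `x i n` (which is the degree of `x⁺_{i,n}`, and minus the
degree of `x⁻_{i,n}`), zero for the others. -/
def Gen.weight {ι : Type u} [DecidableEq ι] : Gen ι → (ι → ℕ)
  | Gen.x i _ => Pi.single i 1
  | _ => 0

/-- The span of the words of weight `α`. It is the part of `Q`-degree `α` of the positive, and of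
`Q`-degree `-α` of the negative algebra. -/
def weightSpace {ι : Type u} [DecidableEq ι] (α : ι → ℕ) : Submodule ℂ (Borel ι) :=
  Submodule.span ℂ {a | ∃ w : List (Gen ι), (w.map Gen.weight).sum = α ∧ a = word w}

/-- The degree that defines the topology of the algebra: `φ_{i,-k}` and `ψ_{i,k}` have degree `k`,
the other generators have degree zero. -/
def Gen.hDeg {ι : Type u} : Gen ι → ℕ
  | Gen.h _ k => k
  | _ => 0

/-- The two-sided ideal generated by the words of degree greater than `N`. The completed algebra is
the inverse limit of the quotients by these ideals. -/
def hIdeal (ι : Type u) (N : ℕ) : TwoSidedIdeal (Borel ι) :=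
  TwoSidedIdeal.span {a | ∃ w : List (Gen ι), N < (w.map Gen.hDeg).sum ∧ a = word w}

/-! ### Counit, coproducts, antipodes -/

/-- The counit on generators. -/
def counitGen {ι : Type u} : Gen ι → ℂ
  | Gen.x _ _ => 0
  | Gen.h _ k => if k = 0 then 1 else 0
  | Gen.hinv _ => 1
  | Gen.c => 1
  | Gen.cinv => 1

lemma counitGen_admissible {ι : Type u} : Admissible (counitGen (ι := ι)) := by
  constructor <;> intros <;> simp [counitGen, mul_comm]

/-- The counit. -/
def counit (ι : Type u) : Borel ι →ₐ[ℂ] ℂ := lift counitGen counitGen_admissible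

/-- The completed tensor square. Give `x i n` the loop degree `n`, `φ_{i,-k}` the loop degree `-k`,
`ψ_{i,k}` the loop degree `k`, and the other generators the loop degree `0`. The coefficient of a
series at `m` is the part of it whose first tensor factor has loop degree `-m`; so infinite sums
are allowed when the loop degree of the first factor tends to `-∞`. -/
abbrev CompletedTensor (ι : Type u) : Type u := HahnSeries ℤ (Borel ι ⊗[ℂ] Borel ι)

lemma tmul_c_comm {ι : Type u} (t : Borel ι ⊗[ℂ] Borel ι) :
    (gen Gen.c ⊗ₜ gen Gen.c) * t = t * (gen Gen.c ⊗ₜ gen Gen.c) := by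
  induction t using TensorProduct.induction_on with
  | zero => simp
  | tmul a b => simp only [Algebra.TensorProduct.tmul_mul_tmul, c_comm]
  | add a b ha hb => rw [mul_add, add_mul, ha, hb]

/-- `Δ(x⁺_i(z)) = x⁺_i(z) ⊗ 1 + φ_i(z q^{c₁/2}) ⊗ x⁺_i(z q^{c₁})`,
`Δ(φ_i(z)) = φ_i(z q^{-c₂/2}) ⊗ φ_i(z q^{c₁/2})`, and `φ_{i,0}⁻¹`, `q^{±c/2}` are group-like. -/
def deltaPlusGen {ι : Type u} : Gen ι → CompletedTensor ι
  | Gen.x i n => HahnSeries.single (-n) (X i n ⊗ₜ[ℂ] 1) +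
      HahnSeries.ofPowerSeries ℤ (Borel ι ⊗[ℂ] Borel ι) (PowerSeries.mk fun k : ℕ =>
        (H i k * cpow (-(2 * n + k))) ⊗ₜ[ℂ] X i (n + k))
  | Gen.h i k => ∑ p ∈ Finset.HasAntidiagonal.antidiagonal k, HahnSeries.single (p.1 : ℤ)
      ((H i p.1 * cpow p.2) ⊗ₜ[ℂ] (H i p.2 * cpow (-p.1)))
  | Gen.hinv i => HahnSeries.single 0 (Hinv i ⊗ₜ[ℂ] Hinv i)
  | Gen.c => HahnSeries.single 0 (gen Gen.c ⊗ₜ[ℂ] gen Gen.c)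
  | Gen.cinv => HahnSeries.single 0 (gen Gen.cinv ⊗ₜ[ℂ] gen Gen.cinv)

/-- `Δ(x⁻_i(z)) = 1 ⊗ x⁻_i(z) + x⁻_i(z q^{c₂}) ⊗ ψ_i(z q^{c₂/2})`,
`Δ(ψ_i(z)) = ψ_i(z q^{c₂/2}) ⊗ ψ_i(z q^{-c₁/2})`, and `ψ_{i,0}⁻¹`, `q^{±c'/2}` are group-like. -/
def deltaMinusGen {ι : Type u} : Gen ι → CompletedTensor ι
  | Gen.x i n => HahnSeries.single 0 (1 ⊗ₜ[ℂ] X i n) +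
      HahnSeries.single (-n) (1 : Borel ι ⊗[ℂ] Borel ι) * HahnSeries.ofPowerSeries ℤ (Borel ι ⊗[ℂ] Borel ι) (PowerSeries.mk fun k : ℕ =>
        X i (n - k) ⊗ₜ[ℂ] (H i k * cpow (-(2 * n - k))))
  | Gen.h i k => ∑ p ∈ Finset.HasAntidiagonal.antidiagonal k, HahnSeries.single (-(p.1 : ℤ))
      ((H i p.1 * cpow p.2) ⊗ₜ[ℂ] (H i p.2 * cpow (-p.1)))
  | Gen.hinv i => HahnSeries.single 0 (Hinv i ⊗ₜ[ℂ] Hinv i)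
  | Gen.c => HahnSeries.single 0 (gen Gen.c ⊗ₜ[ℂ] gen Gen.c)
  | Gen.cinv => HahnSeries.single 0 (gen Gen.cinv ⊗ₜ[ℂ] gen Gen.cinv)

lemma deltaPlusGen_admissible {ι : Type u} : Admissible (deltaPlusGen (ι := ι)) where
  c_cinv := by
    simp [deltaPlusGen, HahnSeries.single_mul_single, c_mul_cinv]
    rfl
  cinv_c := by
    simp [deltaPlusGen, HahnSeries.single_mul_single, cinv_mul_c]
    rfl
  c_comm g := by
    ext m
    simp only [deltaPlusGen, HahnSeries.coeff_single_zero_mul, HahnSeries.coeff_mul_single_zero]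
    exact tmul_c_comm _
  h_hinv i := by
    simp [deltaPlusGen, HahnSeries.single_mul_single, cpow, H_mul_Hinv]
    rfl
  hinv_h i := by
    simp [deltaPlusGen, HahnSeries.single_mul_single, cpow, Hinv_mul_H]
    rfl
  h_comm i j := by
    simp [deltaPlusGen, HahnSeries.single_mul_single, cpow, H_comm i j]

lemma deltaMinusGen_admissible {ι : Type u} : Admissible (deltaMinusGen (ι := ι)) where
  c_cinv := by
    simp [deltaMinusGen, HahnSeries.single_mul_single, c_mul_cinv]
    rfl
  cinv_c := by
    simp [deltaMinusGen, HahnSeries.single_mul_single, cinv_mul_c]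
    rfl
  c_comm g := by
    ext m
    simp only [deltaMinusGen, HahnSeries.coeff_single_zero_mul, HahnSeries.coeff_mul_single_zero]
    exact tmul_c_comm _
  h_hinv i := by
    simp [deltaMinusGen, HahnSeries.single_mul_single, cpow, H_mul_Hinv]
    rfl
  hinv_h i := by
    simp [deltaMinusGen, HahnSeries.single_mul_single, cpow, Hinv_mul_H]
    rfl
  h_comm i j := by
    simp [deltaMinusGen, HahnSeries.single_mul_single, cpow, H_comm i j]

/-- The coproduct of the positive algebra. -/
def deltaPlus (ι : Type u) : Borel ι →ₐ[ℂ] CompletedTensor ι :=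
  lift deltaPlusGen deltaPlusGen_admissible

/-- The coproduct of the negative algebra. -/
def deltaMinus (ι : Type u) : Borel ι →ₐ[ℂ] CompletedTensor ι :=
  lift deltaMinusGen deltaMinusGen_admissible

/-- The coefficients of the inverse series of `∑ₖ (H i k) t ^ k`, that is of `φ_i(z)⁻¹` or
`ψ_i(z)⁻¹`. -/
def hInvCoeff {ι : Type u} (i : ι) : ℕ → Borel ι
  | 0 => Hinv i
  | k + 1 => -(Hinv i * ∑ r : Fin (k + 1), H i ((r : ℕ) + 1) * hInvCoeff i (k - (r : ℕ)))

/-- `S(x⁺_i(z)) = -φ_i(z q^{-c/2})⁻¹ x⁺_i(z q^{-c})`, `S(φ_i(z)) = φ_i(z)⁻¹`, `S(q^{c/2}) = q^{-c/2}`.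
The formal variable of the power series records the degree `Gen.hDeg`. -/
def antipodePlusGen {ι : Type u} : Gen ι → (PowerSeries (Borel ι))ᵐᵒᵖ
  | Gen.x i n => MulOpposite.op (-PowerSeries.mk fun k : ℕ =>
      hInvCoeff i k * X i (n + k) * cpow (2 * n + k))
  | Gen.h i k => MulOpposite.op (PowerSeries.monomial k (hInvCoeff i k))
  | Gen.hinv i => MulOpposite.op (PowerSeries.C (H i 0))
  | Gen.c => MulOpposite.op (PowerSeries.C (gen Gen.cinv))
  | Gen.cinv => MulOpposite.op (PowerSeries.C (gen Gen.c))

/-- `S(x⁻_i(z)) = -x⁻_i(z q^{-c'}) ψ_i(z q^{-c'/2})⁻¹`, `S(ψ_i(z)) = ψ_i(z)⁻¹`,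
`S(q^{c'/2}) = q^{-c'/2}`. -/
def antipodeMinusGen {ι : Type u} : Gen ι → (PowerSeries (Borel ι))ᵐᵒᵖ
  | Gen.x i n => MulOpposite.op (-PowerSeries.mk fun k : ℕ =>
      X i (n - k) * hInvCoeff i k * cpow (2 * n - k))
  | Gen.h i k => MulOpposite.op (PowerSeries.monomial k (hInvCoeff i k))
  | Gen.hinv i => MulOpposite.op (PowerSeries.C (H i 0))
  | Gen.c => MulOpposite.op (PowerSeries.C (gen Gen.cinv))
  | Gen.cinv => MulOpposite.op (PowerSeries.C (gen Gen.c))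

lemma C_cinv_comm {ι : Type u} (f : PowerSeries (Borel ι)) :
    PowerSeries.C (gen Gen.cinv) * f = f * PowerSeries.C (gen Gen.cinv) := by
  ext m
  rw [PowerSeries.coeff_C_mul, PowerSeries.coeff_mul_C, cinv_comm]

lemma Hinv_comm {ι : Type u} (i j : ι) : Hinv i * Hinv j = Hinv j * Hinv i := by
  calc Hinv i * Hinv j = Hinv i * Hinv j * (H i 0 * H j 0 * (Hinv j * Hinv i)) := by
        rw [mul_assoc (H i 0), ← mul_assoc (H j 0), H_mul_Hinv, one_mul, H_mul_Hinv, mul_one]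
    _ = Hinv j * Hinv i := by
        rw [H_comm i j, ← mul_assoc, mul_assoc (Hinv i), ← mul_assoc (Hinv j), Hinv_mul_H,
          one_mul, Hinv_mul_H, one_mul]

lemma antipodePlusGen_admissible {ι : Type u} : Admissible (antipodePlusGen (ι := ι)) where
  c_cinv := by simp [antipodePlusGen, ← MulOpposite.op_mul, ← map_mul, c_mul_cinv]
  cinv_c := by simp [antipodePlusGen, ← MulOpposite.op_mul, ← map_mul, cinv_mul_c]
  c_comm g := by
    apply MulOpposite.unop_injective
    simp only [antipodePlusGen, MulOpposite.unop_mul, MulOpposite.unop_op]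
    exact (C_cinv_comm _).symm
  h_hinv i := by
    simp [antipodePlusGen, ← MulOpposite.op_mul, ← map_mul, hInvCoeff, H_mul_Hinv]
  hinv_h i := by
    simp [antipodePlusGen, ← MulOpposite.op_mul, ← map_mul, hInvCoeff, Hinv_mul_H]
  h_comm i j := by
    simp [antipodePlusGen, ← MulOpposite.op_mul, ← map_mul, hInvCoeff, Hinv_comm i j]

lemma antipodeMinusGen_admissible {ι : Type u} : Admissible (antipodeMinusGen (ι := ι)) where
  c_cinv := by simp [antipodeMinusGen, ← MulOpposite.op_mul, ← map_mul, c_mul_cinv]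
  cinv_c := by simp [antipodeMinusGen, ← MulOpposite.op_mul, ← map_mul, cinv_mul_c]
  c_comm g := by
    apply MulOpposite.unop_injective
    simp only [antipodeMinusGen, MulOpposite.unop_mul, MulOpposite.unop_op]
    exact (C_cinv_comm _).symm
  h_hinv i := by
    simp [antipodeMinusGen, ← MulOpposite.op_mul, ← map_mul, hInvCoeff, H_mul_Hinv]
  hinv_h i := by
    simp [antipodeMinusGen, ← MulOpposite.op_mul, ← map_mul, hInvCoeff, Hinv_mul_H]
  h_comm i j := by
    simp [antipodeMinusGen, ← MulOpposite.op_mul, ← map_mul, hInvCoeff, Hinv_comm i j]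

/-- The antipode of the positive algebra, an anti-morphism to the completed algebra: the value on
`a` is the sum of the coefficients of the series. -/
def antipodePlus (ι : Type u) : Borel ι →ₐ[ℂ] (PowerSeries (Borel ι))ᵐᵒᵖ :=
  lift antipodePlusGen antipodePlusGen_admissible

/-- The antipode of the negative algebra. -/
def antipodeMinus (ι : Type u) : Borel ι →ₐ[ℂ] (PowerSeries (Borel ι))ᵐᵒᵖ :=
  lift antipodeMinusGen antipodeMinusGen_admissible

/-! ### The weak Hopf pairing -/

/-- `u ⊗ v ↦ f u * g v`. -/
def evalTensor {ι : Type u} (f g : Borel ι →ₗ[ℂ] ℂ) : Borel ι ⊗[ℂ] Borel ι →ₗ[ℂ] ℂ :=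
  LinearMap.mul' ℂ ℂ ∘ₗ TensorProduct.map f g

/-- `P a b = ⟨a, b⟩` is the weak Hopf pairing between the positive algebra (first argument) and the
negative one (second argument), with `⟨x⁺_{i,n}, x⁻_{i,-n}⟩ = κ`. -/
structure IsWeakHopfPairing {ι : Type u} [DecidableEq ι] (A : Matrix ι ι ℤ) (d : ι → ℕ) (q κ : ℂ)
    (P : Borel ι →ₗ[ℂ] Borel ι →ₗ[ℂ] ℂ) : Prop where
  finite_right : ∀ a b b', (Function.support fun m : ℤ =>
    evalTensor (P.flip b) (P.flip b') ((deltaPlus ι a).coeff m)).Finite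
  mul_right : ∀ a b b', P a (b * b') =
    ∑ᶠ m : ℤ, evalTensor (P.flip b) (P.flip b') ((deltaPlus ι a).coeff m)
  finite_left : ∀ a a' b, (Function.support fun m : ℤ =>
    evalTensor (P a') (P a) ((deltaMinus ι b).coeff m)).Finite
  mul_left : ∀ a a' b, P (a * a') b =
    ∑ᶠ m : ℤ, evalTensor (P a') (P a) ((deltaMinus ι b).coeff m)
  one_right : ∀ a, P a 1 = counit ι a
  one_left : ∀ b, P 1 b = counit ι b
  graded : ∀ α β, α ≠ β → ∀ a ∈ weightSpace α, ∀ b ∈ weightSpace β, P a b = 0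
  c_c : ∀ s t, (s = 1 ∨ s = -1) → (t = 1 ∨ t = -1) → P (cpow s) (cpow t) = 1
  c_h : ∀ s, (s = 1 ∨ s = -1) → ∀ i k, P (cpow s) (H i k) = if k = 0 then 1 else 0
  h_c : ∀ s, (s = 1 ∨ s = -1) → ∀ i k, P (H i k) (cpow s) = if k = 0 then 1 else 0
  c_hinv : ∀ s, (s = 1 ∨ s = -1) → ∀ i, P (cpow s) (Hinv i) = 1
  hinv_c : ∀ s, (s = 1 ∨ s = -1) → ∀ i, P (Hinv i) (cpow s) = 1
  c_x : ∀ s, (s = 1 ∨ s = -1) → ∀ i n, P (cpow s) (X i n) = 0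
  x_c : ∀ s, (s = 1 ∨ s = -1) → ∀ i n, P (X i n) (cpow s) = 0
  h_x : ∀ i k j n, P (H i k) (X j n) = 0
  x_h : ∀ j n i k, P (X j n) (H i k) = 0
  h_h : ∀ i k j l, P (H i k) (H j l) =
    if k = l then PowerSeries.coeff k (gSeries (qij A d q i j)) else 0
  hinv_h : ∀ i j, P (Hinv i) (H j 0) = (PowerSeries.coeff 0 (gSeries (qij A d q i j)))⁻¹
  h_hinv : ∀ i j, P (H i 0) (Hinv j) = (PowerSeries.coeff 0 (gSeries (qij A d q i j)))⁻¹
  x_x : ∀ i n j m, P (X i n) (X j m) = if i = j ∧ n = -m then κ else 0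

/-! ### Relations and weak Hopf ideals -/

/-- The coefficient of `z^{-n} w^{-m}` in
`(z - Q w) x_i(z) x_j(w) - (Q z - w) x_j(w) x_i(z)`. -/
def exchange {ι : Type u} (Q : ℂ) (i j : ι) (n m : ℤ) : Borel ι :=
  (X i (n + 1) * X j m - Q • (X i n * X j (m + 1))) -
    (Q • (X j m * X i (n + 1)) - X j (m + 1) * X i n)

/-- The coefficient of `z_1^{-n_1} ⋯ z_m^{-n_m} w^{-l}`, where `m = 1 - a_{ij}`, in
`∑_r (-1)^r [m choose r]_{q_i} Sym_z (x_i(z_1) ⋯ x_i(z_r) x_j(w) x_i(z_{r+1}) ⋯ x_i(z_m))`. -/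
def serre {ι : Type u} (A : Matrix ι ι ℤ) (d : ι → ℕ) (q : ℂ) (i j : ι)
    (n : Fin (1 - A i j).toNat → ℤ) (l : ℤ) : Borel ι :=
  ∑ r ∈ Finset.range ((1 - A i j).toNat + 1),
    ((-1) ^ r * qBinom (q ^ d i) (1 - A i j).toNat r) •
      ∑ σ : Equiv.Perm (Fin (1 - A i j).toNat),
        ((List.ofFn fun k => X i (n (σ k))).take r).prod * X j l *
          ((List.ofFn fun k => X i (n (σ k))).drop r).prod

/-- The Serre elements, for `i ≠ j`. -/
def serreSet {ι : Type u} (A : Matrix ι ι ℤ) (d : ι → ℕ) (q : ℂ) : Set (Borel ι) :=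
  {a | ∃ i j, i ≠ j ∧ ∃ n l, a = serre A d q i j n l}

/-- The elements `φ_{i,-k} φ_{j,-l} - φ_{j,-l} φ_{i,-k}` or `ψ_{i,k} ψ_{j,l} - ψ_{j,l} ψ_{i,k}`. -/
def cartanSet (ι : Type u) : Set (Borel ι) :=
  {a | ∃ i k j l, a = H i k * H j l - H j l * H i k}

/-- The coefficients of `φ_i(z) x⁺_j(w) - g_{ij}(z w⁻¹ q^{-c/2}) x⁺_j(w) φ_i(z)`. -/
def actionPlusSet {ι : Type u} (A : Matrix ι ι ℤ) (d : ι → ℕ) (q : ℂ) : Set (Borel ι) :=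
  {a | ∃ i n j m, a = H i n * X j m - ∑ p ∈ Finset.HasAntidiagonal.antidiagonal n,
    PowerSeries.coeff p.1 (gSeries (qij A d q i j)) • (cpow (-p.1) * X j (m - p.1) * H i p.2)}

/-- The coefficients of `ψ_i(z) x⁻_j(w) - g_{ij}(w z⁻¹ q^{c'/2}) x⁻_j(w) ψ_i(z)`. -/
def actionMinusSet {ι : Type u} (A : Matrix ι ι ℤ) (d : ι → ℕ) (q : ℂ) : Set (Borel ι) :=
  {a | ∃ i n j m, a = H i n * X j m - ∑ p ∈ Finset.HasAntidiagonal.antidiagonal n,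
    PowerSeries.coeff p.1 (gSeries (qij A d q i j)) • (cpow p.1 * X j (m + p.1) * H i p.2)}

/-- The coefficients of `(z - q_{ij} w) x⁺_i(z) x⁺_j(w) - (q_{ij} z - w) x⁺_j(w) x⁺_i(z)`. -/
def exchangePlusSet {ι : Type u} (A : Matrix ι ι ℤ) (d : ι → ℕ) (q : ℂ) : Set (Borel ι) :=
  {a | ∃ i j n m, a = exchange (qij A d q i j) i j n m}

/-- The coefficients of `(z - q_{ij}⁻¹ w) x⁻_i(z) x⁻_j(w) - (q_{ij}⁻¹ z - w) x⁻_j(w) x⁻_i(z)`. -/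
def exchangeMinusSet {ι : Type u} (A : Matrix ι ι ℤ) (d : ι → ℕ) (q : ℂ) : Set (Borel ι) :=
  {a | ∃ i j n m, a = exchange (qij A d q i j)⁻¹ i j n m}

/-- The two-sided ideal of the positive algebra generated by all its relations. -/
def idealPlus {ι : Type u} (A : Matrix ι ι ℤ) (d : ι → ℕ) (q : ℂ) : TwoSidedIdeal (Borel ι) :=
  TwoSidedIdeal.span
    (cartanSet ι ∪ actionPlusSet A d q ∪ exchangePlusSet A d q ∪ serreSet A d q)

/-- The two-sided ideal of the negative algebra generated by all its relations. -/
def idealMinus {ι : Type u} (A : Matrix ι ι ℤ) (d : ι → ℕ) (q : ℂ) : TwoSidedIdeal (Borel ι) :=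
  TwoSidedIdeal.span
    (cartanSet ι ∪ actionMinusSet A d q ∪ exchangeMinusSet A d q ∪ serreSet A d q)

/-- The subspace `I ⊗ U + U ⊗ I` of `U ⊗ U`. -/
def tensorIdeal {ι : Type u} (I : TwoSidedIdeal (Borel ι)) : Submodule ℂ (Borel ι ⊗[ℂ] Borel ι) :=
  Submodule.span ℂ {t | ∃ u v : Borel ι, (u ∈ I ∨ v ∈ I) ∧ t = u ⊗ₜ v}

/-- A weak Hopf ideal for the coproduct `Δ` and the antipode `S`: a two-sided ideal `I` with
`ε(I) = 0`, such that `Δ(I)` is in the completion of `I ⊗ U + U ⊗ I` (each component is in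
`I ⊗ U + U ⊗ I`), and `S(I)` is in the closure of `I` in the completed algebra. -/
structure IsWeakHopfIdeal {ι : Type u} (Δ : Borel ι →ₐ[ℂ] CompletedTensor ι)
    (S : Borel ι →ₐ[ℂ] (PowerSeries (Borel ι))ᵐᵒᵖ) (I : TwoSidedIdeal (Borel ι)) : Prop where
  counit_eq : ∀ a ∈ I, counit ι a = 0
  coideal : ∀ a ∈ I, ∀ m : ℤ, (Δ a).coeff m ∈ tensorIdeal I
  antipode : ∀ a ∈ I, ∀ N : ℕ, ∃ b ∈ I,
    (∑ k ∈ Finset.range (N + 1), PowerSeries.coeff k (S a).unop) - b ∈ hIdeal ι N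

end QAffine

end

/-!
Both Borel algebras are the same algebra `Borel ι`, and the map `theta`, which reverses the modes of
the root currents and inverts the central element, exchanges the two coproducts up to a swap of the
tensor factors and a shift of the loop degree (`deltaMinus_theta`). By this symmetry
one of the two duality axioms of the pairing, one of the two coideal properties and one of the two
kernels suffice.

*The pairing.* If the pairing exists, left multiplication by a generator of the negative algebra has
a dual operator on the positive algebra: for the Cartan current `ψ_j` an algebra morphism, for the
root current `x_j` a skew derivation. A morphism and a skew derivation together are the same as a
representation by triangular `2 × 2` matrices (`skewRep`), and since the algebra has so few
relations, the values on generators can be prescribed. The dual operators define an action of the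
negative algebra, and the pairing is the counit of its result (`pairing`). Multiplicativity of the
representation gives the Leibniz rule, which says that the coproduct of the negative algebra is dual
to the product of the positive one (`pairing_mul_left`). The pairing is invariant under `theta`
(`pairing_theta`), and so the other coproduct is dual to the other product. Uniqueness
(`IsWeakHopfPairing.unique`) holds since the coproduct of a generator involves only generators and
powers of the central element, which do not change the pairing.

*The coideal property.* For the relations that involve a Cartan current and for the quadratic
relations, a calculation with coefficients shows that the coproduct respects them modulo the ideal.
The coproduct of a root current is a sum of two currents `e` and `y`, and the coproduct of a Serre
series is the Serre series of the `e`, plus that of the `y`, plus mixed terms. To see that the mixed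
terms vanish (`mixed_serre_eq_zero`), let polynomials in the formal variables act on families of
modes. The quadratic relations allow one to bring all words into the same order after multiplication
by products of linear factors, and an alternating sum of such products vanishes
(`sum_wordFactor_serreWord`). This holds for every order, and the products for the different orders
have no common zero away from the zeros of the variables and of the factors that mix the two kinds
of currents (`exists_wordFactor_ne_zero`). By the Nullstellensatz a power of the product of these
remaining polynomials annihilates the mixed terms. But these polynomials act injectively: an `e`
moves the loop degree of the first factor with its mode, while a `y` bounds it from below
independently of its mode, so no nonzero distribution of bounded order is multiplied by a scalar
when a mode is moved from one kind to the other (`OrderBounded.eq_zero`).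

*The annihilators.* The matrices of two root currents have product zero after the counit is applied.
This kills the quadratic and the Serre relations, and since these matrices also respect the other
relations, the ideal pairs to zero with the generators of the negative algebra. By the coideal
property it pairs to zero with all products (`pairing_idealPlus`).

*The antipode.* The completed algebra is the inverse limit of the quotients by the two-sided ideals
of words of large degree in the Cartan currents. In such a quotient `φ_i(z)` and its inverse are
polynomials, and the relation between `φ_i(z)` and `x_i(w)` forces all modes of `x_i` to vanish
(`X_mem_closure`). So the closure of the ideal of the relations contains all root currents, and the
condition on the antipode is a condition on the relations between the Cartan currents only, where it
says that the inverses of commuting series commute.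
-/

open scoped TensorProduct

noncomputable section

namespace QAffine

universe u

/-! ### Exchange factors of words -/

/-- The product of `f a b` over the pairs of letters `a`, `b` of a word with `a` before `b`. -/
def wordFactor {L S : Type*} [CommRing S] (f : L → L → S) : List L → S
  | [] => 1
  | a :: l => (l.map (f a)).prod * wordFactor f l

section WordFactor
variable {L S : Type*} [CommRing S] (f : L → L → S)

lemma wordFactor_append_cons (l₁ l₂ : List L) (a : L) :
    wordFactor f (l₁ ++ a :: l₂) =
      (l₁.map fun c => f c a).prod * (l₂.map (f a)).prod * wordFactor f (l₁ ++ l₂) := by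
  induction l₁ with
  | nil => simp [wordFactor]
  | cons c l₁ ih =>
    simp only [List.cons_append, wordFactor, ih, List.map_append, List.map_cons, List.prod_append,
      List.prod_cons]
    ring

lemma wordFactor_swap (l₁ l₂ : List L) (a b : L) :
    wordFactor f (l₁ ++ a :: b :: l₂) * f b a = wordFactor f (l₁ ++ b :: a :: l₂) * f a b := by
  rw [wordFactor_append_cons, wordFactor_append_cons, wordFactor_append_cons,
    wordFactor_append_cons]
  simp only [List.map_cons, List.prod_cons]
  ring

lemma map_wordFactor {S' : Type*} [CommRing S'] (g : S →+* S') (l : List L) :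
    g (wordFactor f l) = wordFactor (fun a b => g (f a b)) l := by
  induction l with
  | nil => simp [wordFactor]
  | cons a l ih => simp [wordFactor, ih, map_list_prod, List.map_map, Function.comp_def]

lemma wordFactor_ne_zero [IsDomain S] {l : List L} (h : l.Pairwise fun a b => f a b ≠ 0) :
    wordFactor f l ≠ 0 := by
  induction l with
  | nil => simp [wordFactor]
  | cons a l ih =>
    rw [List.pairwise_cons] at h
    refine mul_ne_zero ?_ (ih h.2)
    intro h0
    rw [List.prod_eq_zero_iff, List.mem_map] at h0
    obtain ⟨b, hb, hb0⟩ := h0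
    exact h.1 b hb hb0

/-- If neighbouring letters of the words in a module may be exchanged at the cost of the factors
`f`, then so may be the letters of any two words that are permutations of each other. -/
lemma wordFactor_smul_perm {M : Type*} [AddCommGroup M] [Module S M] (W : List L → M)
    (hW : ∀ pre c a post, (pre ++ c :: a :: post).Nodup →
      f a c • W (pre ++ c :: a :: post) = f c a • W (pre ++ a :: c :: post)) (π : List L) :
    ∀ pre τ : List L, π.Perm τ → (pre ++ τ).Nodup →
      wordFactor f π • W (pre ++ τ) = wordFactor f τ • W (pre ++ π) := by
  -- moving one letter to the front of the word
  have move : ∀ (τ₁ τ₂ : List L) (a : L) (pre : List L), (pre ++ τ₁ ++ a :: τ₂).Nodup →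
      (τ₁.map (f a)).prod • W (pre ++ τ₁ ++ a :: τ₂) =
        (τ₁.map fun c => f c a).prod • W (pre ++ a :: (τ₁ ++ τ₂)) := by
    intro τ₁
    induction τ₁ with
    | nil => intro τ₂ a pre _; simp
    | cons c τ₁ ih =>
      intro τ₂ a pre h
      have e1 : pre ++ c :: τ₁ ++ a :: τ₂ = (pre ++ [c]) ++ τ₁ ++ a :: τ₂ := by simp
      have e2 : pre ++ [c] ++ a :: (τ₁ ++ τ₂) = pre ++ c :: a :: (τ₁ ++ τ₂) := by simp
      rw [e1] at h ⊢
      have h2 : (pre ++ c :: a :: (τ₁ ++ τ₂)).Nodup := by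
        refine (List.Perm.nodup_iff ?_).1 h
        simp only [List.append_assoc, List.singleton_append]
        refine List.Perm.append_left _ (List.Perm.cons _ ?_)
        exact List.perm_middle
      rw [List.map_cons, List.prod_cons, mul_smul, ih τ₂ a (pre ++ [c]) h, e2, smul_comm,
        hW _ _ _ _ h2, ← mul_smul, List.map_cons, List.prod_cons, mul_comm]
      simp
  induction π with
  | nil =>
    intro pre τ h _
    rw [List.nil_perm] at h
    subst h
    rfl
  | cons a π ih =>
    intro pre τ h hn
    have ha : a ∈ τ := h.subset (by simp)
    obtain ⟨τ₁, τ₂, rfl⟩ := List.append_of_mem ha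
    have hπ : π.Perm (τ₁ ++ τ₂) := by
      have := h.trans List.perm_middle
      exact List.Perm.cons_inv this
    have hn' : (pre ++ [a] ++ (τ₁ ++ τ₂)).Nodup := by
      refine (List.Perm.nodup_iff ?_).1 hn
      simp only [List.append_assoc, List.singleton_append]
      exact List.Perm.append_left _ List.perm_middle
    have key := ih (pre ++ [a]) (τ₁ ++ τ₂) hπ hn'
    have mv := move τ₁ τ₂ a pre (by simpa using hn)
    have hprod : (π.map (f a)).prod = (τ₁.map (f a)).prod * (τ₂.map (f a)).prod := by
      rw [(hπ.map (f a)).prod_eq, List.map_append, List.prod_append]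
    rw [wordFactor, hprod, wordFactor_append_cons]
    simp only [List.append_assoc, List.cons_append, List.nil_append] at *
    calc _ = (wordFactor f π * (τ₂.map (f a)).prod) •
          ((τ₁.map (f a)).prod • W (pre ++ (τ₁ ++ a :: τ₂))) := by
            rw [← mul_smul]; congr 1; ring
      _ = ((τ₁.map fun c => f c a).prod * (τ₂.map (f a)).prod) •
          (wordFactor f π • W (pre ++ a :: (τ₁ ++ τ₂))) := by
            rw [mv, ← mul_smul, ← mul_smul]; congr 1; ring
      _ = _ := by rw [key, ← mul_smul]

end WordFactor

/-! ### Gaussian binomial coefficients -/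

section QBinom
variable {q : ℂ}

lemma qInt_ne_zero (hq0 : q ≠ 0) (hq : ∀ n : ℕ, 0 < n → q ^ n ≠ 1) {k : ℕ} (hk : 0 < k) :
    qInt q k ≠ 0 := by
  have key : ∀ k : ℕ, 0 < k → q ^ k - q⁻¹ ^ k ≠ 0 := by
    intro k hk h
    apply hq (2 * k) (by omega)
    have h1 : q ^ k = (q ^ k)⁻¹ := by rw [← inv_pow]; exact sub_eq_zero.1 h
    have h2 : q ^ k ≠ 0 := pow_ne_zero _ hq0
    rw [two_mul, pow_add]
    nth_rewrite 2 [h1]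
    exact mul_inv_cancel₀ h2
  refine div_ne_zero (key k hk) ?_
  simpa using key 1 one_pos

lemma qFactorial_ne_zero (hq0 : q ≠ 0) (hq : ∀ n : ℕ, 0 < n → q ^ n ≠ 1) (n : ℕ) :
    qFactorial q n ≠ 0 :=
  Finset.prod_ne_zero_iff.2 fun _ _ => qInt_ne_zero hq0 hq (Nat.succ_pos _)

lemma qFactorial_succ (n : ℕ) : qFactorial q (n + 1) = qFactorial q n * qInt q (n + 1) :=
  Finset.prod_range_succ _ _

lemma qBinom_zero (hq0 : q ≠ 0) (hq : ∀ n : ℕ, 0 < n → q ^ n ≠ 1) (n : ℕ) : qBinom q n 0 = 1 := by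
  have := qFactorial_ne_zero hq0 hq n
  simp only [qBinom, Nat.sub_zero]
  rw [show qFactorial q 0 = 1 from rfl, one_mul, div_self this]

lemma qBinom_self (hq0 : q ≠ 0) (hq : ∀ n : ℕ, 0 < n → q ^ n ≠ 1) (n : ℕ) : qBinom q n n = 1 := by
  have := qFactorial_ne_zero hq0 hq n
  simp only [qBinom, Nat.sub_self]
  rw [show qFactorial q 0 = 1 from rfl, mul_one, div_self this]

lemma qInt_add (hq0 : q ≠ 0) (a b : ℕ) :
    qInt q (a + b) = q⁻¹ ^ a * qInt q b + q ^ b * qInt q a := by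
  simp only [qInt, pow_add, inv_pow]
  have := pow_ne_zero a hq0
  have := pow_ne_zero b hq0
  rw [mul_div_assoc', mul_div_assoc', ← add_div]
  congr 1
  field_simp
  ring

/-- Pascal's rule. -/
lemma qBinom_succ_succ (hq0 : q ≠ 0) (hq : ∀ n : ℕ, 0 < n → q ^ n ≠ 1) {n r : ℕ} (hr : r < n) :
    qBinom q (n + 1) (r + 1) = q⁻¹ ^ (r + 1) * qBinom q n (r + 1) + q ^ (n - r) * qBinom q n r := by
  obtain ⟨s, rfl⟩ : ∃ s, n = r + 1 + s := ⟨n - (r + 1), by omega⟩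
  have h1 := qFactorial_ne_zero hq0 hq r
  have h2 := qFactorial_ne_zero hq0 hq s
  have h3 := qInt_ne_zero hq0 hq (Nat.succ_pos r)
  have h4 := qInt_ne_zero hq0 hq (Nat.succ_pos s)
  have e1 : r + 1 + s + 1 - (r + 1) = s + 1 := by omega
  have e2 : r + 1 + s - (r + 1) = s := by omega
  have e3 : r + 1 + s - r = s + 1 := by omega
  have e4 : r + 1 + s + 1 = (r + 1) + (s + 1) := by omega
  simp only [qBinom, e1, e2, e3]
  rw [qFactorial_succ (r + 1 + s), e4, qInt_add hq0 (r + 1) (s + 1), qFactorial_succ r,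
    qFactorial_succ s]
  field_simp

end QBinom

/-! ### The alternating sum behind the Serre relation -/

/-- The exponent structure of the letters of a Serre word: `some s` stands for `x_i(z_s)` and `none`
for `x_j(w)`, and `serreQ q m a b` is the parameter of the exchange relation of the letters
`a` and `b` when `q = q_i` and `a_{ij} = 1 - m`. -/
def serreQ (q : ℂ) (m : ℕ) : Option (Fin m) → Option (Fin m) → ℂ
  | some _, some _ => q ^ 2
  | none, none => 1
  | _, _ => q ^ (1 - (m : ℤ))

/-- A sign that orders each pair of letters. -/
def letterSign {m : ℕ} : Option (Fin m) → Option (Fin m) → ℂ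
  | some s, some t => if s < t then 1 else -1
  | some _, none => 1
  | none, some _ => -1
  | none, none => 1

lemma letterSign_swap {m : ℕ} {a b : Option (Fin m)} (h : a ≠ b) :
    letterSign b a = -letterSign a b := by
  rcases a with _ | a <;> rcases b with _ | b <;> simp only [letterSign, neg_neg]
  · exact absurd rfl h
  · have h' : a ≠ b := fun e => h (by rw [e])
    rcases lt_or_gt_of_ne h' with h1 | h1
    · rw [if_pos h1, if_neg (not_lt_of_gt h1)]
    · rw [if_pos h1, if_neg (not_lt_of_gt h1), neg_neg]

lemma letterSign_sq {m : ℕ} (a b : Option (Fin m)) : letterSign a b * letterSign a b = 1 := by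
  rcases a with _ | a <;> rcases b with _ | b <;> simp only [letterSign] <;> try norm_num
  split_ifs <;> norm_num

lemma letterSign_ne_zero {m : ℕ} (a b : Option (Fin m)) : letterSign a b ≠ 0 := by
  intro h
  have := letterSign_sq a b
  rw [h] at this
  norm_num at this

lemma serreQ_comm (q : ℂ) (m : ℕ) (a b : Option (Fin m)) : serreQ q m a b = serreQ q m b a := by
  rcases a with _ | a <;> rcases b with _ | b <;> rfl

/-- The factor of a pair of letters, at a point `v`. -/
def pointFactor (q : ℂ) (m : ℕ) (v : Option (Fin m) → ℂ) (a b : Option (Fin m)) : ℂ :=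
  letterSign a b * (serreQ q m a b * v a - v b)

/-- The word `x_i(z_{σ 1}) ⋯ x_i(z_{σ r}) x_j(w) x_i(z_{σ (r+1)}) ⋯ x_i(z_{σ m})`. -/
def serreWord {m : ℕ} (σ : Equiv.Perm (Fin m)) (r : ℕ) : List (Option (Fin m)) :=
  ((List.ofFn fun k => some (σ k)).take r) ++ none :: ((List.ofFn fun k => some (σ k)).drop r)

/-- The coefficients of `∏_{k < n} (1 + q ^ (1 - m + 2 k) T)`. -/
def gaussCoeff (q : ℂ) (m : ℕ) : ℕ → ℕ → ℂ
  | 0, 0 => 1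
  | 0, _ + 1 => 0
  | n + 1, 0 => gaussCoeff q m n 0
  | n + 1, r + 1 =>
      gaussCoeff q m n (r + 1) + q ^ (1 - (m : ℤ) + 2 * n) * gaussCoeff q m n r

lemma gaussCoeff_of_lt (q : ℂ) (m : ℕ) : ∀ n r : ℕ, n < r → gaussCoeff q m n r = 0 := by
  intro n
  induction n with
  | zero =>
    intro r hr
    obtain ⟨r, rfl⟩ := Nat.exists_eq_succ_of_ne_zero (by omega : r ≠ 0)
    rfl
  | succ n ih =>
    intro r hr
    obtain ⟨r, rfl⟩ := Nat.exists_eq_succ_of_ne_zero (by omega : r ≠ 0)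
    simp only [gaussCoeff]
    rw [ih _ (by omega), ih _ (by omega)]
    simp

lemma gaussCoeff_eq {q : ℂ} (hq0 : q ≠ 0) (hq : ∀ n : ℕ, 0 < n → q ^ n ≠ 1) (m : ℕ) :
    ∀ n r : ℕ, r ≤ n → gaussCoeff q m n r = q ^ ((r : ℤ) * (n - m)) * qBinom q n r := by
  intro n
  induction n with
  | zero =>
    intro r hr
    obtain rfl : r = 0 := by omega
    simp [gaussCoeff, qBinom_zero hq0 hq]
  | succ n ih =>
    intro r hr
    rcases r with _ | r
    · simp only [gaussCoeff]
      rw [ih 0 (by omega)]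
      simp [qBinom_zero hq0 hq]
    · simp only [gaussCoeff]
      rw [ih r (by omega)]
      rcases Nat.lt_or_ge r n with h | h
      · rw [ih (r + 1) (by omega), qBinom_succ_succ hq0 hq h, mul_add, ← mul_assoc, ← mul_assoc,
          ← mul_assoc]
        congr 2
        · rw [inv_pow, ← zpow_natCast, ← zpow_neg, ← zpow_add₀ hq0]
          congr 1
          push_cast
          ring
        · rw [← zpow_natCast q (n - r), ← zpow_add₀ hq0, ← zpow_add₀ hq0]
          congr 1
          push_cast [Nat.cast_sub h.le]
          ring
      · obtain rfl : r = n := by omega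
        rw [gaussCoeff_of_lt q m r (r + 1) (by omega), qBinom_self hq0 hq, qBinom_self hq0 hq,
          zero_add, mul_one, mul_one, ← zpow_add₀ hq0]
        congr 1
        push_cast
        ring

/-- Iterated `q`-commutators: `serreRec q m w n o u` is the value of the `n`-fold one in the
variables `u o, …, u (o + n - 1)`. -/
def serreRec (q : ℂ) (m : ℕ) (w : ℂ) : ℕ → ℕ → (ℕ → ℂ) → ℂ
  | 0, _ => fun _ => 1
  | n + 1, o => fun u => serreRec q m w n o u * (u (o + n) - q ^ (1 - (m : ℤ)) * w) -
      q ^ (1 - (m : ℤ) + 2 * n) * ((q ^ (1 - (m : ℤ)) * u o - w) * serreRec q m w n (o + 1) u)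

lemma serreRec_eq (q : ℂ) (m : ℕ) (w : ℂ) (u : ℕ → ℂ) : ∀ n o : ℕ, serreRec q m w n o u =
    ∑ r ∈ Finset.range (n + 1), (-1) ^ r * gaussCoeff q m n r *
      ((∏ t ∈ Finset.range r, (q ^ (1 - (m : ℤ)) * u (o + t) - w)) *
        ∏ t ∈ Finset.range (n - r), (u (o + (r + t)) - q ^ (1 - (m : ℤ)) * w)) := by
  intro n
  induction n with
  | zero => intro o; simp [serreRec, gaussCoeff]
  | succ n ih =>
    intro o
    set Q := q ^ (1 - (m : ℤ)) with hQ
    set P : ℕ → ℂ := fun r => (∏ t ∈ Finset.range r, (Q * u (o + t) - w)) *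
        ∏ t ∈ Finset.range (n + 1 - r), (u (o + (r + t)) - Q * w) with hP
    have h1 : serreRec q m w n o u * (u (o + n) - Q * w) =
        ∑ r ∈ Finset.range (n + 1), (-1) ^ r * gaussCoeff q m n r * P r := by
      rw [ih, Finset.sum_mul]
      refine Finset.sum_congr rfl fun r hr => ?_
      have hr' : r ≤ n := by simpa [Nat.lt_succ_iff] using hr
      have e : n + 1 - r = (n - r) + 1 := by omega
      simp only [hP]
      rw [e, Finset.prod_range_succ, show r + (n - r) = n by omega]
      ring
    have h2 : (Q * u o - w) * serreRec q m w n (o + 1) u =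
        ∑ r ∈ Finset.range (n + 1), (-1) ^ r * gaussCoeff q m n r * P (r + 1) := by
      rw [ih, Finset.mul_sum]
      refine Finset.sum_congr rfl fun r _ => ?_
      simp only [hP]
      rw [Finset.prod_range_succ', Nat.add_sub_add_right]
      simp only [add_zero]
      have e1 : ∀ t, o + 1 + t = o + (t + 1) := fun t => by ring
      have e2 : ∀ t, r + t + 1 = r + 1 + t := fun t => by ring
      simp only [e1, e2]
      ring
    have h3 : ∑ r ∈ Finset.range (n + 1), (-1) ^ r * gaussCoeff q m n r * P r =
        gaussCoeff q m n 0 * P 0 + ∑ r ∈ Finset.range (n + 1),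
          (-1) ^ (r + 1) * gaussCoeff q m n (r + 1) * P (r + 1) := by
      have := Finset.sum_range_succ (fun r => (-1 : ℂ) ^ r * gaussCoeff q m n r * P r) (n + 1)
      rw [gaussCoeff_of_lt q m n (n + 1) (by omega), mul_zero, zero_mul, add_zero] at this
      rw [← this, Finset.sum_range_succ', pow_zero, one_mul, add_comm]
    simp only [serreRec]
    rw [← hQ, h1, h2, h3]
    rw [Finset.sum_range_succ' _ (n + 1), pow_zero, one_mul, Finset.mul_sum, add_sub_assoc,
      ← Finset.sum_sub_distrib, add_comm]
    congr 1
    refine Finset.sum_congr rfl fun r _ => ?_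
    simp only [gaussCoeff, hP]
    ring

section Alternating
variable {m : ℕ} (q : ℂ) (v : Option (Fin m) → ℂ)

/-- The values of the variables `z_{σ 0}, z_{σ 1}, …` at the point `v`. -/
def permValues (σ : Equiv.Perm (Fin m)) (k : ℕ) : ℂ :=
  if h : k < m then v (some (σ ⟨k, h⟩)) else 0

/-- The sum of `c` over the permutations of the variables, weighted by the factors of the words. -/
def alternate : ((ℕ → ℂ) → ℂ) →ₗ[ℂ] ℂ where
  toFun c := ∑ σ : Equiv.Perm (Fin m),
    wordFactor (pointFactor q m v) (List.ofFn fun k => some (σ k)) * c (permValues v σ)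
  map_add' c c' := by simp [mul_add, Finset.sum_add_distrib]
  map_smul' a c := by
    simp only [Pi.smul_apply, smul_eq_mul, Finset.mul_sum, RingHom.id_apply]
    exact Finset.sum_congr rfl fun _ _ => by ring

lemma ofFn_split {α : Type*} {k : ℕ} (f : Fin m → α) (hk : k + 1 < m) :
    List.ofFn f = (List.ofFn f).take k ++ f ⟨k, by omega⟩ :: f ⟨k + 1, hk⟩ ::
      (List.ofFn f).drop (k + 2) := by
  conv_lhs => rw [← List.take_append_drop k (List.ofFn f)]
  rw [List.drop_eq_getElem_cons (by simp; omega), List.drop_eq_getElem_cons (by simp; omega)]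
  simp

lemma ofFn_comp_swap {α : Type*} {k : ℕ} (f : Fin m → α) (hk : k + 1 < m) :
    List.ofFn (fun t => f (Equiv.swap (⟨k, by omega⟩ : Fin m) ⟨k + 1, hk⟩ t)) =
      (List.ofFn f).take k ++ f ⟨k + 1, hk⟩ :: f ⟨k, by omega⟩ :: (List.ofFn f).drop (k + 2) := by
  rw [ofFn_split _ hk, Equiv.swap_apply_left, Equiv.swap_apply_right]
  congr 1
  · apply List.ext_getElem (by simp)
    intro t h1 h2
    simp only [List.length_take, List.length_ofFn] at h1
    simp only [List.getElem_take, List.getElem_ofFn]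
    rw [Equiv.swap_apply_of_ne_of_ne]
    · intro h; rw [Fin.ext_iff] at h; simp at h; omega
    · intro h; rw [Fin.ext_iff] at h; simp at h; omega
  · congr 2
    apply List.ext_getElem (by simp)
    intro t h1 h2
    simp only [List.getElem_drop, List.getElem_ofFn]
    rw [Equiv.swap_apply_of_ne_of_ne]
    · intro h; rw [Fin.ext_iff] at h; simp at h; omega
    · intro h; rw [Fin.ext_iff] at h; simp at h; omega

lemma permValues_mul_swap (σ : Equiv.Perm (Fin m)) {k : ℕ} (hk : k + 1 < m) :
    permValues v (σ * Equiv.swap ⟨k, by omega⟩ ⟨k + 1, hk⟩) =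
      permValues v σ ∘ Equiv.swap k (k + 1) := by
  funext t
  simp only [permValues, Function.comp_apply, Equiv.Perm.mul_apply]
  by_cases h1 : t = k
  · subst h1; simp [hk, show t < m by omega]
  by_cases h2 : t = k + 1
  · subst h2; simp [hk, show k < m by omega]
  rw [Equiv.swap_apply_of_ne_of_ne h1 h2]
  by_cases ht : t < m
  · rw [dif_pos ht, dif_pos ht, Equiv.swap_apply_of_ne_of_ne]
    · simpa [Fin.ext_iff] using h1
    · simpa [Fin.ext_iff] using h2
  · rw [dif_neg ht, dif_neg ht]

/-- Up to the kernel of `alternate`, the `k`-th variable is `q ^ 2` times the next one. -/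
lemma alternate_adjacent {k : ℕ} (hk : k + 1 < m) (c : (ℕ → ℂ) → ℂ)
    (hc : ∀ u, c (u ∘ Equiv.swap k (k + 1)) = c u) :
    alternate q v (fun u => (u k - q ^ 2 * u (k + 1)) * c u) = 0 := by
  set s : Equiv.Perm (Fin m) := Equiv.swap ⟨k, by omega⟩ ⟨k + 1, hk⟩ with hs
  have hneg : alternate q v (fun u => (u k - q ^ 2 * u (k + 1)) * c u) =
      -alternate q v (fun u => (u k - q ^ 2 * u (k + 1)) * c u) := by
    simp only [alternate, LinearMap.coe_mk, AddHom.coe_mk]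
    conv_lhs => rw [← Equiv.sum_comp (Equiv.mulRight s)]
    rw [← Finset.sum_neg_distrib]
    refine Finset.sum_congr rfl fun σ _ => ?_
    have hperm : permValues v (σ * s) = _ := permValues_mul_swap v σ hk
    rw [Equiv.coe_mulRight, hperm, hc]
    set a : Option (Fin m) := some (σ ⟨k, by omega⟩) with ha
    set b : Option (Fin m) := some (σ ⟨k + 1, hk⟩) with hb
    have hab : a ≠ b := by
      intro h
      have := σ.injective (Option.some.inj h)
      simp at this
    have hw := wordFactor_swap (pointFactor q m v)
      ((List.ofFn fun t => some (σ t)).take k) ((List.ofFn fun t => some (σ t)).drop (k + 2)) a b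
    have hl : (List.ofFn fun t => some (σ t)) = _ := ofFn_split (fun t => some (σ t)) hk
    have hl' : (List.ofFn fun t => some ((σ * s) t)) = _ :=
      ofFn_comp_swap (fun t => some (σ t)) hk
    rw [← ha, ← hb] at hl hl'
    rw [← hl, ← hl'] at hw
    have hua : permValues v σ k = v a := by
      simp [permValues, ha, show k < m by omega]
    have hub : permValues v σ (k + 1) = v b := by simp [permValues, hb, hk]
    simp only [Function.comp_apply, Equiv.swap_apply_left, Equiv.swap_apply_right, hua, hub]
    have e1 : pointFactor q m v a b = letterSign a b * (q ^ 2 * v a - v b) := rfl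
    have e2 : pointFactor q m v b a = -letterSign a b * (q ^ 2 * v b - v a) := by
      rw [← letterSign_swap hab]; rfl
    rw [e1, e2] at hw
    have hsq := letterSign_sq a b
    set W := wordFactor (pointFactor q m v) (List.ofFn fun t => some (σ t))
    set W' := wordFactor (pointFactor q m v) (List.ofFn fun t => some ((σ * s) t))
    linear_combination (c (permValues v σ) * letterSign a b) * hw -
      c (permValues v σ) * (W' * (v b - q ^ 2 * v a) + W * (v a - q ^ 2 * v b)) * hsq
  linear_combination (1 / 2) * hneg

/-- A product of consecutive variables may be shifted by one place. -/
lemma alternate_shift {n o : ℕ} (hn : o + n + 1 ≤ m) (f : (ℕ → ℂ) → ℂ)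
    (hf : ∀ k, o ≤ k → k < o + n → ∀ u, f (u ∘ Equiv.swap k (k + 1)) = f u) :
    alternate q v (fun u => (∏ t ∈ Finset.range n, u (o + t)) * f u) =
      q ^ (2 * n) * alternate q v (fun u => (∏ t ∈ Finset.range n, u (o + (t + 1))) * f u) := by
  have step : ∀ j ≤ n, alternate q v
      (fun u => (∏ t ∈ (Finset.range (n + 1)).erase j, u (o + t)) * f u) =
      q ^ (2 * j) * alternate q v (fun u => (∏ t ∈ Finset.range n, u (o + (t + 1))) * f u) := by
    intro j
    induction j with
    | zero =>
      intro _
      simp only [mul_zero, pow_zero, one_mul]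
      congr 1
      funext u
      congr 1
      rw [Finset.range_eq_Ico, Finset.range_eq_Ico,
        Finset.prod_Ico_add' (fun t => u (o + t)) 0 n 1]
      refine Finset.prod_congr ?_ fun _ _ => rfl
      ext t
      simp only [Finset.mem_erase, Finset.mem_Ico]
      omega
    | succ j ih =>
      intro hj
      have hR : ∀ u : ℕ → ℂ, (∏ t ∈ ((Finset.range (n + 1)).erase j).erase (j + 1),
          (u ∘ Equiv.swap (o + j) (o + j + 1)) (o + t)) =
          ∏ t ∈ ((Finset.range (n + 1)).erase j).erase (j + 1), u (o + t) := by
        intro u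
        refine Finset.prod_congr rfl fun t ht => ?_
        simp only [Finset.mem_erase] at ht
        rw [Function.comp_apply, Equiv.swap_apply_of_ne_of_ne (by omega) (by omega)]
      have hadj := alternate_adjacent q v (k := o + j) (by omega)
        (fun u => (∏ t ∈ ((Finset.range (n + 1)).erase j).erase (j + 1), u (o + t)) * f u)
        (fun u => by simp only [hR]; rw [hf _ (by omega) (by omega)])
      have e1 : ∀ u : ℕ → ℂ, ∏ t ∈ (Finset.range (n + 1)).erase j, u (o + t) =
          u (o + j + 1) * ∏ t ∈ ((Finset.range (n + 1)).erase j).erase (j + 1), u (o + t) := by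
        intro u
        rw [← Finset.mul_prod_erase _ _ (show j + 1 ∈ (Finset.range (n + 1)).erase j by
          simp; omega)]
        rfl
      have e2 : ∀ u : ℕ → ℂ, ∏ t ∈ (Finset.range (n + 1)).erase (j + 1), u (o + t) =
          u (o + j) * ∏ t ∈ ((Finset.range (n + 1)).erase j).erase (j + 1), u (o + t) := by
        intro u
        rw [Finset.erase_right_comm, ← Finset.mul_prod_erase _ _
          (show j ∈ (Finset.range (n + 1)).erase (j + 1) by simp; omega)]
      have hsplit : alternate q v
          (fun u => (∏ t ∈ (Finset.range (n + 1)).erase (j + 1), u (o + t)) * f u) -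
          q ^ 2 * alternate q v
            (fun u => (∏ t ∈ (Finset.range (n + 1)).erase j, u (o + t)) * f u) = 0 := by
        rw [← smul_eq_mul, ← map_smul, ← map_sub, ← hadj]
        congr 1
        funext u
        simp only [Pi.sub_apply, Pi.smul_apply, smul_eq_mul, e1, e2]
        ring
      rw [sub_eq_zero.1 hsplit, ih (by omega)]
      ring
  rw [← step n le_rfl]
  congr 1
  funext u
  congr 1
  refine Finset.prod_congr ?_ fun _ _ => rfl
  ext t
  simp only [Finset.mem_erase, Finset.mem_range]
  omega

/-- Up to the kernel of `alternate`, an iterated `q`-commutator is a multiple of the product of its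
variables. -/
lemma alternate_serreRec (hq0 : q ≠ 0) (n : ℕ) : ∀ (o : ℕ) (f : (ℕ → ℂ) → ℂ), o + n ≤ m →
    (∀ k, o ≤ k → k + 1 < o + n → ∀ u, f (u ∘ Equiv.swap k (k + 1)) = f u) →
    alternate q v (fun u => serreRec q m (v none) n o u * f u) =
      (∏ t ∈ Finset.range n, (1 - q ^ (2 - 2 * (m : ℤ) + 2 * t))) *
        alternate q v (fun u => (∏ t ∈ Finset.range n, u (o + t)) * f u) := by
  induction n with
  | zero => intro o f _ _; simp [serreRec]
  | succ n ih =>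
    intro o f ho hf
    set Q := q ^ (1 - (m : ℤ)) with hQ
    set w := v none with hw
    set C := ∏ t ∈ Finset.range n, (1 - q ^ (2 - 2 * (m : ℤ) + 2 * t)) with hC
    have i1 := ih o (fun u => (u (o + n) - Q * w) * f u) (by omega) (fun k h1 h2 u => by
      simp only [Function.comp_apply]
      rw [hf k h1 (by omega), Equiv.swap_apply_of_ne_of_ne (by omega) (by omega)])
    have i2 := ih (o + 1) (fun u => (Q * u o - w) * f u) (by omega) (fun k h1 h2 u => by
      simp only [Function.comp_apply]
      rw [hf k (by omega) (by omega), Equiv.swap_apply_of_ne_of_ne (by omega) (by omega)])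
    have hs := alternate_shift q v (n := n) (o := o) (by omega) f
      (fun k h1 h2 u => hf k h1 (by omega) u)
    have e1 : (fun u => serreRec q m w (n + 1) o u * f u) =
        (fun u => serreRec q m w n o u * ((u (o + n) - Q * w) * f u)) -
          q ^ (1 - (m : ℤ) + 2 * n) •
            (fun u => serreRec q m w n (o + 1) u * ((Q * u o - w) * f u)) := by
      funext u
      simp only [serreRec, Pi.sub_apply, Pi.smul_apply, smul_eq_mul]
      ring
    set A := alternate q v (fun u => (∏ t ∈ Finset.range (n + 1), u (o + t)) * f u) with hA
    set B := alternate q v (fun u => (∏ t ∈ Finset.range n, u (o + (t + 1))) * f u) with hB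
    have e2 : alternate q v
        (fun u => (∏ t ∈ Finset.range n, u (o + t)) * ((u (o + n) - Q * w) * f u)) =
        A - Q * w * (q ^ (2 * n) * B) := by
      rw [← hs, hA, ← smul_eq_mul (Q * w), ← map_smul, ← map_sub]
      congr 1
      funext u
      simp only [Pi.sub_apply, Pi.smul_apply, smul_eq_mul, Finset.prod_range_succ]
      ring
    have e3 : alternate q v
        (fun u => (∏ t ∈ Finset.range n, u (o + 1 + t)) * ((Q * u o - w) * f u)) =
        Q * A - w * B := by
      rw [hA, hB, ← smul_eq_mul Q (alternate _ _ _), ← smul_eq_mul w (alternate _ _ _), ← map_smul,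
        ← map_smul, ← map_sub]
      congr 1
      funext u
      simp only [Pi.sub_apply, Pi.smul_apply, smul_eq_mul, Finset.prod_range_succ', add_zero]
      have e : ∀ t, o + 1 + t = o + (t + 1) := fun t => by ring
      simp only [e]
      ring
    have e4 : q ^ (1 - (m : ℤ) + 2 * n) = Q * q ^ (2 * n) := by
      rw [zpow_add₀ hq0, hQ]
      norm_cast
    have e5 : q ^ (2 - 2 * (m : ℤ) + 2 * n) = Q * Q * q ^ (2 * n) := by
      rw [zpow_add₀ hq0, show 2 - 2 * (m : ℤ) = 1 - m + (1 - m) by ring, zpow_add₀ hq0, hQ]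
      norm_cast
    rw [e1, map_sub, map_smul, i1, i2, e2, e3, Finset.prod_range_succ, smul_eq_mul, e4, e5]
    ring

lemma wordFactor_serreWord (σ : Equiv.Perm (Fin m)) {r : ℕ} (hr : r ≤ m) :
    wordFactor (pointFactor q m v) (serreWord σ r) =
      wordFactor (pointFactor q m v) (List.ofFn fun k => some (σ k)) *
        ((∏ t ∈ Finset.range r, (q ^ (1 - (m : ℤ)) * permValues v σ t - v none)) *
        ∏ t ∈ Finset.range (m - r), (permValues v σ (r + t) - q ^ (1 - (m : ℤ)) * v none)) := by
  rw [serreWord, wordFactor_append_cons, List.take_append_drop, mul_comm]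
  have h1 : (((List.ofFn fun k => some (σ k)).take r).map
      fun c => pointFactor q m v c none) = (List.range r).map
        fun t => q ^ (1 - (m : ℤ)) * permValues v σ t - v none := by
    apply List.ext_getElem (by simp [hr])
    intro t h1 h2
    simp only [List.length_map, List.length_range] at h2
    simp [permValues, pointFactor, letterSign, serreQ, show t < m by omega]
  have h2 : (((List.ofFn fun k => some (σ k)).drop r).map (pointFactor q m v none)) =
      (List.range (m - r)).map
        fun t => permValues v σ (r + t) - q ^ (1 - (m : ℤ)) * v none := by
    apply List.ext_getElem (by simp)
    intro t h1 h2
    simp only [List.length_map, List.length_range] at h2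
    simp [permValues, pointFactor, letterSign, serreQ, show r + t < m by omega]
  rw [h1, h2, Finset.prod_range, Finset.prod_range, ← List.prod_ofFn, ← List.prod_ofFn]
  congr 2
  · congr 1
    apply List.ext_getElem <;> simp
  · congr 1
    apply List.ext_getElem <;> simp

/-- The alternating sum that makes the Serre relation hold in the shuffle algebra. -/
theorem sum_wordFactor_serreWord (hq0 : q ≠ 0) (hq : ∀ n : ℕ, 0 < n → q ^ n ≠ 1) (hm : 0 < m) :
    ∑ r ∈ Finset.range (m + 1), ∑ σ : Equiv.Perm (Fin m), ((-1) ^ r * qBinom q m r) *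
      wordFactor (pointFactor q m v) (serreWord σ r) = 0 := by
  have h := alternate_serreRec q v hq0 m 0 (fun _ => 1) (by omega) (fun _ _ _ _ => rfl)
  have hC : ∏ t ∈ Finset.range m, (1 - q ^ (2 - 2 * (m : ℤ) + 2 * t)) = 0 := by
    apply Finset.prod_eq_zero (i := m - 1) (by simp; omega)
    have : 2 - 2 * (m : ℤ) + 2 * ((m - 1 : ℕ) : ℤ) = 0 := by omega
    rw [this, zpow_zero, sub_self]
  rw [hC, zero_mul] at h
  rw [Finset.sum_comm, ← h]
  simp only [alternate, LinearMap.coe_mk, AddHom.coe_mk, mul_one]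
  refine Finset.sum_congr rfl fun σ _ => ?_
  rw [serreRec_eq, Finset.mul_sum]
  refine Finset.sum_congr rfl fun r hr => ?_
  have hr' : r ≤ m := by simpa [Nat.lt_succ_iff] using hr
  rw [wordFactor_serreWord q v σ hr', gaussCoeff_eq hq0 hq m m r hr', sub_self, mul_zero, zpow_zero,
    one_mul]
  simp only [zero_add]
  ring

end Alternating

/-! ### Polynomials acting on families of modes -/

/-- Families indexed by the exponents of the formal variables: `f n` is the coefficient of
`∏ₐ z_a ^ (-n a)` of a formal distribution. -/
def ModeFun (L T : Type*) : Type _ := (L → ℤ) → T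

section ModeFun
variable {L T : Type*} [AddCommGroup T] [Module ℂ T]

instance : AddCommGroup (ModeFun L T) := inferInstanceAs (AddCommGroup ((L → ℤ) → T))
instance : Module ℂ (ModeFun L T) := inferInstanceAs (Module ℂ ((L → ℤ) → T))

/-- Multiplication by a monomial shifts the modes. -/
def shift (s : L →₀ ℕ) : Module.End ℂ (ModeFun L T) where
  toFun f := fun n => f (fun a => n a + (s a : ℤ))
  map_add' _ _ := rfl
  map_smul' _ _ := rfl

lemma shift_apply (s : L →₀ ℕ) (f : ModeFun L T) (n : L → ℤ) :
    shift s f n = f (fun a => n a + (s a : ℤ)) := rfl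

/-- The shifts as a representation of the monoid of monomials. -/
def shiftHom (L T : Type*) [AddCommGroup T] [Module ℂ T] :
    Multiplicative (L →₀ ℕ) →* Module.End ℂ (ModeFun L T) where
  toFun s := shift s.toAdd
  map_one' := by
    refine LinearMap.ext fun f => funext fun n => ?_
    simp [shift_apply]
  map_mul' s t := by
    refine LinearMap.ext fun f => funext fun n => ?_
    rw [Module.End.mul_apply, shift_apply, shift_apply, shift_apply]
    simp [add_assoc]

/-- The action of polynomials on formal distributions. -/
def modeAct (L T : Type*) [AddCommGroup T] [Module ℂ T] :
    MvPolynomial L ℂ →ₐ[ℂ] Module.End ℂ (ModeFun L T) :=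
  AddMonoidAlgebra.lift ℂ _ _ (shiftHom L T)

instance : Module (MvPolynomial L ℂ) (ModeFun L T) := Module.compHom _ (modeAct L T).toRingHom

lemma poly_smul_def (p : MvPolynomial L ℂ) (f : ModeFun L T) : p • f = modeAct L T p f := rfl

lemma C_smul_mode (c : ℂ) (f : ModeFun L T) :
    (MvPolynomial.C c : MvPolynomial L ℂ) • f = c • f := by
  rw [poly_smul_def, ← MvPolynomial.algebraMap_eq, AlgHom.commutes]
  rfl

lemma X_smul_mode [DecidableEq L] (a : L) (f : ModeFun L T) (n : L → ℤ) :
    ((MvPolynomial.X a : MvPolynomial L ℂ) • f) n = f (n + Pi.single a 1) := by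
  have h : modeAct L T (MvPolynomial.X a) =
      shiftHom L T (Multiplicative.ofAdd (Finsupp.single a 1)) := by
    have := AddMonoidAlgebra.lift_single (R := ℂ) (shiftHom L T) (Finsupp.single a 1) 1
    rw [one_smul] at this
    exact this
  rw [poly_smul_def, h]
  refine (shift_apply _ _ _).trans (congrArg f (funext fun b => ?_))
  simp only [toAdd_ofAdd, Pi.add_apply]
  by_cases hb : b = a
  · subst hb; simp
  · simp [hb]

end ModeFun

/-- The commutation relation `(z - Q w) a(z) b(w) = (Q z - w) b(w) a(z)` of two currents. -/
def ExchangeRel {T : Type*} [Ring T] [Algebra ℂ T] (Q : ℂ) (a b : ℤ → T) : Prop :=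
  ∀ n m, a (n + 1) * b m - Q • (a n * b (m + 1)) = Q • (b m * a (n + 1)) - b (m + 1) * a n

lemma ExchangeRel.symm {T : Type*} [Ring T] [Algebra ℂ T] {Q : ℂ} {a b : ℤ → T}
    (h : ExchangeRel Q a b) : ExchangeRel Q b a := by
  intro n m
  have := h m n
  rw [sub_eq_sub_iff_add_eq_add] at this ⊢
  rw [add_comm (Q • _), ← this, add_comm]

/-! ### Vanishing of the mixed part of a Serre relation -/

section Mixed
variable {m : ℕ} (q : ℂ)

/-- The exchange factor of two letters, as a polynomial. -/
def letterFactor (m : ℕ) (a b : Option (Fin m)) : MvPolynomial (Option (Fin m)) ℂ :=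
  MvPolynomial.C (letterSign a b) *
    (MvPolynomial.C (serreQ q m a b) * MvPolynomial.X a - MvPolynomial.X b)

lemma eval_wordFactor (v : Option (Fin m) → ℂ) (l : List (Option (Fin m))) :
    MvPolynomial.eval v (wordFactor (letterFactor q m) l) = wordFactor (pointFactor q m v) l := by
  rw [map_wordFactor]
  simp only [letterFactor, map_mul, map_sub, MvPolynomial.eval_C, MvPolynomial.eval_X]
  rfl

/-- On the multiplicative group of `ℂ` there is an integer valued function that increases by one
under multiplication by a number that is not a root of unity. -/
lemma exists_log {p : ℂ} (hp0 : p ≠ 0) (hp : ∀ n : ℕ, 0 < n → p ^ n ≠ 1) :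
    ∃ ℓ : ℂ → ℤ, ∀ x, x ≠ 0 → ℓ (p * x) = ℓ x + 1 := by
  classical
  set u : ℂˣ := Units.mk0 p hp0 with hu
  have hinj : Function.Injective fun k : ℤ => u ^ k := by
    rw [injective_zpow_iff_not_isOfFinOrder, isOfFinOrder_iff_pow_eq_one]
    rintro ⟨n, hn, h⟩
    refine hp n hn ?_
    have := congrArg Units.val h
    simpa [hu] using this
  have hex : ∀ x : ℂˣ, ∃ k : ℤ,
      x = (Quotient.out (QuotientGroup.mk x : ℂˣ ⧸ Subgroup.zpowers u)) * u ^ k := by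
    intro x
    have h1 : (QuotientGroup.mk (Quotient.out (QuotientGroup.mk x : ℂˣ ⧸ Subgroup.zpowers u)) :
        ℂˣ ⧸ Subgroup.zpowers u) = QuotientGroup.mk x := QuotientGroup.out_eq' _
    rw [QuotientGroup.eq, Subgroup.mem_zpowers_iff] at h1
    obtain ⟨k, hk⟩ := h1
    exact ⟨k, by rw [hk, mul_inv_cancel_left]⟩
  choose k hk using hex
  refine ⟨fun x => if h : x = 0 then 0 else k (Units.mk0 x h), fun x hx => ?_⟩
  have hpx : p * x ≠ 0 := mul_ne_zero hp0 hx
  simp only [dif_neg hpx, dif_neg hx]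
  have e : Units.mk0 (p * x) hpx = Units.mk0 x hx * u := by
    ext
    simp [hu, mul_comm]
  rw [e]
  set y := Units.mk0 x hx
  have hy : (QuotientGroup.mk (y * u) : ℂˣ ⧸ Subgroup.zpowers u) = QuotientGroup.mk y := by
    rw [QuotientGroup.eq]
    simp [mul_inv_rev]
  have h1 := hk (y * u)
  have h2 := hk y
  rw [hy] at h1
  have h3 : u ^ k (y * u) = u ^ (k y + 1) := by
    rw [zpow_add, zpow_one]
    have := h1.symm.trans (congrArg (· * u) h2)
    simpa [mul_assoc] using this
  exact hinj h3

/-- At a point where none of the factors of letters of different colours vanishes, some order of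
the letters has a nonzero factor. The pairs of letters whose factor vanishes are the edges of a
directed graph, which is to have no cycle. Along an edge the value goes from `w` to `Q w`, from `z`
to `q² z`, or from `Q⁻¹ w` to `w`, where `w = v none`, `y = Q w` and `Q⁻¹ w = (q²)^(m-1) y`. Since `q`
is not a root of unity, a cycle has to visit `none` and the values `y, q² y, …, (q²)^(m-1) y`, that
is, all the `m + 1` letters, but these do not have the same colour. -/
lemma exists_wordFactor_ne_zero (hq0 : q ≠ 0) (hq : ∀ n : ℕ, 0 < n → q ^ n ≠ 1)
    (col : Option (Fin m) → Prop) (hcol : ∃ s, ¬ (col (some s) ↔ col none))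
    (v : Option (Fin m) → ℂ) (hv : ∀ a, v a ≠ 0)
    (hcross : ∀ a b, ¬ (col a ↔ col b) → serreQ q m a b * v a - v b ≠ 0) :
    ∃ π : List (Option (Fin m)), (Finset.univ.toList).Perm π ∧
      wordFactor (pointFactor q m v) π ≠ 0 := by
  classical
  have hq2 : ∀ n : ℕ, 0 < n → (q ^ 2) ^ n ≠ 1 := fun n hn => by
    rw [← pow_mul]; exact hq _ (by omega)
  have hq20 : q ^ 2 ≠ 0 := pow_ne_zero _ hq0
  obtain ⟨ℓ, hℓ⟩ := exists_log hq20 hq2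
  have hℓk : ∀ (k : ℕ) (x : ℂ), x ≠ 0 → ℓ ((q ^ 2) ^ k * x) = ℓ x + k := by
    intro k
    induction k with
    | zero => intro x _; simp
    | succ k ih =>
      intro x hx
      rw [pow_succ', mul_assoc, hℓ _ (mul_ne_zero (pow_ne_zero _ hq20) hx), ih x hx]
      push_cast
      ring
  have hm : 0 < m := by
    obtain ⟨s, _⟩ := hcol
    exact s.pos
  set Q := q ^ (1 - (m : ℤ)) with hQ
  have hQ0 : Q ≠ 0 := zpow_ne_zero _ hq0
  have hQQ : Q * Q * (q ^ 2) ^ (m - 1) = 1 := by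
    rw [hQ, ← zpow_add₀ hq0, ← pow_mul, ← zpow_natCast, ← zpow_add₀ hq0]
    rw [show 1 - (m : ℤ) + (1 - m) + ((2 * (m - 1) : ℕ) : ℤ) = 0 by omega, zpow_zero]
  set y := Q * v none with hy
  have hy0 : y ≠ 0 := mul_ne_zero hQ0 (hv none)
  have hpow : ∀ k k' : ℕ, (q ^ 2) ^ k * y = (q ^ 2) ^ k' * y → k = k' := by
    intro k k' h
    have := congrArg ℓ h
    rw [hℓk _ _ hy0, hℓk _ _ hy0] at this
    omega
  -- one of the values of the chain is not taken in the colour of `none`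
  obtain ⟨k₀, hk₀m, hk₀⟩ : ∃ k₀ < m, ∀ s, (col (some s) ↔ col none) →
      v (some s) ≠ (q ^ 2) ^ k₀ * y := by
    by_contra! hne
    choose s hs1 hs2 using fun k : Fin m => hne k k.2
    have hinj : Function.Injective s := by
      intro k k' h
      have : (q ^ 2) ^ (k : ℕ) * y = (q ^ 2) ^ (k' : ℕ) * y := by rw [← hs2, ← hs2, h]
      exact Fin.ext (hpow _ _ this)
    obtain ⟨t, ht⟩ := hcol
    obtain ⟨k, rfl⟩ := (Finite.injective_iff_surjective.1 hinj) t
    exact ht (hs1 k)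
  set D : Fin m → Prop := fun s =>
    (col (some s) ↔ col none) ∧ ∃ k : ℕ, k₀ < k ∧ k < m ∧ v (some s) = (q ^ 2) ^ k * y with hD
  -- `none` has rank zero, the letters of `D`, which lead to it, have positive rank, and no edge
  -- leads from another letter to `D`; between letters of the same kind the logarithm grows
  set rank : Option (Fin m) → ℤ := fun a => match a with
    | none => 0
    | some s => -(ℓ (v (some s)) - ℓ y) + (if D s then (m : ℤ) else -1) with hrank
  have edge : ∀ a b, a ≠ b → (col a ↔ col b) → serreQ q m a b * v a - v b = 0 →
      rank b < rank a := by
    rintro (_ | s) (_ | t) hab hc h0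
    · exact absurd rfl hab
    · have ht : v (some t) = y := (sub_eq_zero.1 h0).symm
      have hDt : ¬ D t := by
        rintro ⟨_, k, hk1, _, hk3⟩
        have := hpow 0 k (by rw [pow_zero, one_mul, ← hk3, ht])
        omega
      simp only [hrank, if_neg hDt, ht]
      omega
    · have hs : Q * v (some s) = v none := sub_eq_zero.1 h0
      have hs' : v (some s) = (q ^ 2) ^ (m - 1) * y := by
        rw [hy, ← hs]
        linear_combination (-v (some s)) * hQQ
      have hk₁ : k₀ < m - 1 := by
        rcases Nat.lt_or_ge k₀ (m - 1) with h | h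
        · exact h
        · exfalso
          have : k₀ = m - 1 := by omega
          exact hk₀ s hc (this ▸ hs')
      have hDs : D s := ⟨hc, m - 1, hk₁, by omega, hs'⟩
      have := hℓk (m - 1) y hy0
      rw [← hs'] at this
      simp only [hrank, if_pos hDs]
      omega
    · have ht : v (some t) = q ^ 2 * v (some s) := (sub_eq_zero.1 h0).symm
      have hl := hℓ _ (hv (some s))
      rw [← ht] at hl
      by_cases hDs : D s
      · simp only [hrank, if_pos hDs]
        split_ifs <;> omega
      · have hDt : ¬ D t := by
          rintro ⟨hct, k, hk1, hk2, hk3⟩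
          have hs' : v (some s) = (q ^ 2) ^ (k - 1) * y := by
            apply mul_left_cancel₀ hq20
            rw [← ht, hk3, ← mul_assoc (q ^ 2), ← pow_succ', Nat.sub_add_cancel (by omega)]
          have hcs : col (some s) ↔ col none := hc.trans hct
          rcases Nat.lt_or_ge k₀ (k - 1) with h | h
          · exact hDs ⟨hcs, k - 1, h, by omega, hs'⟩
          · have : k₀ = k - 1 := by omega
            exact hk₀ s hcs (this ▸ hs')
        simp only [hrank, if_neg hDs, if_neg hDt]
        omega
  let r : Option (Fin m) → Option (Fin m) → Prop := fun a b => rank a ≤ rank b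
  have : Std.Total r := ⟨fun a b => le_total (rank a) (rank b)⟩
  have : IsTrans _ r := ⟨fun a b c h h' => le_trans h h'⟩
  have hperm := List.perm_insertionSort r (Finset.univ : Finset (Option (Fin m))).toList
  refine ⟨_, hperm.symm, wordFactor_ne_zero _ ?_⟩
  have hnd := (List.Perm.nodup_iff hperm).2 (Finset.nodup_toList _)
  refine ((List.pairwise_insertionSort r _).and hnd).imp ?_
  rintro a b ⟨hr, hab⟩
  refine mul_ne_zero (letterSign_ne_zero a b) fun h0 => ?_
  by_cases hc : col a ↔ col b
  · exact absurd (edge a b hab hc h0) (not_lt_of_ge hr)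
  · exact hcross a b hc h0

section Bounded
variable {R : Type*} [Ring R] [Algebra ℂ R]

omit [Algebra ℂ R] in
lemma coeff_mul_eq_zero {x y : HahnSeries ℤ R} {a b : ℤ} (hx : ∀ N < a, x.coeff N = 0)
    (hy : ∀ N < b, y.coeff N = 0) {N : ℤ} (hN : N < a + b) : (x * y).coeff N = 0 := by
  rw [HahnSeries.coeff_mul]
  refine Finset.sum_eq_zero fun p hp => ?_
  rw [Finset.mem_antidiagonal] at hp
  rcases lt_or_ge p.1 a with h | h
  · rw [hx _ h, zero_mul]
  · rw [hy _ (by omega), mul_zero]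

omit [Algebra ℂ R] in
lemma coeff_listProd_eq_zero {L : Type*} (A : L → HahnSeries ℤ R) (b : L → ℤ)
    (hA : ∀ a, ∀ N < b a, (A a).coeff N = 0) (l : List L) :
    ∀ N < (l.map b).sum, (l.map A).prod.coeff N = 0 := by
  induction l with
  | nil =>
    intro N hN
    simp only [List.map_nil, List.sum_nil, List.prod_nil] at hN ⊢
    rw [← HahnSeries.single_zero_one, HahnSeries.coeff_single_of_ne hN.ne]
  | cons a l ih =>
    intro N hN
    simp only [List.map_cons, List.prod_cons, List.sum_cons] at hN ⊢
    exact coeff_mul_eq_zero (hA a) ih hN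

/-- The lower bound for the order of the modes: letters of the chosen colour lower it. -/
def colBound (col : Option (Fin m) → Prop) [DecidablePred col] (n : Option (Fin m) → ℤ) : ℤ :=
  ∑ a, if col a then -n a else 0

/-- The order of the modes `f n` is bounded below by `colBound col n`, up to a constant. -/
def OrderBounded (col : Option (Fin m) → Prop) [DecidablePred col]
    (f : ModeFun (Option (Fin m)) (HahnSeries ℤ R)) : Prop :=
  ∃ C : ℤ, ∀ n, ∀ N < colBound col n - C, (f n).coeff N = 0

variable (col : Option (Fin m) → Prop) [DecidablePred col]

lemma colBound_add_single (n : Option (Fin m) → ℤ) (a : Option (Fin m)) (c : ℤ) :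
    colBound col (n + Pi.single a c) = colBound col n - if col a then c else 0 := by
  have h : ∀ b, (if col b then -(n + Pi.single a c : Option (Fin m) → ℤ) b else 0) =
      (if col b then -n b else 0) - (if b = a then (if col a then c else 0) else 0) := by
    intro b
    by_cases hb : b = a
    · subst hb
      by_cases hc : col b
      · simp [hc, sub_eq_add_neg, add_comm]
      · simp [hc]
    · by_cases hc : col b <;> simp [hb, hc]
  simp only [colBound]
  simp only [h, Finset.sum_sub_distrib]
  simp

lemma OrderBounded.smul {col : Option (Fin m) → Prop} [DecidablePred col]
    (p : MvPolynomial (Option (Fin m)) ℂ) : ∀ {f : ModeFun (Option (Fin m)) (HahnSeries ℤ R)},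
      OrderBounded col f → OrderBounded col (p • f) := by
  induction p using MvPolynomial.induction_on with
  | C c =>
    rintro f ⟨C, hC⟩
    refine ⟨C, fun n N hN => ?_⟩
    rw [C_smul_mode]
    change (c • f n).coeff N = 0
    rw [HahnSeries.coeff_smul, hC n N hN, smul_zero]
  | add p p' hp hp' =>
    intro f hf
    obtain ⟨C, hC⟩ := hp hf
    obtain ⟨C', hC'⟩ := hp' hf
    refine ⟨max C C', fun n N hN => ?_⟩
    rw [add_smul]
    change ((p • f) n + (p' • f) n).coeff N = 0
    have h1 := le_max_left C C'
    have h2 := le_max_right C C'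
    rw [HahnSeries.coeff_add, hC n N (by omega), hC' n N (by omega), add_zero]
  | mul_X p a hp =>
    rintro f ⟨C, hC⟩
    rw [mul_smul]
    refine hp ⟨C + 1, fun n N hN => ?_⟩
    rw [X_smul_mode]
    refine hC _ _ ?_
    rw [colBound_add_single]
    split_ifs <;> omega

/-- A distribution of bounded order that is multiplied by a scalar under a shift of the exponents
which lets the bound grow vanishes. -/
lemma OrderBounded.eq_zero {col : Option (Fin m) → Prop} [DecidablePred col]
    {f : ModeFun (Option (Fin m)) (HahnSeries ℤ R)}
    (hf : OrderBounded col f) {x y : Option (Fin m)} (hx : col x) (hy : ¬ col y) (c : ℂ)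
    (h : ∀ n, f n = c • f (n + Pi.single x (-1) + Pi.single y 1)) : f = 0 := by
  obtain ⟨C, hC⟩ := hf
  have key : ∀ k : ℕ, ∀ n N, N < colBound col n - C + k → (f n).coeff N = 0 := by
    intro k
    induction k with
    | zero => intro n N hN; exact hC n N (by simpa using hN)
    | succ k ih =>
      intro n N hN
      rw [h n, HahnSeries.coeff_smul, ih _ N, smul_zero]
      rw [colBound_add_single, colBound_add_single, if_pos hx, if_neg hy]
      push_cast at hN
      omega
  funext n
  ext N
  exact key (N - (colBound col n - C) + 1).toNat n N (by omega)

/-- A polynomial that acts injectively on distributions of bounded order. -/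
def Cancellable (R : Type*) [Ring R] [Algebra ℂ R] (col : Option (Fin m) → Prop)
    [DecidablePred col] (p : MvPolynomial (Option (Fin m)) ℂ) : Prop :=
  ∀ f : ModeFun (Option (Fin m)) (HahnSeries ℤ R), OrderBounded col f → p • f = 0 → f = 0

lemma cancellable_submonoid : ∃ M : Submonoid (MvPolynomial (Option (Fin m)) ℂ),
    ∀ p, p ∈ M ↔ Cancellable R col p :=
  ⟨{ carrier := {p | Cancellable R col p}
     one_mem' := fun f _ h => by rwa [one_smul] at h
     mul_mem' := fun {p p'} hp hp' f hf h => hp' f hf (hp _ (hf.smul p') (by rwa [← mul_smul])) },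
    fun _ => Iff.rfl⟩

lemma cancellable_X (a : Option (Fin m)) : Cancellable R col (MvPolynomial.X a) := by
  intro f _ h
  funext n
  have := congrFun h (n + Pi.single a (-1))
  rw [X_smul_mode, add_assoc, ← Pi.single_add] at this
  refine Eq.trans ?_ this
  simp

lemma cancellable_cross {a b : Option (Fin m)} (hab : ¬ (col a ↔ col b)) {c : ℂ} (hc : c ≠ 0) :
    Cancellable R col (MvPolynomial.C c * MvPolynomial.X a - MvPolynomial.X b) := by
  intro f hf h
  have h' : ∀ n : Option (Fin m) → ℤ, c • f (n + Pi.single a 1) = f (n + Pi.single b 1) := by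
    intro n
    have := congrFun h n
    rw [sub_smul, mul_smul, C_smul_mode] at this
    change c • (MvPolynomial.X a • f) n - (MvPolynomial.X b • f) n = 0 at this
    rw [X_smul_mode, X_smul_mode] at this
    exact sub_eq_zero.1 this
  by_cases ha : col a
  · have hb : ¬ col b := fun hb => hab ⟨fun _ => hb, fun _ => ha⟩
    refine hf.eq_zero ha hb c⁻¹ fun n => ?_
    rw [← h', smul_smul, inv_mul_cancel₀ hc, one_smul, add_assoc, ← Pi.single_add]
    simp
  · have hb : col b := by tauto
    refine hf.eq_zero hb ha c fun n => ?_
    rw [h', add_assoc, ← Pi.single_add]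
    simp

end Bounded

lemma mem_serreWord (σ : Equiv.Perm (Fin m)) (r : ℕ) : (serreWord σ r).Perm Finset.univ.toList := by
  have h1 : (serreWord σ r).Perm (none :: List.ofFn fun k => some (σ k)) := by
    refine List.perm_middle.trans ?_
    rw [List.take_append_drop]
  refine h1.trans ?_
  rw [List.perm_ext_iff_of_nodup _ (Finset.nodup_toList _)]
  · intro a
    simp only [List.mem_cons, List.mem_ofFn, Finset.mem_toList, Finset.mem_univ, iff_true]
    rcases a with _ | a
    · exact Or.inl rfl
    · exact Or.inr ⟨σ.symm a, by simp⟩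
  · rw [List.nodup_cons, List.nodup_ofFn]
    refine ⟨by simp [List.mem_ofFn], fun a b h => σ.injective (Option.some.inj h)⟩

/-- The part of a Serre relation that mixes two families of currents, which satisfy the exchange
relations with each other, vanishes. By the exchange relations and `sum_wordFactor_serreWord`, the
factor of every order of the letters annihilates the sum. By the Nullstellensatz so does a power of
a product of polynomials that act injectively on distributions of bounded order. -/
theorem mixed_serre_eq_zero {R : Type*} [Ring R] [Algebra ℂ R] (hq0 : q ≠ 0)
    (hq : ∀ n : ℕ, 0 < n → q ^ n ≠ 1) (A : Option (Fin m) → ℤ → HahnSeries ℤ R)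
    (hA : ∀ a b, a ≠ b → ExchangeRel (serreQ q m a b) (A a) (A b))
    (col : Option (Fin m) → Prop) [DecidablePred col] (hcol : ∃ s, ¬ (col (some s) ↔ col none))
    (hbd : ∀ a n, ∀ N < (if col a then -n else 0), (A a n).coeff N = 0)
    (n : Option (Fin m) → ℤ) :
    ∑ r ∈ Finset.range (m + 1), ∑ σ : Equiv.Perm (Fin m), ((-1) ^ r * qBinom q m r) •
      ((serreWord σ r).map fun a => A a (n a)).prod = 0 := by
  classical
  have hm : 0 < m := by
    obtain ⟨s, _⟩ := hcol
    exact s.pos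
  let W : List (Option (Fin m)) → ModeFun (Option (Fin m)) (HahnSeries ℤ R) :=
    fun l n => (l.map fun a => A a (n a)).prod
  let Z : ModeFun (Option (Fin m)) (HahnSeries ℤ R) :=
    ∑ r ∈ Finset.range (m + 1), ∑ σ : Equiv.Perm (Fin m), ((-1) ^ r * qBinom q m r) •
      W (serreWord σ r)
  have hZapp : ∀ n, Z n = ∑ r ∈ Finset.range (m + 1), ∑ σ : Equiv.Perm (Fin m),
      ((-1) ^ r * qBinom q m r) • W (serreWord σ r) n := by
    intro n
    refine (Finset.sum_apply n _ _).trans (Finset.sum_congr rfl fun r _ => ?_)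
    exact Finset.sum_apply n _ _
  have hWex : ∀ pre c a post, (pre ++ c :: a :: post).Nodup →
      letterFactor q m a c • W (pre ++ c :: a :: post) =
        letterFactor q m c a • W (pre ++ a :: c :: post) := by
    intro pre c a post hnd
    have hnd' := hnd
    rw [List.nodup_append, List.nodup_cons, List.nodup_cons] at hnd'
    obtain ⟨-, ⟨hc, ha, -⟩, hd⟩ := hnd'
    have hac : a ≠ c := fun h => hc (by simp [h])
    have hpre : ∀ (n : Option (Fin m) → ℤ) (d : Option (Fin m)), d = a ∨ d = c →
        pre.map (fun b => A b ((n + Pi.single d 1 : Option (Fin m) → ℤ) b)) =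
          pre.map fun b => A b (n b) := by
      intro n d hd'
      refine List.map_congr_left fun b hb => ?_
      have hbd : b ≠ d := by
        rcases hd' with rfl | rfl
        · exact hd b hb _ (by simp)
        · exact hd b hb _ (by simp)
      simp [hbd]
    have hpost : ∀ (n : Option (Fin m) → ℤ) (d : Option (Fin m)), d = a ∨ d = c →
        post.map (fun b => A b ((n + Pi.single d 1 : Option (Fin m) → ℤ) b)) =
          post.map fun b => A b (n b) := by
      intro n d hd'
      refine List.map_congr_left fun b hb => ?_
      have hbd : b ≠ d := by
        rintro rfl
        rcases hd' with rfl | rfl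
        · exact ha hb
        · exact hc (by simp [hb])
      simp [hbd]
    funext n
    simp only [letterFactor, mul_smul, sub_smul, C_smul_mode]
    change letterSign a c • (serreQ q m a c • (MvPolynomial.X a • W (pre ++ c :: a :: post)) n -
        (MvPolynomial.X c • W (pre ++ c :: a :: post)) n) =
      letterSign c a • (serreQ q m c a • (MvPolynomial.X c • W (pre ++ a :: c :: post)) n -
        (MvPolynomial.X a • W (pre ++ a :: c :: post)) n)
    rw [X_smul_mode, X_smul_mode, X_smul_mode, X_smul_mode]
    simp only [W, List.map_append, List.map_cons, List.prod_append, List.prod_cons,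
      hpre _ a (Or.inl rfl), hpre _ c (Or.inr rfl), hpost _ a (Or.inl rfl), hpost _ c (Or.inr rfl)]
    rw [letterSign_swap hac, neg_smul, ← smul_neg, neg_sub, serreQ_comm q m c a]
    congr 1
    have hex := hA a c hac (n a) (n c)
    simp only [Pi.add_apply, Pi.single_eq_same, Pi.single_eq_of_ne hac,
      Pi.single_eq_of_ne hac.symm, add_zero]
    have := congrArg (fun t => (pre.map fun b => A b (n b)).prod *
      (t * (post.map fun b => A b (n b)).prod)) hex
    simp only [mul_sub, sub_mul, mul_smul_comm, smul_mul_assoc, mul_assoc] at this ⊢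
    exact this.symm
  have hkill : ∀ π : List (Option (Fin m)), Finset.univ.toList.Perm π →
      wordFactor (letterFactor q m) π • Z = 0 := by
    intro π hπ
    have h1 : wordFactor (letterFactor q m) π • Z = (∑ r ∈ Finset.range (m + 1),
        ∑ σ : Equiv.Perm (Fin m), MvPolynomial.C ((-1) ^ r * qBinom q m r) *
          wordFactor (letterFactor q m) (serreWord σ r)) • W π := by
      rw [Finset.smul_sum, Finset.sum_smul]
      refine Finset.sum_congr rfl fun r _ => ?_
      rw [Finset.smul_sum, Finset.sum_smul]
      refine Finset.sum_congr rfl fun σ _ => ?_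
      have hp := (mem_serreWord σ r)
      have := wordFactor_smul_perm (letterFactor q m) W hWex π [] (serreWord σ r)
        ((hp.trans hπ).symm) ((List.Perm.nodup_iff hp).2 (Finset.nodup_toList _))
      simp only [List.nil_append] at this
      rw [← C_smul_mode, smul_comm, this, ← mul_smul]
    have h2 : (∑ r ∈ Finset.range (m + 1),
        ∑ σ : Equiv.Perm (Fin m), MvPolynomial.C ((-1) ^ r * qBinom q m r) *
          wordFactor (letterFactor q m) (serreWord σ r)) = 0 := by
      apply MvPolynomial.funext
      intro v
      simp only [map_sum, map_mul, MvPolynomial.eval_C, eval_wordFactor, map_zero]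
      exact sum_wordFactor_serreWord q v hq0 hq hm
    rw [h1, h2, zero_smul]
  have hbdZ : OrderBounded col Z := by
    refine ⟨0, fun n N hN => ?_⟩
    rw [hZapp, HahnSeries.coeff_sum]
    refine Finset.sum_eq_zero fun r _ => ?_
    rw [HahnSeries.coeff_sum]
    refine Finset.sum_eq_zero fun σ _ => ?_
    rw [HahnSeries.coeff_smul]
    have := coeff_listProd_eq_zero (fun a => A a (n a)) (fun a => if col a then -n a else 0)
      (fun a => hbd a (n a)) (serreWord σ r) N (by
        rw [((mem_serreWord σ r).map _).sum_eq, Finset.sum_map_toList]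
        simpa [colBound] using hN)
    rw [this, smul_zero]
  -- the product of the variables and of the factors of letters of different colours
  let X : MvPolynomial (Option (Fin m)) ℂ := (∏ a, MvPolynomial.X a) *
    ∏ p : Option (Fin m) × Option (Fin m), if (col p.1 ↔ col p.2) then 1 else
      (MvPolynomial.C (serreQ q m p.1 p.2) * MvPolynomial.X p.1 - MvPolynomial.X p.2)
  obtain ⟨M, hM⟩ := cancellable_submonoid (R := R) col
  have hXM : X ∈ M := by
    refine M.mul_mem (M.prod_mem fun a _ => (hM _).2 (cancellable_X col a))
      (M.prod_mem fun p _ => ?_)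
    split_ifs with h
    · exact M.one_mem
    · refine (hM _).2 (cancellable_cross col h ?_)
      rcases p with ⟨_ | a, _ | b⟩
      · exact absurd Iff.rfl h
      · exact zpow_ne_zero _ hq0
      · exact zpow_ne_zero _ hq0
      · exact pow_ne_zero _ hq0
  let J : Ideal (MvPolynomial (Option (Fin m)) ℂ) :=
    Ideal.span {p | ∃ π : List (Option (Fin m)), Finset.univ.toList.Perm π ∧
      p = wordFactor (letterFactor q m) π}
  have hJ : ∀ p ∈ J, p • Z = 0 := by
    intro p hp
    induction hp using Submodule.span_induction with
    | mem p hp => obtain ⟨π, hπ, rfl⟩ := hp; exact hkill π hπ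
    | zero => rw [zero_smul]
    | add p p' _ _ hp hp' => rw [add_smul, hp, hp', add_zero]
    | smul c p _ hp => rw [smul_eq_mul, mul_smul, hp, smul_zero]
  have hrad : X ∈ J.radical := by
    rw [← MvPolynomial.vanishingIdeal_zeroLocus_eq_radical (K := ℂ)]
    intro v hv
    by_contra hX
    simp only [X, map_mul, map_prod, MvPolynomial.aeval_X] at hX
    rw [mul_eq_zero, not_or, Finset.prod_eq_zero_iff, Finset.prod_eq_zero_iff] at hX
    push Not at hX
    obtain ⟨π, hπ, hne⟩ := exists_wordFactor_ne_zero q hq0 hq col hcol v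
      (fun a => hX.1 a (Finset.mem_univ a)) (fun a b hab => by
        have := hX.2 (a, b) (Finset.mem_univ _)
        rw [if_neg hab] at this
        simpa using this)
    apply hne
    rw [← eval_wordFactor]
    exact hv _ (Ideal.subset_span ⟨π, hπ, rfl⟩)
  obtain ⟨N, hN⟩ := hrad
  have hZ : Z = 0 := (hM _).1 (M.pow_mem hXM N) Z hbdZ (hJ _ hN)
  have := congrFun hZ n
  rw [hZapp] at this
  exact this

end Mixed

/-! ### Words, powers of the central element and loop degrees -/

section Words
variable {ι : Type u}

lemma word_nil : word ([] : List (Gen ι)) = 1 := rfl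

lemma word_cons (g : Gen ι) (w : List (Gen ι)) : word (g :: w) = gen g * word w := by
  simp [word]

lemma word_append (w w' : List (Gen ι)) : word (w ++ w') = word w * word w' := by
  simp [word]

lemma word_singleton (g : Gen ι) : word [g] = gen g := by simp [word]

@[elab_as_elim]
theorem Borel.induction {p : Borel ι → Prop} (one : p 1) (smul : ∀ (r : ℂ) a, p a → p (r • a))
    (add : ∀ a b, p a → p b → p (a + b)) (mul : ∀ g a, p a → p (gen g * a))
    (a : Borel ι) : p a := by
  suffices h : ∀ b, p b → p (a * b) by simpa using h 1 one
  obtain ⟨a, rfl⟩ := mk_surjective ι a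
  induction a using FreeAlgebra.induction with
  | grade0 r => intro b hb; rw [AlgHom.commutes, ← Algebra.smul_def]; exact smul r b hb
  | grade1 g => exact fun b hb => mul g b hb
  | mul x y hx hy => intro b hb; rw [map_mul, mul_assoc]; exact hx _ (hy _ hb)
  | add x y hx hy => intro b hb; rw [map_add, add_mul]; exact add _ _ (hx _ hb) (hy _ hb)

lemma span_range_word : Submodule.span ℂ (Set.range (word (ι := ι))) = ⊤ := by
  rw [eq_top_iff]
  rintro a -
  induction a using Borel.induction with
  | one => exact Submodule.subset_span ⟨[], rfl⟩
  | smul r a ha => exact Submodule.smul_mem _ _ ha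
  | add a b ha hb => exact Submodule.add_mem _ ha hb
  | mul g a ha =>
    induction ha using Submodule.span_induction with
    | mem x hx => obtain ⟨w, rfl⟩ := hx; exact Submodule.subset_span ⟨g :: w, word_cons g w⟩
    | zero => rw [mul_zero]; exact Submodule.zero_mem _
    | add x y _ _ hx hy => rw [mul_add]; exact Submodule.add_mem _ hx hy
    | smul r x _ hx => rw [mul_smul_comm]; exact Submodule.smul_mem _ _ hx

lemma Borel.linearMap_ext {M : Type*} [AddCommMonoid M] [Module ℂ M] {f g : Borel ι →ₗ[ℂ] M}
    (h : ∀ w, f (word w) = g (word w)) : f = g := by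
  refine LinearMap.ext_on_range (v := word) span_range_word h

lemma Borel.algHom_ext {T : Type*} [Ring T] [Algebra ℂ T] {f g : Borel ι →ₐ[ℂ] T}
    (h : ∀ x, f (gen x) = g (gen x)) (a : Borel ι) : f a = g a := by
  induction a using Borel.induction with
  | one => rw [map_one, map_one]
  | smul r a ha => rw [map_smul, map_smul, ha]
  | add a b ha hb => rw [map_add, map_add, ha, hb]
  | mul x a ha => rw [map_mul, map_mul, ha, h]

lemma cpow_zero : (cpow 0 : Borel ι) = 1 := by simp [cpow]

lemma cpow_add (m n : ℤ) : (cpow (m + n) : Borel ι) = cpow m * cpow n := by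
  simp [cpow, zpow_add]

lemma cpow_one : (cpow 1 : Borel ι) = gen Gen.c := by simp [cpow, cUnit]

lemma cpow_neg_one : (cpow (-1) : Borel ι) = gen Gen.cinv := by simp [cpow, cUnit]

/-- The values of a morphism on the powers of the central element are determined by a recursion. -/
lemma map_cpow_eq {T F : Type*} [Monoid T] [FunLike F (Borel ι) T] [MonoidHomClass F (Borel ι) T]
    (f : F) (g : ℤ → T) (h0 : g 0 = 1) (h1 : ∀ m, g (m + 1) = g m * f (gen Gen.c)) (m : ℤ) :
    f (cpow m) = g m := by
  induction m using Int.induction_on with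
  | zero => rw [h0, cpow_zero, map_one]
  | succ i ih => rw [cpow_add, map_mul, ih, h1, cpow_one]
  | pred i ih =>
    have h := h1 (-(i : ℤ) - 1)
    rw [sub_add_cancel, ← ih] at h
    rw [sub_eq_add_neg, cpow_add, map_mul, h, mul_assoc, ← map_mul, cpow_neg_one, c_mul_cinv,
      map_one, mul_one, ← sub_eq_add_neg]

lemma cpow_comm (m : ℤ) (a : Borel ι) : cpow m * a = a * cpow m := by
  induction m using Int.induction_on with
  | zero => rw [cpow_zero, one_mul, mul_one]
  | succ i ih => rw [cpow_add, mul_assoc, cpow_one, c_comm, ← mul_assoc, ih, mul_assoc]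
  | pred i ih =>
    rw [sub_eq_add_neg, cpow_add, mul_assoc, cpow_neg_one, cinv_comm, ← mul_assoc, ih, mul_assoc]

lemma cpow_mul_cpow (m n : ℤ) : (cpow m : Borel ι) * cpow n = cpow (m + n) := (cpow_add m n).symm

/-- `H i k` for integer `k`, which is zero for negative `k`. -/
def Hz (i : ι) (k : ℤ) : Borel ι := if 0 ≤ k then H i k.toNat else 0

lemma Hz_natCast (i : ι) (k : ℕ) : Hz i k = H i k := by simp [Hz]

lemma Hz_of_neg (i : ι) {k : ℤ} (hk : k < 0) : Hz i k = 0 := by simp [Hz, hk]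

end Words

/-! ### Hahn series -/

section Hahn
variable {R S : Type*} [Ring R] [Algebra ℂ R] [Ring S] [Algebra ℂ S]

/-- The morphism of Hahn series given by a morphism of the coefficients. -/
def hahnMap (f : R →ₐ[ℂ] S) : HahnSeries ℤ R →ₐ[ℂ] HahnSeries ℤ S where
  toFun x := x.map f
  map_one' := by
    ext N
    rw [HahnSeries.map_coeff, HahnSeries.coeff_one, HahnSeries.coeff_one, apply_ite f, map_one,
      map_zero]
  map_mul' x y := HahnSeries.map_mul (f : R →ₙ+* S)
  map_zero' := by ext N; simp
  map_add' x y := by ext N; simp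
  commutes' r := by
    ext N
    simp only [HahnSeries.map_coeff, HahnSeries.algebraMap_apply, HahnSeries.C_apply,
      HahnSeries.coeff_single]
    split_ifs
    · exact AlgHom.commutes f r
    · exact map_zero f

lemma hahnMap_coeff (f : R →ₐ[ℂ] S) (x : HahnSeries ℤ R) (N : ℤ) :
    (hahnMap f x).coeff N = f (x.coeff N) := rfl

lemma hahnMap_single (f : R →ₐ[ℂ] S) (N : ℤ) (x : R) :
    hahnMap f (HahnSeries.single N x) = HahnSeries.single N (f x) := by
  ext M
  rw [hahnMap_coeff, HahnSeries.coeff_single, HahnSeries.coeff_single, apply_ite f, map_zero]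

omit [Algebra ℂ R] in
lemma ofPowerSeries_mk_coeff (f : ℕ → R) (N : ℤ) :
    (HahnSeries.ofPowerSeries ℤ R (PowerSeries.mk f)).coeff N = if 0 ≤ N then f N.toNat else 0 := by
  split_ifs with h
  · lift N to ℕ using h
    rw [HahnSeries.ofPowerSeries_apply_coeff, PowerSeries.coeff_mk, Int.toNat_natCast]
  · rw [HahnSeries.ofPowerSeries_apply, HahnSeries.embDomain_of_notMem_range]
    rintro ⟨n, rfl⟩
    exact h (by simp)

omit [Algebra ℂ R] in
lemma single_one_comm (N : ℤ) (x : HahnSeries ℤ R) :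
    HahnSeries.single N 1 * x = x * HahnSeries.single N 1 := by
  ext M
  rw [HahnSeries.coeff_single_mul, HahnSeries.coeff_mul_single, one_mul, mul_one]

end Hahn

section Coproduct
variable {ι : Type u}

lemma deltaPlus_X_coeff (i : ι) (n N : ℤ) : (deltaPlus ι (X i n)).coeff N =
    (if N = -n then X i n ⊗ₜ[ℂ] 1 else 0) +
      (Hz i N * cpow (-(2 * n + N))) ⊗ₜ[ℂ] X i (n + N) := by
  change (deltaPlus ι (gen (Gen.x i n))).coeff N = _
  rw [deltaPlus, lift_gen, deltaPlusGen, HahnSeries.coeff_add, HahnSeries.coeff_single,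
    ofPowerSeries_mk_coeff]
  refine congrArg₂ _ (by congr) ?_
  split_ifs with h
  · lift N to ℕ using h
    rw [Hz_natCast]
    rfl
  · rw [Hz_of_neg _ (not_le.1 h), zero_mul, TensorProduct.zero_tmul]

lemma deltaPlus_H_coeff (i : ι) (k : ℕ) (N : ℤ) : (deltaPlus ι (H i k)).coeff N =
    (Hz i N * cpow (k - N)) ⊗ₜ[ℂ] (Hz i (k - N) * cpow (-N)) := by
  rw [H, deltaPlus, lift_gen, deltaPlusGen, HahnSeries.coeff_sum]
  simp only [HahnSeries.coeff_single]
  by_cases h : 0 ≤ N ∧ N ≤ k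
  · obtain ⟨h0, hk⟩ := h
    lift N to ℕ using h0
    rw [Finset.sum_eq_single (N, k - N)]
    · rw [if_pos rfl]
      simp only
      have : ((k - N : ℕ) : ℤ) = k - N := by omega
      rw [← this, Hz_natCast, Hz_natCast]
    · rintro ⟨p, r⟩ hp hne
      rw [Finset.HasAntidiagonal.mem_antidiagonal] at hp
      refine if_neg fun h => hne ?_
      simp only at h hp
      ext <;> simp <;> omega
    · intro h
      exact absurd (Finset.HasAntidiagonal.mem_antidiagonal.2 (by simp; omega)) h
  · rw [Finset.sum_eq_zero]
    · rcases lt_or_ge N 0 with h0 | h0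
      · rw [Hz_of_neg _ h0, zero_mul, TensorProduct.zero_tmul]
      · rw [Hz_of_neg _ (show (k : ℤ) - N < 0 by omega), zero_mul, TensorProduct.tmul_zero]
    · rintro ⟨p, r⟩ hp
      rw [Finset.HasAntidiagonal.mem_antidiagonal] at hp
      refine if_neg fun h' => h ?_
      simp only at hp h'
      omega

lemma deltaMinus_X_coeff (i : ι) (n N : ℤ) : (deltaMinus ι (X i n)).coeff N =
    (if N = 0 then 1 ⊗ₜ[ℂ] X i n else 0) + X i (-N) ⊗ₜ[ℂ] (Hz i (N + n) * cpow (N - n)) := by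
  change (deltaMinus ι (gen (Gen.x i n))).coeff N = _
  rw [deltaMinus, lift_gen, deltaMinusGen, HahnSeries.coeff_add, HahnSeries.coeff_single,
    HahnSeries.coeff_single_mul, one_mul, ofPowerSeries_mk_coeff]
  refine congrArg₂ _ (by congr) ?_
  rw [sub_neg_eq_add]
  split_ifs with h
  · obtain ⟨k, hk⟩ := Int.eq_ofNat_of_zero_le h
    rw [hk, Int.toNat_natCast, Hz_natCast]
    congr 3 <;> omega
  · rw [Hz_of_neg _ (not_le.1 h), zero_mul, TensorProduct.tmul_zero]

lemma deltaMinus_H_coeff (i : ι) (k : ℕ) (N : ℤ) : (deltaMinus ι (H i k)).coeff N =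
    (Hz i (-N) * cpow (k + N)) ⊗ₜ[ℂ] (Hz i (k + N) * cpow N) := by
  rw [H, deltaMinus, lift_gen, deltaMinusGen, HahnSeries.coeff_sum]
  simp only [HahnSeries.coeff_single]
  obtain ⟨M, rfl⟩ : ∃ M, N = -M := ⟨-N, by simp⟩
  by_cases h : 0 ≤ M ∧ M ≤ k
  · obtain ⟨h0, hk⟩ := h
    lift M to ℕ using h0
    rw [Finset.sum_eq_single (M, k - M)]
    · rw [if_pos rfl]
      simp only
      have : ((k - M : ℕ) : ℤ) = k + -M := by omega
      rw [← this, neg_neg, Hz_natCast, Hz_natCast]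
    · rintro ⟨p, r⟩ hp hne
      rw [Finset.HasAntidiagonal.mem_antidiagonal] at hp
      refine if_neg fun h => hne ?_
      simp only at h hp
      ext <;> simp <;> omega
    · intro h
      exact absurd (Finset.HasAntidiagonal.mem_antidiagonal.2 (by simp; omega)) h
  · rw [Finset.sum_eq_zero]
    · rcases lt_or_ge M 0 with h0 | h0
      · rw [neg_neg, Hz_of_neg _ h0, zero_mul, TensorProduct.zero_tmul]
      · rw [Hz_of_neg _ (show (k : ℤ) + -M < 0 by omega), zero_mul, TensorProduct.tmul_zero]
    · rintro ⟨p, r⟩ hp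
      rw [Finset.HasAntidiagonal.mem_antidiagonal] at hp
      refine if_neg fun h' => h ?_
      simp only at hp h'
      omega

lemma deltaPlus_cpow (s : ℤ) :
    deltaPlus ι (cpow s) = HahnSeries.single 0 (cpow s ⊗ₜ[ℂ] cpow s) := by
  refine map_cpow_eq (deltaPlus ι) (fun s => HahnSeries.single 0 (cpow s ⊗ₜ[ℂ] cpow s)) ?_ ?_ s
  · simp only [cpow_zero]
    rfl
  intro m
  rw [deltaPlus, lift_gen, deltaPlusGen, HahnSeries.single_mul_single, add_zero,
    Algebra.TensorProduct.tmul_mul_tmul, cpow_add, cpow_one]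

lemma deltaMinus_cpow (s : ℤ) :
    deltaMinus ι (cpow s) = HahnSeries.single 0 (cpow s ⊗ₜ[ℂ] cpow s) := by
  refine map_cpow_eq (deltaMinus ι) (fun s => HahnSeries.single 0 (cpow s ⊗ₜ[ℂ] cpow s)) ?_ ?_ s
  · simp only [cpow_zero]
    rfl
  intro m
  rw [deltaMinus, lift_gen, deltaMinusGen, HahnSeries.single_mul_single, add_zero,
    Algebra.TensorProduct.tmul_mul_tmul, cpow_add, cpow_one]

/-! ### The symmetry between the positive and the negative algebra -/

/-- The generator of the negative algebra that corresponds to a generator of the positive one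
under the symmetry `theta`. -/
def Gen.flip : Gen ι → Gen ι
  | Gen.x i n => Gen.x i (-n)
  | Gen.h i k => Gen.h i k
  | Gen.hinv i => Gen.hinv i
  | Gen.c => Gen.cinv
  | Gen.cinv => Gen.c

lemma Gen.flip_flip (g : Gen ι) : g.flip.flip = g := by
  cases g <;> simp [Gen.flip]

lemma flip_admissible : Admissible fun g : Gen ι => (gen g.flip : Borel ι) where
  c_cinv := cinv_mul_c
  cinv_c := c_mul_cinv
  c_comm _ := cinv_comm _
  h_hinv := H_mul_Hinv
  hinv_h := Hinv_mul_H
  h_comm := H_comm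

/-- The isomorphism between the positive and the negative algebra that reverses the loop degree
of the `x i n` and inverts the central element. It exchanges the two factors of the coproduct. -/
def theta (ι : Type u) : Borel ι →ₐ[ℂ] Borel ι := lift _ flip_admissible

lemma theta_gen (g : Gen ι) : theta ι (gen g) = gen g.flip := lift_gen _ flip_admissible g

lemma theta_X (i : ι) (n : ℤ) : theta ι (X i n) = X i (-n) := theta_gen _

lemma theta_H (i : ι) (k : ℕ) : theta ι (H i k) = H i k := theta_gen _

lemma theta_Hz (i : ι) (k : ℤ) : theta ι (Hz i k) = Hz i k := by
  unfold Hz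
  split_ifs
  · exact theta_H _ _
  · exact map_zero _

lemma theta_Hinv (i : ι) : theta ι (Hinv i) = Hinv i := theta_gen _

lemma theta_theta (a : Borel ι) : theta ι (theta ι a) = a := by
  refine Borel.algHom_ext (f := (theta ι).comp (theta ι)) (g := AlgHom.id ℂ _) (fun g => ?_) a
  simp [theta_gen, Gen.flip_flip]

lemma theta_cpow (s : ℤ) : theta ι (cpow s) = cpow (-s) := by
  refine map_cpow_eq (theta ι) (fun s => cpow (-s)) (by rw [neg_zero, cpow_zero]) (fun m => ?_) s
  rw [theta_gen, neg_add, cpow_add, cpow_neg_one]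
  rfl

lemma counit_gen (g : Gen ι) : counit ι (gen g) = counitGen g := lift_gen _ _ g

lemma counit_theta (a : Borel ι) : counit ι (theta ι a) = counit ι a := by
  refine Borel.algHom_ext (f := (counit ι).comp (theta ι)) (g := counit ι) (fun g => ?_) a
  rw [AlgHom.comp_apply, theta_gen, counit_gen, counit_gen]
  cases g <;> rfl

lemma counit_cpow (s : ℤ) : counit ι (cpow s) = 1 := by
  refine map_cpow_eq (counit ι) (fun _ => 1) rfl (fun m => ?_) s
  rw [counit_gen, one_mul]
  rfl

/-- The loop degree in the positive algebra. -/
def Gen.loop : Gen ι → ℤ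
  | Gen.x _ n => n
  | Gen.h _ k => -k
  | _ => 0

/-- The exchange of the tensor factors, combined with `theta`. -/
def thetaSwap (ι : Type u) : Borel ι ⊗[ℂ] Borel ι →ₐ[ℂ] Borel ι ⊗[ℂ] Borel ι :=
  (Algebra.TensorProduct.map (theta ι) (theta ι)).comp
    (Algebra.TensorProduct.comm ℂ (Borel ι) (Borel ι)).toAlgHom

lemma thetaSwap_tmul (a b : Borel ι) : thetaSwap ι (a ⊗ₜ b) = theta ι b ⊗ₜ theta ι a := rfl

/-- The factor `HahnSeries.single g.loop 1` accounts for the grading: the coefficients of both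
coproducts are indexed by the loop degree of the first factor, and the factors are exchanged. -/
lemma deltaMinus_theta_gen (g : Gen ι) : deltaMinus ι (theta ι (gen g)) =
    HahnSeries.single g.loop 1 * hahnMap (thetaSwap ι) (deltaPlus ι (gen g)) := by
  cases g with
  | x i n =>
    ext N
    rw [HahnSeries.coeff_single_mul, one_mul, hahnMap_coeff]
    change (deltaMinus ι (theta ι (X i n))).coeff N =
      thetaSwap ι ((deltaPlus ι (X i n)).coeff (N - n))
    rw [theta_X, deltaMinus_X_coeff, deltaPlus_X_coeff, map_add, thetaSwap_tmul, theta_X, map_mul,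
      theta_Hz, theta_cpow, add_sub_cancel, neg_neg,
      show 2 * n + (N - n) = N - -n by ring, ← sub_eq_add_neg]
    refine congrArg₂ _ ?_ rfl
    by_cases h : N = 0
    · rw [if_pos h, if_pos (by omega), thetaSwap_tmul, theta_X, map_one]
    · rw [if_neg h, if_neg (by omega), map_zero]
  | h i k =>
    ext N
    rw [HahnSeries.coeff_single_mul, one_mul, hahnMap_coeff]
    change (deltaMinus ι (theta ι (H i k))).coeff N =
      thetaSwap ι ((deltaPlus ι (H i k)).coeff (N - -k))
    rw [theta_H, deltaMinus_H_coeff, deltaPlus_H_coeff, thetaSwap_tmul, map_mul, map_mul, theta_Hz,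
      theta_cpow, theta_Hz, theta_cpow, sub_neg_eq_add, neg_neg, sub_add_cancel_right,
      neg_neg, add_comm N]
  | hinv i =>
    rw [theta_gen]
    simp only [deltaMinus, deltaPlus, lift_gen, Gen.flip, deltaMinusGen, deltaPlusGen,
      hahnMap_single, HahnSeries.single_mul_single, Gen.loop, thetaSwap_tmul, theta_Hinv,
      add_zero, one_mul]
  | c =>
    rw [theta_gen]
    simp only [deltaMinus, deltaPlus, lift_gen, Gen.flip, deltaMinusGen, deltaPlusGen,
      hahnMap_single, HahnSeries.single_mul_single, Gen.loop, thetaSwap_tmul, theta_gen,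
      add_zero, one_mul]
  | cinv =>
    rw [theta_gen]
    simp only [deltaMinus, deltaPlus, lift_gen, Gen.flip, deltaMinusGen, deltaPlusGen,
      hahnMap_single, HahnSeries.single_mul_single, Gen.loop, thetaSwap_tmul, theta_gen,
      add_zero, one_mul]

/-- The elements of loop degree `N` of the positive algebra. -/
def loopSpace (ι : Type u) (N : ℤ) : Submodule ℂ (Borel ι) :=
  Submodule.span ℂ {a | ∃ w : List (Gen ι), (w.map Gen.loop).sum = N ∧ a = word w}

lemma word_mem_loopSpace (w : List (Gen ι)) : word w ∈ loopSpace ι (w.map Gen.loop).sum :=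
  Submodule.subset_span ⟨w, rfl, rfl⟩

lemma gen_mem_loopSpace (g : Gen ι) : gen g ∈ loopSpace ι g.loop :=
  Submodule.subset_span ⟨[g], by simp, (word_singleton g).symm⟩

lemma mul_mem_loopSpace {a b : Borel ι} {M N : ℤ} (ha : a ∈ loopSpace ι M)
    (hb : b ∈ loopSpace ι N) : a * b ∈ loopSpace ι (M + N) := by
  induction ha using Submodule.span_induction with
  | zero => rw [zero_mul]; exact Submodule.zero_mem _
  | add x y _ _ hx hy => rw [add_mul]; exact Submodule.add_mem _ hx hy
  | smul r x _ hx => rw [smul_mul_assoc]; exact Submodule.smul_mem _ _ hx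
  | mem x hx =>
    obtain ⟨w, rfl, rfl⟩ := hx
    induction hb using Submodule.span_induction with
    | zero => rw [mul_zero]; exact Submodule.zero_mem _
    | add x y _ _ hx hy => rw [mul_add]; exact Submodule.add_mem _ hx hy
    | smul r x _ hx => rw [mul_smul_comm]; exact Submodule.smul_mem _ _ hx
    | mem y hy =>
      obtain ⟨w', rfl, rfl⟩ := hy
      exact Submodule.subset_span ⟨w ++ w', by simp, (word_append _ _).symm⟩

lemma cpow_mem_loopSpace (s : ℤ) : cpow s ∈ loopSpace ι 0 := by
  induction s using Int.induction_on with
  | zero => rw [cpow_zero, ← word_nil]; exact word_mem_loopSpace []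
  | succ i ih =>
    rw [cpow_add, cpow_one]
    have := mul_mem_loopSpace ih (gen_mem_loopSpace (ι := ι) Gen.c)
    rwa [show (0 : ℤ) + (Gen.c : Gen ι).loop = 0 from rfl] at this
  | pred i ih =>
    rw [sub_eq_add_neg, cpow_add, cpow_neg_one]
    have := mul_mem_loopSpace ih (gen_mem_loopSpace (ι := ι) Gen.cinv)
    rwa [show (0 : ℤ) + (Gen.cinv : Gen ι).loop = 0 from rfl] at this

/-- The negative coproduct is the positive one with the factors exchanged, up to the shift that
passes from the loop degree of the first factor to that of the second one. -/
lemma deltaMinus_theta {a : Borel ι} {N : ℤ} (ha : a ∈ loopSpace ι N) :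
    deltaMinus ι (theta ι a) =
      HahnSeries.single N 1 * hahnMap (thetaSwap ι) (deltaPlus ι a) := by
  induction ha using Submodule.span_induction with
  | zero => simp only [map_zero, mul_zero]
  | add x y _ _ hx hy => simp only [map_add, hx, hy, mul_add]
  | smul r x _ hx => simp only [map_smul, hx, mul_smul_comm]
  | mem x hx =>
    obtain ⟨w, rfl, rfl⟩ := hx
    induction w with
    | nil =>
      rw [word_nil, map_one (theta ι), map_one (deltaMinus ι), map_one (deltaPlus ι),
        map_one (hahnMap (thetaSwap ι)), mul_one]
      rfl
    | cons g w ih =>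
      rw [word_cons, map_mul, map_mul, ih, deltaMinus_theta_gen, map_mul, map_mul, List.map_cons,
        List.sum_cons]
      rw [← mul_one (1 : Borel ι ⊗[ℂ] Borel ι), ← HahnSeries.single_mul_single, mul_one]
      rw [mul_assoc, mul_assoc, ← mul_assoc (hahnMap _ _) (HahnSeries.single _ _),
        ← single_one_comm, mul_assoc]

lemma deltaMinus_theta_coeff {a : Borel ι} {N : ℤ} (ha : a ∈ loopSpace ι N) (M : ℤ) :
    (deltaMinus ι (theta ι a)).coeff M = thetaSwap ι ((deltaPlus ι a).coeff (M - N)) := by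
  rw [deltaMinus_theta ha, HahnSeries.coeff_single_mul, one_mul, hahnMap_coeff]

end Coproduct

/-! ### Two forms of the relation between Cartan currents and root currents -/

section Action

lemma gSeries_mul {Q : ℂ} (hQ : Q ≠ 0) :
    gSeries Q * (PowerSeries.X - PowerSeries.C Q) = PowerSeries.C Q * PowerSeries.X - 1 := by
  rw [gSeries, mul_assoc, PowerSeries.inv_mul_cancel, mul_one]
  simpa using hQ

lemma coeff_zero_gSeries {Q : ℂ} (hQ : Q ≠ 0) : Q * PowerSeries.coeff 0 (gSeries Q) = 1 := by
  have h := congrArg (PowerSeries.coeff 0) (gSeries_mul hQ)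
  rw [mul_sub, map_sub, PowerSeries.coeff_zero_mul_X, PowerSeries.coeff_mul_C, map_sub,
    PowerSeries.coeff_zero_mul_X, PowerSeries.coeff_zero_one] at h
  linear_combination -h

lemma coeff_succ_gSeries {Q : ℂ} (hQ : Q ≠ 0) (p : ℕ) :
    PowerSeries.coeff p (gSeries Q) - Q * PowerSeries.coeff (p + 1) (gSeries Q) =
      if p = 0 then Q else 0 := by
  have h := congrArg (PowerSeries.coeff (p + 1)) (gSeries_mul hQ)
  rw [mul_sub, map_sub, PowerSeries.coeff_succ_mul_X, PowerSeries.coeff_mul_C, map_sub,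
    PowerSeries.coeff_succ_mul_X, PowerSeries.coeff_C, PowerSeries.coeff_one,
    if_neg (Nat.succ_ne_zero p), sub_zero] at h
  linear_combination h

variable {R : Type*} [Ring R] [Algebra ℂ R]

/-- The coefficients of `φ(z) x(w) - g(z w⁻¹ q^{-c/2}) x(w) φ(z)`. -/
def actionDefect (Q : ℂ) (c : ℤ → R) (h x : ℤ → R) (n : ℕ) (m : ℤ) : R :=
  h n * x m - ∑ p ∈ Finset.HasAntidiagonal.antidiagonal n,
    PowerSeries.coeff p.1 (gSeries Q) • (c (-p.1) * x (m - p.1) * h p.2)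

/-- The relation `(z - Q w q^{c/2}) φ(z) x(w) = (Q z - w q^{c/2}) x(w) φ(z)`. -/
def ActionRel (Q : ℂ) (c : ℤ → R) (h x : ℤ → R) : Prop :=
  ∀ K m : ℤ, h K * x m * c (-1) - Q • (h (K + 1) * x (m + 1)) =
    Q • (x m * h K * c (-1)) - x (m + 1) * h (K + 1)

variable {Q : ℂ} {c h x : ℤ → R}

/-- The recursion `coeff_succ_gSeries` of the coefficients of `g` turns the relation with `g` into
the relation with its denominator cleared. -/
lemma actionDefect_succ (hQ : Q ≠ 0) (c0 : c 0 = 1) (cadd : ∀ m n, c (m + n) = c m * c n)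
    (ch : ∀ m n, c m * h n = h n * c m) (cx : ∀ m n, c m * x n = x n * c m) (n : ℕ) (m : ℤ) :
    actionDefect Q c h x n m * c (-1) - Q • actionDefect Q c h x (n + 1) (m + 1) =
      (h n * x m * c (-1) - Q • (h (n + 1) * x (m + 1))) -
        (Q • (x m * h n * c (-1)) - x (m + 1) * h (n + 1)) := by
  have e1 : (∑ p ∈ Finset.HasAntidiagonal.antidiagonal n,
      PowerSeries.coeff p.1 (gSeries Q) • (c (-p.1) * x (m - p.1) * h p.2)) * c (-1) =
      ∑ p ∈ Finset.HasAntidiagonal.antidiagonal n, PowerSeries.coeff p.1 (gSeries Q) •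
        (c (-(p.1 + 1 : ℕ)) * x (m + 1 - (p.1 + 1 : ℕ)) * h p.2) := by
    rw [Finset.sum_mul]
    refine Finset.sum_congr rfl fun p _ => ?_
    rw [smul_mul_assoc, mul_assoc, ← ch, ← mul_assoc, mul_assoc (c _), ← cx, ← mul_assoc, ← cadd]
    push_cast
    rw [neg_add, add_sub_add_right_eq_sub]
  have e2 : ∀ p ∈ Finset.HasAntidiagonal.antidiagonal n,
      PowerSeries.coeff p.1 (gSeries Q) • (c (-(p.1 + 1 : ℕ)) * x (m + 1 - (p.1 + 1 : ℕ)) * h p.2) -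
      Q • (PowerSeries.coeff (p.1 + 1) (gSeries Q) •
        (c (-(p.1 + 1 : ℕ)) * x (m + 1 - (p.1 + 1 : ℕ)) * h p.2)) =
      if p = (0, n) then Q • (x m * h n * c (-1)) else 0 := by
    rintro ⟨p, r⟩ hp
    rw [Finset.HasAntidiagonal.mem_antidiagonal] at hp
    rw [smul_smul, ← sub_smul, coeff_succ_gSeries hQ]
    simp only at hp ⊢
    split_ifs with h1 h2 h2
    · subst h1
      rw [Prod.mk.injEq] at h2
      rw [h2.2, cx, mul_assoc, ch, ← mul_assoc]
      simp
    · exact absurd (Prod.ext h1 (by simp only; omega)) h2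
    · exact absurd (congrArg Prod.fst h2) h1
    · rw [zero_smul]
  have e3 : (∑ p ∈ Finset.HasAntidiagonal.antidiagonal n,
      if p = (0, n) then Q • (x m * h n * c (-1)) else 0) = Q • (x m * h n * c (-1)) := by
    rw [Finset.sum_ite_eq', if_pos (by simp)]
  rw [← Finset.sum_congr rfl e2, Finset.sum_sub_distrib] at e3
  rw [actionDefect, actionDefect, sub_mul, e1, Finset.Nat.sum_antidiagonal_succ, smul_sub, smul_add,
    smul_smul, coeff_zero_gSeries hQ, one_smul, Finset.smul_sum, ← e3]
  simp only [CharP.cast_eq_zero, neg_zero, c0, one_mul, sub_zero, Nat.cast_add, Nat.cast_one]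
  abel

/-- The two forms of the relation between `φ(z)` and `x(w)` are equivalent. -/
lemma actionRel_iff (hQ : Q ≠ 0) (c0 : c 0 = 1) (cadd : ∀ m n, c (m + n) = c m * c n)
    (ch : ∀ m n, c m * h n = h n * c m) (cx : ∀ m n, c m * x n = x n * c m)
    (hneg : ∀ k < 0, h k = 0) :
    ActionRel Q c h x ↔ ∀ n m, actionDefect Q c h x n m = 0 := by
  have hz : ∀ m, actionDefect Q c h x 0 m = h 0 * x m - Q⁻¹ • (x m * h 0) := by
    intro m
    have : PowerSeries.coeff 0 (gSeries Q) = Q⁻¹ := by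
      rw [← mul_right_inj' hQ, coeff_zero_gSeries hQ, mul_inv_cancel₀ hQ]
    simp only [actionDefect, Finset.HasAntidiagonal.antidiagonal_zero, Finset.sum_singleton, this]
    simp [c0]
  constructor
  · intro hrel n
    induction n with
    | zero =>
      intro m
      have := hrel (-1) (m - 1)
      rw [hneg (-1) (by norm_num), neg_add_cancel, sub_add_cancel, zero_mul, zero_mul, mul_zero,
        zero_mul, smul_zero, zero_sub, zero_sub, neg_inj] at this
      rw [hz, ← this, smul_smul, inv_mul_cancel₀ hQ, one_smul, sub_self]
    | succ n ih =>
      intro m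
      have h1 := actionDefect_succ hQ c0 cadd ch cx n (m - 1)
      rw [hrel n (m - 1), sub_self, ih, zero_mul, zero_sub, sub_add_cancel, neg_eq_zero] at h1
      exact (smul_eq_zero_iff_right hQ).1 h1
  · intro hd K m
    rcases lt_trichotomy K (-1) with hK | rfl | hK
    · rw [hneg K (by omega), hneg (K + 1) (by omega)]
      simp
    · have h0 := hz (m + 1)
      rw [hd, eq_comm, sub_eq_zero] at h0
      rw [hneg (-1) (by norm_num), neg_add_cancel, h0, smul_smul, mul_inv_cancel₀ hQ]
      simp
    · lift K to ℕ using by omega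
      have h1 := actionDefect_succ hQ c0 cadd ch cx K m
      rw [hd, hd, zero_mul, smul_zero, sub_zero, eq_comm, sub_eq_zero] at h1
      exact h1

lemma ExchangeRel.add_left {a a' b : ℤ → R} (h : ExchangeRel Q a b) (h' : ExchangeRel Q a' b) :
    ExchangeRel Q (fun n => a n + a' n) b := by
  intro n m
  have h1 := h n m
  have h2 := h' n m
  simp only [add_mul, mul_add, smul_add]
  calc _ = (a (n + 1) * b m - Q • (a n * b (m + 1))) +
        (a' (n + 1) * b m - Q • (a' n * b (m + 1))) := by abel
    _ = _ := by rw [h1, h2]; abel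

end Action

/-! ### Coefficients of products of series -/

section Series
variable {R : Type*} [Ring R]

lemma coeff_mul_eq_sum_Icc {x y : HahnSeries ℤ R} {a b : ℤ} (hx : ∀ N < a, x.coeff N = 0)
    (hy : ∀ N < b, y.coeff N = 0) (N : ℤ) :
    (x * y).coeff N = ∑ p ∈ Finset.Icc a (N - b), x.coeff p * y.coeff (N - p) := by
  rw [HahnSeries.coeff_mul]
  refine Finset.sum_bij_ne_zero (fun p _ _ => p.1) ?_ ?_ ?_ ?_
  · rintro ⟨p, r⟩ hp hne
    rw [Finset.mem_antidiagonal] at hp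
    simp only at hp hne ⊢
    rw [Finset.mem_Icc]
    constructor
    · by_contra h
      exact hne (by rw [hx p (by omega), zero_mul])
    · by_contra h
      exact hne (by rw [hy r (by omega), mul_zero])
  · rintro ⟨p, r⟩ hp _ ⟨p', r'⟩ hp' _ h
    rw [Finset.mem_antidiagonal] at hp hp'
    simp only at hp hp' h
    ext <;> simp only <;> omega
  · intro p _ hne
    refine ⟨(p, N - p), ?_, hne, rfl⟩
    rw [Finset.mem_antidiagonal]
    exact ⟨left_ne_zero_of_mul hne, right_ne_zero_of_mul hne, by simp⟩
  · rintro ⟨p, r⟩ hp _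
    rw [Finset.mem_antidiagonal] at hp
    simp only at hp ⊢
    rw [← hp.2.2, add_sub_cancel_left]

/-- The coefficient of a product, with the index of summation attached to the second factor. -/
lemma coeff_mul_eq_sum_Icc' {x y : HahnSeries ℤ R} {a b : ℤ} (hx : ∀ N < a, x.coeff N = 0)
    (hy : ∀ N < b, y.coeff N = 0) (N : ℤ) :
    (x * y).coeff N = ∑ p ∈ Finset.Icc b (N - a), x.coeff (N - p) * y.coeff p := by
  rw [coeff_mul_eq_sum_Icc hx hy]
  refine Finset.sum_nbij' (fun p => N - p) (fun p => N - p) ?_ ?_ ?_ ?_ ?_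
  · intro p hp
    rw [Finset.mem_Icc] at hp ⊢
    omega
  · intro p hp
    rw [Finset.mem_Icc] at hp ⊢
    omega
  · intro p _
    ring
  · intro p _
    ring
  · intro p _
    rw [sub_sub_cancel]

lemma prod_map_add {L : Type*} [DecidableEq L] (e y : L → R) (l : List L) (hl : l.Nodup) :
    (l.map fun a => e a + y a).prod =
      ∑ s ∈ l.toFinset.powerset, (l.map fun a => if a ∈ s then e a else y a).prod := by
  induction l with
  | nil => simp
  | cons a l ih =>
    rw [List.nodup_cons] at hl
    have ha : a ∉ l.toFinset := by simpa using hl.1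
    rw [List.map_cons, List.prod_cons, ih hl.2, List.toFinset_cons, Finset.sum_powerset_insert ha,
      add_mul, add_comm (e a * _), Finset.mul_sum, Finset.mul_sum]
    have hmem : ∀ b ∈ l, b ≠ a := fun b hb hba => hl.1 (hba ▸ hb)
    refine congrArg₂ _ ?_ ?_
    · refine Finset.sum_congr rfl fun s hs => ?_
      rw [List.map_cons, List.prod_cons, if_neg fun h => ha (Finset.mem_powerset.1 hs h)]
    · refine Finset.sum_congr rfl fun s hs => ?_
      rw [List.map_cons, List.prod_cons, if_pos (Finset.mem_insert_self _ _)]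
      refine congrArg (fun t => e a * List.prod t) (List.map_congr_left fun b hb => ?_)
      simp [Finset.mem_insert, hmem b hb]

/-- The coefficient of a product of series whose coefficients are products `f a k * g a k`, where
the `f a k` commute with the `g a k`. -/
lemma coeff_prod_map_mk {L : Type*} [DecidableEq L] (f g : L → ℕ → R)
    (hfg : ∀ a k b k', Commute (f a k) (g b k')) (l : List L) (hl : l.Nodup) :
    ∀ N, PowerSeries.coeff N (l.map fun a => PowerSeries.mk fun k => f a k * g a k).prod =
      ∑ k ∈ Finset.piAntidiag l.toFinset N,
        (l.map fun a => f a (k a)).prod * (l.map fun a => g a (k a)).prod := by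
  induction l with
  | nil =>
    intro N
    simp only [List.map_nil, List.prod_nil, PowerSeries.coeff_one, List.toFinset_nil,
      Finset.piAntidiag_empty]
    split_ifs <;> simp
  | cons a l ih =>
    intro N
    rw [List.nodup_cons] at hl
    have ha : a ∉ l.toFinset := by simpa using hl.1
    have hmem : ∀ b ∈ l, b ≠ a := fun b hb hba => hl.1 (hba ▸ hb)
    rw [List.map_cons, List.prod_cons, PowerSeries.coeff_mul, List.toFinset_cons,
      ← Finset.cons_eq_insert _ _ ha, Finset.piAntidiag_cons, Finset.sum_disjiUnion]
    refine Finset.sum_congr rfl fun p _ => ?_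
    rw [ih hl.2, PowerSeries.coeff_mk, Finset.mul_sum, Finset.sum_map]
    refine Finset.sum_congr rfl fun k hk => ?_
    have hka : k a = 0 := by
      by_contra h
      exact ha ((Finset.mem_piAntidiag.1 hk).2 a h)
    have hk' : ∀ b ∈ l,
        (addRightEmbedding (fun t => if t = a then p.1 else 0) k : L → ℕ) b = k b := by
      intro b hb
      simp [hmem b hb]
    have hk'' : (addRightEmbedding (fun t => if t = a then p.1 else 0) k : L → ℕ) a = p.1 := by
      simp [hka]
    rw [List.map_cons, List.prod_cons, List.map_cons, List.prod_cons, hk'',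
      List.map_congr_left fun b hb => congrArg (f b) (hk' b hb),
      List.map_congr_left fun b hb => congrArg (g b) (hk' b hb)]
    have hc : Commute (g a p.1) (l.map fun b => f b (k b)).prod := by
      refine Commute.list_prod_right _ _ fun t ht => ?_
      obtain ⟨b, _, rfl⟩ := List.mem_map.1 ht
      exact (hfg _ _ _ _).symm
    rw [mul_assoc, ← mul_assoc (g a p.1), hc.eq, mul_assoc, mul_assoc]

end Series

/-! ### The positive relations generate a coideal -/

section Currents
variable {ι : Type u} {B : Type*} [Ring B] [Algebra ℂ B]

lemma qij_ne_zero (A : Matrix ι ι ℤ) (d : ι → ℕ) {q : ℂ} (hq0 : q ≠ 0) (i j : ι) :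
    qij A d q i j ≠ 0 := zpow_ne_zero _ hq0

/-- The letter `none` of a Serre word stands for `x_j`, the other letters stand for `x_i`. -/
def letter {m : ℕ} (i j : ι) : Option (Fin m) → ι
  | none => j
  | some _ => i

/-- The exponents of the letters of a Serre word. -/
def letterMode {m : ℕ} (n : Fin m → ℤ) (l : ℤ) : Option (Fin m) → ℤ
  | none => l
  | some s => n s

lemma serre_eq (A : Matrix ι ι ℤ) (d : ι → ℕ) (q : ℂ) (i j : ι)
    (n : Fin (1 - A i j).toNat → ℤ) (l : ℤ) : serre A d q i j n l =
      ∑ r ∈ Finset.range ((1 - A i j).toNat + 1), ∑ σ : Equiv.Perm (Fin (1 - A i j).toNat),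
        ((-1) ^ r * qBinom (q ^ d i) (1 - A i j).toNat r) •
          ((serreWord σ r).map fun a => X (letter i j a) (letterMode n l a)).prod := by
  unfold serre
  refine Finset.sum_congr rfl fun r _ => ?_
  rw [Finset.smul_sum]
  refine Finset.sum_congr rfl fun σ _ => congrArg _ ?_
  rw [serreWord, List.map_append, List.map_cons, List.prod_append, List.prod_cons, ← mul_assoc,
    List.map_take, List.map_drop, List.map_ofFn]
  rfl

/-- The images of the relations of the positive algebra under a surjective morphism. -/
structure PlusRelations (A : Matrix ι ι ℤ) (d : ι → ℕ) (q : ℂ) (π : Borel ι →ₐ[ℂ] B) : Prop where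
  surj : Function.Surjective π
  cartan : ∀ i j k l, Commute (π (Hz i k)) (π (Hz j l))
  action : ∀ i j, ActionRel (qij A d q i j) (fun s => π (cpow s)) (fun k => π (Hz i k))
    (fun n => π (X j n))
  exchange : ∀ i j, ExchangeRel (qij A d q i j) (fun n => π (X i n)) (fun n => π (X j n))
  serre : ∀ i j, i ≠ j → ∀ n l, π (serre A d q i j n l) = 0

lemma PlusRelations.of_idealPlus {A : Matrix ι ι ℤ} {d : ι → ℕ} {q : ℂ} (hq0 : q ≠ 0)
    {π : Borel ι →ₐ[ℂ] B} (hs : Function.Surjective π) (hπ : ∀ a ∈ idealPlus A d q, π a = 0) :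
    PlusRelations A d q π where
  surj := hs
  cartan i j k l := by
    unfold Hz
    split_ifs
    · have := hπ _ (TwoSidedIdeal.subset_span (Or.inl (Or.inl (Or.inl
        ⟨i, k.toNat, j, l.toNat, rfl⟩))))
      rw [map_sub, map_mul, map_mul, sub_eq_zero] at this
      exact this
    · rw [map_zero]; exact Commute.zero_right _
    · rw [map_zero]; exact Commute.zero_left _
    · rw [map_zero]
  action i j := by
    rw [actionRel_iff (qij_ne_zero A d hq0 i j)]
    · intro n m
      have := hπ _ (TwoSidedIdeal.subset_span (Or.inl (Or.inl (Or.inr ⟨i, n, j, m, rfl⟩))))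
      simp only [map_sub, map_mul, map_sum, map_smul] at this
      simpa only [actionDefect, Hz_natCast] using this
    · rw [cpow_zero, map_one]
    · intro m n; rw [cpow_add, map_mul]
    · intro m n; rw [← map_mul, cpow_comm, map_mul]
    · intro m n; rw [← map_mul, cpow_comm, map_mul]
    · intro k hk; rw [Hz_of_neg _ hk, map_zero]
  exchange i j n m := by
    have := hπ _ (TwoSidedIdeal.subset_span (Or.inl (Or.inr ⟨i, j, n, m, rfl⟩)))
    simp only [QAffine.exchange, map_sub, map_mul, map_smul] at this
    exact sub_eq_zero.1 this
  serre i j hij n l := hπ _ (TwoSidedIdeal.subset_span (Or.inr ⟨i, j, hij, n, l, rfl⟩))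

/-- The coproduct followed by a morphism on both factors. -/
def deltaVia (π : Borel ι →ₐ[ℂ] B) : Borel ι →ₐ[ℂ] HahnSeries ℤ (B ⊗[ℂ] B) :=
  (hahnMap (Algebra.TensorProduct.map π π)).comp (deltaPlus ι)

/-- The first summand of the coproduct of `x_i(z)`. -/
def leftCurrent (π : Borel ι →ₐ[ℂ] B) (i : ι) (n : ℤ) : HahnSeries ℤ (B ⊗[ℂ] B) :=
  HahnSeries.single (-n) (π (X i n) ⊗ₜ[ℂ] 1)

/-- The second summand of the coproduct of `x_i(z)`. -/
def rightCurrent (π : Borel ι →ₐ[ℂ] B) (i : ι) (n : ℤ) : HahnSeries ℤ (B ⊗[ℂ] B) :=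
  HahnSeries.ofPowerSeries ℤ _ (PowerSeries.mk fun k : ℕ =>
    (π (Hz i k) * π (cpow (-(2 * n + k)))) ⊗ₜ[ℂ] π (X i (n + k)))

variable (π : Borel ι →ₐ[ℂ] B)

lemma rightCurrent_coeff (i : ι) (n N : ℤ) : (rightCurrent π i n).coeff N =
    (π (Hz i N) * π (cpow (-(2 * n + N)))) ⊗ₜ[ℂ] π (X i (n + N)) := by
  rw [rightCurrent, ofPowerSeries_mk_coeff]
  split_ifs with h
  · lift N to ℕ using h
    rfl
  · rw [Hz_of_neg _ (not_le.1 h), map_zero, zero_mul, TensorProduct.zero_tmul]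

lemma rightCurrent_coeff_of_neg (i : ι) (n : ℤ) : ∀ N < 0, (rightCurrent π i n).coeff N = 0 := by
  intro N hN
  rw [rightCurrent_coeff, Hz_of_neg _ hN, map_zero, zero_mul, TensorProduct.zero_tmul]

lemma deltaVia_X (i : ι) (n : ℤ) :
    deltaVia π (X i n) = leftCurrent π i n + rightCurrent π i n := by
  ext N
  rw [deltaVia, AlgHom.comp_apply, hahnMap_coeff, deltaPlus_X_coeff, HahnSeries.coeff_add,
    rightCurrent_coeff, leftCurrent, HahnSeries.coeff_single, map_add,
    Algebra.TensorProduct.map_tmul, map_mul]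
  refine congrArg₂ _ ?_ rfl
  split_ifs
  · rw [Algebra.TensorProduct.map_tmul, map_one]
  · exact map_zero _

lemma deltaVia_Hz_coeff (i : ι) (K N : ℤ) : (deltaVia π (Hz i K)).coeff N =
    (π (Hz i N) * π (cpow (K - N))) ⊗ₜ[ℂ] (π (Hz i (K - N)) * π (cpow (-N))) := by
  rcases lt_or_ge K 0 with h | h
  · rw [Hz_of_neg _ h, map_zero]
    rcases lt_or_ge N 0 with h' | h'
    · rw [Hz_of_neg _ h', map_zero, zero_mul, TensorProduct.zero_tmul]
      rfl
    · rw [Hz_of_neg i (show K - N < 0 by omega), map_zero, zero_mul, TensorProduct.tmul_zero]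
      rfl
  · lift K to ℕ using h
    rw [Hz_natCast, deltaVia, AlgHom.comp_apply, hahnMap_coeff, deltaPlus_H_coeff,
      Algebra.TensorProduct.map_tmul, map_mul, map_mul]

lemma deltaVia_Hz_coeff_of_neg (i : ι) (K : ℤ) : ∀ N < 0, (deltaVia π (Hz i K)).coeff N = 0 := by
  intro N hN
  rw [deltaVia_Hz_coeff, Hz_of_neg _ hN, map_zero, zero_mul, TensorProduct.zero_tmul]

lemma deltaVia_cpow (s : ℤ) : deltaVia π (cpow s) =
    HahnSeries.single 0 (π (cpow s) ⊗ₜ[ℂ] π (cpow s)) := by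
  rw [deltaVia, AlgHom.comp_apply, deltaPlus_cpow, hahnMap_single, Algebra.TensorProduct.map_tmul]

variable {π} {A : Matrix ι ι ℤ} {d : ι → ℕ} {q : ℂ}

lemma PlusRelations.central (h : PlusRelations A d q π) (s : ℤ) (b : B) :
    π (cpow s) * b = b * π (cpow s) := by
  obtain ⟨a, rfl⟩ := h.surj b
  rw [← map_mul, cpow_comm, map_mul]

lemma PlusRelations.mul_cpow_mul (h : PlusRelations A d q π) (a b : B) (s t : ℤ) :
    (a * π (cpow s)) * (b * π (cpow t)) = a * b * π (cpow (s + t)) := by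
  rw [cpow_add, map_mul, mul_assoc, ← mul_assoc _ b, h.central s b]
  simp only [mul_assoc]

lemma PlusRelations.mul_cpow_mul' (h : PlusRelations A d q π) (a b : B) (s : ℤ) :
    (a * π (cpow s)) * b = a * b * π (cpow s) := by
  rw [mul_assoc, h.central s b, ← mul_assoc]

lemma map_mul_cpow (a : B) (s t : ℤ) :
    a * π (cpow s) * π (cpow t) = a * π (cpow (s + t)) := by
  rw [cpow_add, map_mul, mul_assoc]

lemma exchangeRel_left (h : PlusRelations A d q π) (i j : ι) :
    ExchangeRel (qij A d q i j) (leftCurrent π i) (leftCurrent π j) := by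
  intro n m
  simp only [leftCurrent, HahnSeries.single_mul_single, Algebra.TensorProduct.tmul_mul_tmul,
    mul_one]
  rw [show -(n + 1) + -m = -n + -(m + 1) by ring, show -m + -(n + 1) = -n + -(m + 1) by ring,
    show -(m + 1) + -n = -n + -(m + 1) by ring]
  have := congrArg (fun b => HahnSeries.single (-n + -(m + 1)) (b ⊗ₜ[ℂ] (1 : B)))
    (h.exchange i j n m)
  simp only [TensorProduct.sub_tmul, ← TensorProduct.smul_tmul'] at this
  convert this using 2
  · ext N
    simp only [HahnSeries.coeff_sub, HahnSeries.coeff_smul, HahnSeries.coeff_single]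
    split_ifs <;> simp
  · ext N
    simp only [HahnSeries.coeff_sub, HahnSeries.coeff_smul, HahnSeries.coeff_single]
    split_ifs <;> simp

lemma exchangeRel_right (h : PlusRelations A d q π) (i j : ι) :
    ExchangeRel (qij A d q i j) (rightCurrent π i) (rightCurrent π j) := by
  have hij : ∀ (n m N : ℤ), (rightCurrent π i n * rightCurrent π j m).coeff N =
      ∑ p ∈ Finset.Icc 0 N, (π (Hz i p) * π (Hz j (N - p)) * π (cpow (-(2 * n + 2 * m + N)))) ⊗ₜ[ℂ]
        (π (X i (n + p)) * π (X j (m + (N - p)))) := by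
    intro n m N
    rw [coeff_mul_eq_sum_Icc (rightCurrent_coeff_of_neg π i n) (rightCurrent_coeff_of_neg π j m),
      sub_zero]
    refine Finset.sum_congr rfl fun p _ => ?_
    rw [rightCurrent_coeff, rightCurrent_coeff, Algebra.TensorProduct.tmul_mul_tmul, h.mul_cpow_mul,
      show -(2 * n + p) + -(2 * m + (N - p)) = -(2 * n + 2 * m + N) by ring]
  have hji : ∀ (n m N : ℤ), (rightCurrent π j m * rightCurrent π i n).coeff N =
      ∑ p ∈ Finset.Icc 0 N, (π (Hz i p) * π (Hz j (N - p)) * π (cpow (-(2 * n + 2 * m + N)))) ⊗ₜ[ℂ]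
        (π (X j (m + (N - p))) * π (X i (n + p))) := by
    intro n m N
    rw [coeff_mul_eq_sum_Icc' (rightCurrent_coeff_of_neg π j m) (rightCurrent_coeff_of_neg π i n),
      sub_zero]
    refine Finset.sum_congr rfl fun p _ => ?_
    rw [rightCurrent_coeff, rightCurrent_coeff, Algebra.TensorProduct.tmul_mul_tmul, h.mul_cpow_mul,
      (h.cartan i j p (N - p)).eq,
      show -(2 * m + (N - p)) + -(2 * n + p) = -(2 * n + 2 * m + N) by ring]
  intro n m
  ext N
  simp only [HahnSeries.coeff_sub, HahnSeries.coeff_smul, hij, hji, Finset.smul_sum,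
    ← Finset.sum_sub_distrib]
  refine Finset.sum_congr rfl fun p _ => ?_
  rw [show 2 * n + 2 * (m + 1) = 2 * (n + 1) + 2 * m by ring]
  simp only [← TensorProduct.tmul_smul, ← TensorProduct.tmul_sub]
  have := h.exchange i j (n + p) (m + (N - p))
  simp only at this
  rw [add_right_comm n 1 p, add_right_comm m 1 (N - p), this]

/-- The first summand of the coproduct of `x_i` and the second one of that of `x_j` satisfy the
exchange relation, because `x_i` moves past the Cartan current `φ_j` in the first tensor factor. -/
lemma exchangeRel_left_right (h : PlusRelations A d q π) {i j : ι}
    (hs : qij A d q i j = qij A d q j i) :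
    ExchangeRel (qij A d q i j) (leftCurrent π i) (rightCurrent π j) := by
  have hij : ∀ (n m N : ℤ), (leftCurrent π i n * rightCurrent π j m).coeff N =
      (π (X i n) * π (Hz j (N + n)) * π (cpow (-(2 * m + N + n)))) ⊗ₜ[ℂ] π (X j (m + (N + n))) := by
    intro n m N
    rw [leftCurrent, HahnSeries.coeff_single_mul, rightCurrent_coeff,
      Algebra.TensorProduct.tmul_mul_tmul, one_mul, mul_assoc, sub_neg_eq_add, add_assoc (2 * m)]
  have hji : ∀ (n m N : ℤ), (rightCurrent π j m * leftCurrent π i n).coeff N =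
      (π (Hz j (N + n)) * π (X i n) * π (cpow (-(2 * m + N + n)))) ⊗ₜ[ℂ] π (X j (m + (N + n))) := by
    intro n m N
    rw [leftCurrent, HahnSeries.coeff_mul_single, rightCurrent_coeff,
      Algebra.TensorProduct.tmul_mul_tmul, mul_one, h.mul_cpow_mul', sub_neg_eq_add,
      add_assoc (2 * m)]
  intro n m
  ext N
  simp only [HahnSeries.coeff_sub, HahnSeries.coeff_smul, hij, hji]
  have := congrArg (fun b => (b * π (cpow (-(2 * m + N + (n + 1))))) ⊗ₜ[ℂ]
    π (X j (m + (N + (n + 1))))) (h.action j i (N + n) n)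
  simp only [sub_mul, smul_mul_assoc, map_mul_cpow, TensorProduct.sub_tmul,
    ← TensorProduct.smul_tmul', ← hs] at this
  rw [show m + 1 + (N + n) = m + (N + (n + 1)) by ring,
    show -(2 * (m + 1) + N + n) = -1 + -(2 * m + N + (n + 1)) by ring]
  rw [add_assoc N n 1] at this
  rw [sub_eq_sub_iff_add_eq_add] at this ⊢
  rw [add_comm (qij A d q i j • _), ← this, add_comm]

lemma exchangeRel_deltaVia (h : PlusRelations A d q π) {i j : ι}
    (hs : qij A d q i j = qij A d q j i) :
    ExchangeRel (qij A d q i j) (fun n => deltaVia π (X i n)) (fun n => deltaVia π (X j n)) := by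
  simp only [deltaVia_X]
  refine ExchangeRel.add_left ?_ ?_
  · refine (ExchangeRel.add_left (exchangeRel_left h i j).symm ?_).symm
    exact (exchangeRel_left_right h hs).symm
  · refine (ExchangeRel.add_left ?_ (exchangeRel_right h i j).symm).symm
    rw [hs]
    exact exchangeRel_left_right h hs.symm

lemma commute_deltaVia_Hz (h : PlusRelations A d q π) (i j : ι) (K L : ℤ) :
    Commute (deltaVia π (Hz i K)) (deltaVia π (Hz j L)) := by
  ext N
  rw [coeff_mul_eq_sum_Icc (deltaVia_Hz_coeff_of_neg π i K) (deltaVia_Hz_coeff_of_neg π j L),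
    coeff_mul_eq_sum_Icc' (deltaVia_Hz_coeff_of_neg π j L) (deltaVia_Hz_coeff_of_neg π i K)]
  refine Finset.sum_congr rfl fun p _ => ?_
  simp only [deltaVia_Hz_coeff, Algebra.TensorProduct.tmul_mul_tmul, h.mul_cpow_mul]
  rw [(h.cartan i j _ _).eq, (h.cartan i j (K - p) _).eq, add_comm (K - p), add_comm (-p)]

lemma actionRel_deltaVia (h : PlusRelations A d q π) (i j : ι) :
    ActionRel (qij A d q i j) (fun s => deltaVia π (cpow s)) (fun k => deltaVia π (Hz i k))
      (fun n => deltaVia π (X j n)) := by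
  have hl : ActionRel (qij A d q i j) (fun s => deltaVia π (cpow s)) (fun k => deltaVia π (Hz i k))
      (leftCurrent π j) := by
    have h1 : ∀ K m N : ℤ, (deltaVia π (Hz i K) * leftCurrent π j m).coeff N =
        (π (Hz i (N + m)) * π (X j m) * π (cpow (K - (N + m)))) ⊗ₜ[ℂ]
          (π (Hz i (K - (N + m))) * π (cpow (-(N + m)))) := by
      intro K m N
      rw [leftCurrent, HahnSeries.coeff_mul_single, deltaVia_Hz_coeff,
        Algebra.TensorProduct.tmul_mul_tmul, mul_one, h.mul_cpow_mul', sub_neg_eq_add]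
    have h2 : ∀ K m N : ℤ, (leftCurrent π j m * deltaVia π (Hz i K)).coeff N =
        (π (X j m) * π (Hz i (N + m)) * π (cpow (K - (N + m)))) ⊗ₜ[ℂ]
          (π (Hz i (K - (N + m))) * π (cpow (-(N + m)))) := by
      intro K m N
      rw [leftCurrent, HahnSeries.coeff_single_mul, deltaVia_Hz_coeff,
        Algebra.TensorProduct.tmul_mul_tmul, one_mul, mul_assoc, sub_neg_eq_add]
    intro K m
    ext N
    simp only [deltaVia_cpow, HahnSeries.coeff_sub, HahnSeries.coeff_smul,
      HahnSeries.coeff_mul_single_zero, h1, h2, Algebra.TensorProduct.tmul_mul_tmul, map_mul_cpow]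
    have := congrArg (fun b => (b * π (cpow (K - (N + m)))) ⊗ₜ[ℂ]
      (π (Hz i (K - (N + m))) * π (cpow (-(N + m) + -1)))) (h.action i j (N + m) m)
    simp only [sub_mul, smul_mul_assoc, map_mul_cpow, TensorProduct.sub_tmul,
      ← TensorProduct.smul_tmul'] at this
    rw [show K + 1 - (N + (m + 1)) = K - (N + m) by ring,
      show -(N + (m + 1)) = -(N + m) + -1 by ring,
      add_comm (K - (N + m)), ← add_assoc N m]
    exact this
  have hr : ActionRel (qij A d q i j) (fun s => deltaVia π (cpow s)) (fun k => deltaVia π (Hz i k))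
      (rightCurrent π j) := by
    have h1 : ∀ K m N : ℤ, (deltaVia π (Hz i K) * rightCurrent π j m).coeff N =
        ∑ p ∈ Finset.Icc 0 N, (π (Hz i p) * π (Hz j (N - p)) * π (cpow (K - 2 * m - N))) ⊗ₜ[ℂ]
          (π (Hz i (K - p)) * π (X j (m + (N - p))) * π (cpow (-p))) := by
      intro K m N
      rw [coeff_mul_eq_sum_Icc (deltaVia_Hz_coeff_of_neg π i K) (rightCurrent_coeff_of_neg π j m),
        sub_zero]
      refine Finset.sum_congr rfl fun p _ => ?_
      rw [deltaVia_Hz_coeff, rightCurrent_coeff, Algebra.TensorProduct.tmul_mul_tmul,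
        h.mul_cpow_mul, h.mul_cpow_mul', show K - p + -(2 * m + (N - p)) = K - 2 * m - N by ring]
    have h2 : ∀ K m N : ℤ, (rightCurrent π j m * deltaVia π (Hz i K)).coeff N =
        ∑ p ∈ Finset.Icc 0 N, (π (Hz i p) * π (Hz j (N - p)) * π (cpow (K - 2 * m - N))) ⊗ₜ[ℂ]
          (π (X j (m + (N - p))) * π (Hz i (K - p)) * π (cpow (-p))) := by
      intro K m N
      rw [coeff_mul_eq_sum_Icc' (rightCurrent_coeff_of_neg π j m) (deltaVia_Hz_coeff_of_neg π i K),
        sub_zero]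
      refine Finset.sum_congr rfl fun p _ => ?_
      rw [deltaVia_Hz_coeff, rightCurrent_coeff, Algebra.TensorProduct.tmul_mul_tmul,
        h.mul_cpow_mul, (h.cartan i j p _).eq, ← mul_assoc (π (X j _)),
        show -(2 * m + (N - p)) + (K - p) = K - 2 * m - N by ring]
    intro K m
    ext N
    simp only [deltaVia_cpow, HahnSeries.coeff_sub, HahnSeries.coeff_smul,
      HahnSeries.coeff_mul_single_zero, h1, h2, Finset.sum_mul, Finset.smul_sum,
      ← Finset.sum_sub_distrib, Algebra.TensorProduct.tmul_mul_tmul, map_mul_cpow]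
    refine Finset.sum_congr rfl fun p _ => ?_
    have := congrArg (fun b => (π (Hz i p) * π (Hz j (N - p)) * π (cpow (K - 2 * m - N + -1))) ⊗ₜ[ℂ]
      (b * π (cpow (-p)))) (h.action i j (K - p) (m + (N - p)))
    simp only [sub_mul, smul_mul_assoc, map_mul_cpow, TensorProduct.tmul_sub,
      TensorProduct.tmul_smul] at this
    rw [show K + 1 - 2 * (m + 1) - N = K - 2 * m - N + -1 by ring, add_comm (-p),
      show m + 1 + (N - p) = m + (N - p) + 1 by ring, show K + 1 - p = K - p + 1 by ring]
    exact this
  intro K m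
  have h1 := hl K m
  have h2 := hr K m
  simp only [deltaVia_X, mul_add, add_mul, smul_add]
  rw [add_sub_add_comm, h1, h2]
  abel

lemma PlusRelations.sum_serreWord (h : PlusRelations A d q π) {i j : ι} (hij : i ≠ j)
    (n : Option (Fin (1 - A i j).toNat) → ℤ) :
    ∑ r ∈ Finset.range ((1 - A i j).toNat + 1), ∑ σ : Equiv.Perm (Fin (1 - A i j).toNat),
      ((-1) ^ r * qBinom (q ^ d i) (1 - A i j).toNat r) •
        ((serreWord σ r).map fun a => π (X (letter i j a) (n a))).prod = 0 := by
  have := h.serre i j hij (fun s => n (some s)) (n none)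
  have hn : letterMode (fun s => n (some s)) (n none) = n := by
    funext a
    cases a <;> rfl
  rw [serre_eq, hn] at this
  simpa only [map_sum, map_smul, map_list_prod, List.map_map, Function.comp_def] using this

lemma prod_map_single {R L : Type*} [Ring R] (f : L → ℤ) (g : L → R) (l : List L) :
    (l.map fun a => HahnSeries.single (f a) (g a)).prod =
      HahnSeries.single (l.map f).sum (l.map g).prod := by
  induction l with
  | nil => rfl
  | cons a l ih => rw [List.map_cons, List.prod_cons, ih, HahnSeries.single_mul_single]; simp

/-- The part of the coproduct of a Serre element that involves only first summands. -/
lemma serre_left (h : PlusRelations A d q π) {i j : ι} (hij : i ≠ j)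
    (n : Option (Fin (1 - A i j).toNat) → ℤ) :
    ∑ r ∈ Finset.range ((1 - A i j).toNat + 1), ∑ σ : Equiv.Perm (Fin (1 - A i j).toNat),
      ((-1) ^ r * qBinom (q ^ d i) (1 - A i j).toNat r) •
        ((serreWord σ r).map fun a => leftCurrent π (letter i j a) (n a)).prod = 0 := by
  have hw : ∀ (r : ℕ) (σ : Equiv.Perm (Fin (1 - A i j).toNat)),
      ((serreWord σ r).map fun a => leftCurrent π (letter i j a) (n a)).prod =
        HahnSeries.single (∑ a, -n a)
          ((((serreWord σ r).map fun a => π (X (letter i j a) (n a))).prod) ⊗ₜ[ℂ] (1 : B)) := by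
    intro r σ
    simp only [leftCurrent]
    rw [prod_map_single (fun a => -n a), ((mem_serreWord σ r).map _).sum_eq, Finset.sum_map_toList]
    refine congrArg _ ?_
    have := map_list_prod (Algebra.TensorProduct.includeLeft : B →ₐ[ℂ] B ⊗[ℂ] B)
      ((serreWord σ r).map fun a => π (X (letter i j a) (n a)))
    rw [Algebra.TensorProduct.includeLeft_apply, List.map_map] at this
    exact this.symm
  ext N
  have := congrArg (fun b => if N = ∑ a, -n a then b ⊗ₜ[ℂ] (1 : B) else 0) (h.sum_serreWord hij n)
  simp only [TensorProduct.sum_tmul, ← TensorProduct.smul_tmul', TensorProduct.zero_tmul,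
    ite_self] at this
  simp only [hw, HahnSeries.coeff_sum, HahnSeries.coeff_smul, HahnSeries.coeff_single]
  split_ifs with hN
  · rw [if_pos hN] at this
    exact this
  · simp

/-- The part of the coproduct of a Serre element that involves only second summands. -/
lemma serre_right (h : PlusRelations A d q π) {i j : ι} (hij : i ≠ j)
    (n : Option (Fin (1 - A i j).toNat) → ℤ) :
    ∑ r ∈ Finset.range ((1 - A i j).toNat + 1), ∑ σ : Equiv.Perm (Fin (1 - A i j).toNat),
      ((-1) ^ r * qBinom (q ^ d i) (1 - A i j).toNat r) •
        ((serreWord σ r).map fun a => rightCurrent π (letter i j a) (n a)).prod = 0 := by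
  let f : Option (Fin (1 - A i j).toNat) → ℕ → B := fun a k =>
    π (Hz (letter i j a) k) * π (cpow (-(2 * n a + k)))
  have hf : ∀ a k b k', Commute (f a k) (f b k') := by
    intro a k b k'
    change _ * _ = _ * _
    simp only [f]
    rw [h.mul_cpow_mul, h.mul_cpow_mul, (h.cartan _ _ _ _).eq, add_comm (-(2 * n a + k))]
  let F : Option (Fin (1 - A i j).toNat) → ℕ → B ⊗[ℂ] B := fun a k => f a k ⊗ₜ[ℂ] 1
  let G : Option (Fin (1 - A i j).toNat) → ℕ → B ⊗[ℂ] B := fun a k =>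
    1 ⊗ₜ[ℂ] π (X (letter i j a) (n a + k))
  have hFG : ∀ a k b k', Commute (F a k) (G b k') := by
    intro a k b k'
    change _ * _ = _ * _
    simp only [F, G, Algebra.TensorProduct.tmul_mul_tmul, one_mul, mul_one]
  -- the factors in the first tensor factor commute, so their product does not depend on the word
  have hw : ∀ (r : ℕ) (σ : Equiv.Perm (Fin (1 - A i j).toNat)),
      ((serreWord σ r).map fun a => rightCurrent π (letter i j a) (n a)).prod =
        HahnSeries.ofPowerSeries ℤ _ (PowerSeries.mk fun N =>
          ∑ k ∈ Finset.piAntidiag Finset.univ N,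
            (Finset.univ.toList.map fun a => F a (k a)).prod *
              1 ⊗ₜ[ℂ] ((serreWord σ r).map fun a => π (X (letter i j a) (n a + k a))).prod) := by
    intro r σ
    have hp := mem_serreWord σ r
    have hnd := (List.Perm.nodup_iff hp).2 (Finset.nodup_toList _)
    have hy : (fun a => rightCurrent π (letter i j a) (n a)) = fun a =>
        HahnSeries.ofPowerSeries ℤ _ (PowerSeries.mk fun k => F a k * G a k) := by
      funext a
      simp only [F, G, f, Algebra.TensorProduct.tmul_mul_tmul, one_mul, mul_one]
      rfl
    have hu : (serreWord σ r).toFinset = Finset.univ := by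
      rw [List.toFinset_eq_of_perm _ _ hp, Finset.toList_toFinset]
    have hmap := map_list_prod (HahnSeries.ofPowerSeries ℤ (B ⊗[ℂ] B))
      ((serreWord σ r).map fun a => PowerSeries.mk fun k => F a k * G a k)
    rw [List.map_map] at hmap
    rw [hy]
    refine hmap.symm.trans (congrArg _ (PowerSeries.ext fun N => ?_))
    rw [coeff_prod_map_mk F G hFG _ hnd, PowerSeries.coeff_mk, hu]
    refine Finset.sum_congr rfl fun k _ => congrArg₂ _ ?_ ?_
    · refine (hp.map _).prod_eq' ?_
      rw [List.pairwise_map]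
      refine List.pairwise_of_forall fun a b => ?_
      change _ * _ = _ * _
      simp only [F, Algebra.TensorProduct.tmul_mul_tmul, (hf a (k a) b (k b)).eq]
    · have := map_list_prod (Algebra.TensorProduct.includeRight : B →ₐ[ℂ] B ⊗[ℂ] B)
        ((serreWord σ r).map fun a => π (X (letter i j a) (n a + k a)))
      rw [Algebra.TensorProduct.includeRight_apply, List.map_map] at this
      exact this.symm
  ext N
  rcases lt_or_ge N 0 with hN | hN
  · simp only [hw, HahnSeries.coeff_sum, HahnSeries.coeff_smul, ofPowerSeries_mk_coeff,
      if_neg (not_le.2 hN)]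
    simp
  · lift N to ℕ using hN
    simp only [hw, HahnSeries.coeff_sum, HahnSeries.coeff_smul,
      HahnSeries.ofPowerSeries_apply_coeff, PowerSeries.coeff_mk, Finset.smul_sum]
    rw [Finset.sum_congr rfl fun r _ => Finset.sum_comm, Finset.sum_comm]
    refine Finset.sum_eq_zero fun k _ => ?_
    have := congrArg (fun b => (Finset.univ.toList.map fun a => F a (k a)).prod * 1 ⊗ₜ[ℂ] b)
      (h.sum_serreWord hij fun a => n a + k a)
    simpa only [TensorProduct.tmul_sum, TensorProduct.tmul_smul, Finset.mul_sum, mul_smul_comm,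
      TensorProduct.tmul_zero, mul_zero] using this

lemma serreQ_letter {i j : ι} (hd : ∀ i, A i i = 2) (hA : A i j ≤ 0)
    (hs : qij A d q i j = qij A d q j i) {a b : Option (Fin (1 - A i j).toNat)} (hab : a ≠ b) :
    serreQ (q ^ d i) (1 - A i j).toNat a b = qij A d q (letter i j a) (letter i j b) := by
  have h1 : (q ^ d i) ^ (1 - ((1 - A i j).toNat : ℤ)) = qij A d q i j := by
    rw [qij, Int.toNat_of_nonneg (by omega), sub_sub_cancel, zpow_mul, zpow_natCast]
  rcases a with _ | a <;> rcases b with _ | b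
  · exact absurd rfl hab
  · exact h1.trans hs
  · exact h1
  · simp only [serreQ, letter, qij, hd, zpow_mul, zpow_natCast]
    norm_cast

/-- Each root current has a coproduct with two summands, so the coproduct of a Serre series is a sum
over the subsets of the letters. The empty and the full subset give Serre series of one of the
summands, and the other ones vanish by `mixed_serre_eq_zero`. -/
lemma deltaVia_serre (hq0 : q ≠ 0) (hq : ∀ n : ℕ, 0 < n → q ^ n ≠ 1) (h : PlusRelations A d q π)
    (hd : ∀ i, A i i = 2) (hdp : ∀ i, 0 < d i) (hs : ∀ i j, qij A d q i j = qij A d q j i)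
    {i j : ι} (hij : i ≠ j) (hA : A i j ≤ 0) (n : Fin (1 - A i j).toNat → ℤ) (l : ℤ) :
    deltaVia π (serre A d q i j n l) = 0 := by
  classical
  have hw : ∀ (r : ℕ) (σ : Equiv.Perm (Fin (1 - A i j).toNat)),
      deltaVia π ((serreWord σ r).map fun a => X (letter i j a) (letterMode n l a)).prod =
        ∑ s : Finset (Option (Fin (1 - A i j).toNat)), ((serreWord σ r).map fun a =>
          if a ∈ s then leftCurrent π (letter i j a) (letterMode n l a)
          else rightCurrent π (letter i j a) (letterMode n l a)).prod := by
    intro r σ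
    have hp := mem_serreWord σ r
    have hnd := (List.Perm.nodup_iff hp).2 (Finset.nodup_toList _)
    have hu : (serreWord σ r).toFinset = Finset.univ := by
      rw [List.toFinset_eq_of_perm _ _ hp, Finset.toList_toFinset]
    rw [map_list_prod, List.map_map]
    have := prod_map_add (fun a => leftCurrent π (letter i j a) (letterMode n l a))
      (fun a => rightCurrent π (letter i j a) (letterMode n l a)) (serreWord σ r) hnd
    rw [hu, Finset.powerset_univ] at this
    rw [← this]
    simp only [Function.comp_def, deltaVia_X]
  rw [serre_eq]
  simp only [map_sum, map_smul, hw, Finset.smul_sum]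
  rw [Finset.sum_congr rfl fun r _ => Finset.sum_comm, Finset.sum_comm]
  refine Finset.sum_eq_zero fun s _ => ?_
  by_cases hmix : ∃ t, ¬ (some t ∈ s ↔ none ∈ s)
  · refine mixed_serre_eq_zero (q ^ d i) (pow_ne_zero _ hq0) (fun k hk => ?_)
      (fun a k => if a ∈ s then leftCurrent π (letter i j a) k else rightCurrent π (letter i j a) k)
      (fun a b hab => ?_) (fun a => a ∈ s) hmix (fun a k N hN => ?_) (letterMode n l)
    · rw [← pow_mul]
      exact hq _ (Nat.mul_pos (hdp i) hk)
    · rw [serreQ_letter hd hA (hs i j) hab]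
      by_cases ha : a ∈ s <;> by_cases hb : b ∈ s
      · simpa only [if_pos ha, if_pos hb] using exchangeRel_left h _ _
      · simpa only [if_pos ha, if_neg hb] using exchangeRel_left_right h (hs _ _)
      · rw [hs]
        simpa only [if_neg ha, if_pos hb] using (exchangeRel_left_right h (hs _ _)).symm
      · simpa only [if_neg ha, if_neg hb] using exchangeRel_right h _ _
    · by_cases ha : a ∈ s
      · simp only [if_pos ha] at hN ⊢
        exact HahnSeries.coeff_single_of_ne hN.ne
      · simp only [if_neg ha] at hN ⊢
        exact rightCurrent_coeff_of_neg π _ _ N hN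
  · push Not at hmix
    by_cases h0 : none ∈ s
    · have hall : ∀ a, a ∈ s := by rintro (_ | a); exacts [h0, (hmix a).2 h0]
      simpa only [if_pos (hall _)] using serre_left h hij (letterMode n l)
    · have hall : ∀ a, a ∉ s := by rintro (_ | a); exacts [h0, fun ha => h0 ((hmix a).1 ha)]
      simpa only [if_neg (hall _)] using serre_right h hij (letterMode n l)

end Currents

section Ideals
variable {ι : Type u}

/-- The quotient by a two-sided ideal, as a morphism of algebras. -/
def quotientMap (I : TwoSidedIdeal (Borel ι)) : Borel ι →ₐ[ℂ] I.ringCon.Quotient where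
  __ := I.ringCon.mk'
  commutes' _ := rfl

lemma quotientMap_surjective (I : TwoSidedIdeal (Borel ι)) :
    Function.Surjective (quotientMap I) := Quotient.mk''_surjective

lemma quotientMap_eq_zero {I : TwoSidedIdeal (Borel ι)} {a : Borel ι} :
    quotientMap I a = 0 ↔ a ∈ I := by
  rw [TwoSidedIdeal.mem_iff, ← RingCon.eq]
  rfl

lemma smul_mem_ideal {I : TwoSidedIdeal (Borel ι)} (r : ℂ) {a : Borel ι} (ha : a ∈ I) :
    r • a ∈ I := by
  rw [← one_mul a, ← smul_mul_assoc]
  exact I.mul_mem_left _ _ ha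

lemma mem_tensorIdeal_iff {I : TwoSidedIdeal (Borel ι)} {t : Borel ι ⊗[ℂ] Borel ι} :
    t ∈ tensorIdeal I ↔ Algebra.TensorProduct.map (quotientMap I) (quotientMap I) t = 0 := by
  constructor
  · intro ht
    induction ht using Submodule.span_induction with
    | zero => exact map_zero _
    | add x y _ _ hx hy => rw [map_add, hx, hy, add_zero]
    | smul r x _ hx => rw [map_smul, hx, smul_zero]
    | mem x hx =>
      obtain ⟨u, v, h | h, rfl⟩ := hx
      · rw [Algebra.TensorProduct.map_tmul, quotientMap_eq_zero.2 h, TensorProduct.zero_tmul]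
      · rw [Algebra.TensorProduct.map_tmul, quotientMap_eq_zero.2 h, TensorProduct.tmul_zero]
  · intro ht
    have hex : Function.Exact (LinearMap.ker (quotientMap I).toLinearMap).subtype
        (quotientMap I).toLinearMap := LinearMap.exact_subtype_ker_map _
    have hs : Function.Surjective (quotientMap I).toLinearMap := quotientMap_surjective I
    have hk := TensorProduct.map_ker hex hs hex hs
    have : t ∈ (TensorProduct.map (quotientMap I).toLinearMap (quotientMap I).toLinearMap).ker := ht
    rw [hk, Submodule.mem_sup] at this
    obtain ⟨_, ⟨y, rfl⟩, _, ⟨z, rfl⟩, rfl⟩ := this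
    clear ht
    refine Submodule.add_mem _ ?_ ?_
    · induction y using TensorProduct.induction_on with
      | zero => rw [map_zero]; exact Submodule.zero_mem _
      | add x y hx hy => rw [map_add]; exact Submodule.add_mem _ hx hy
      | tmul u v => exact Submodule.subset_span ⟨u, v, Or.inr (quotientMap_eq_zero.1 v.2), rfl⟩
    · induction z using TensorProduct.induction_on with
      | zero => rw [map_zero]; exact Submodule.zero_mem _
      | add x y hx hy => rw [map_add]; exact Submodule.add_mem _ hx hy
      | tmul u v => exact Submodule.subset_span ⟨u, v, Or.inl (quotientMap_eq_zero.1 u.2), rfl⟩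

/-- A coproduct preserves an ideal if it does so on generators. -/
lemma coideal_of_generators (Δ : Borel ι →ₐ[ℂ] CompletedTensor ι) (s : Set (Borel ι))
    (hs : ∀ a ∈ s, ∀ m, (Δ a).coeff m ∈ tensorIdeal (TwoSidedIdeal.span s)) :
    ∀ a ∈ TwoSidedIdeal.span s, ∀ m, (Δ a).coeff m ∈ tensorIdeal (TwoSidedIdeal.span s) := by
  set I := TwoSidedIdeal.span s with hI
  let D := (hahnMap (Algebra.TensorProduct.map (quotientMap I) (quotientMap I))).comp Δ
  have hD : ∀ a, a ∈ TwoSidedIdeal.ker D ↔ ∀ m, (Δ a).coeff m ∈ tensorIdeal I := by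
    intro a
    rw [TwoSidedIdeal.mem_ker, HahnSeries.ext_iff, funext_iff]
    exact forall_congr' fun m => mem_tensorIdeal_iff.symm
  have hle : I ≤ TwoSidedIdeal.ker D :=
    TwoSidedIdeal.span_le.2 fun a ha => (hD a).2 (hs a ha)
  exact fun a ha => (hD a).1 (hle ha)

variable {A : Matrix ι ι ℤ} {d : ι → ℕ} {q : ℂ}

/-- The coproduct satisfies the relations again when its two factors are reduced modulo the
ideal. -/
theorem coideal_plus [Fintype ι] (hA : IsSimpleCartan A d) (hq0 : q ≠ 0)
    (hq : ∀ n : ℕ, 0 < n → q ^ n ≠ 1) :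
    ∀ a ∈ idealPlus A d q, ∀ m, (deltaPlus ι a).coeff m ∈ tensorIdeal (idealPlus A d q) := by
  have h : PlusRelations A d q (quotientMap (idealPlus A d q)) :=
    PlusRelations.of_idealPlus hq0 (quotientMap_surjective _) fun a => quotientMap_eq_zero.2
  set π := quotientMap (idealPlus A d q) with hπ
  have hs : ∀ i j, qij A d q i j = qij A d q j i := fun i j => by rw [qij, qij, hA.symm]
  suffices hgen : ∀ a ∈ cartanSet ι ∪ actionPlusSet A d q ∪ exchangePlusSet A d q ∪ serreSet A d q,
      deltaVia π a = 0 by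
    refine coideal_of_generators _ _ fun a ha m => mem_tensorIdeal_iff.2 ?_
    have := congrArg (fun x => x.coeff m) (hgen a ha)
    exact this
  rintro a (((⟨i, k, j, l, rfl⟩ | ⟨i, n, j, m, rfl⟩) | ⟨i, j, n, m, rfl⟩) | ⟨i, j, hij, n, l, rfl⟩)
  · rw [← Hz_natCast, ← Hz_natCast, map_sub, map_mul, map_mul,
      (commute_deltaVia_Hz h i j k l).eq, sub_self]
  · have hact := actionRel_deltaVia h i j
    rw [actionRel_iff (qij_ne_zero A d hq0 i j)] at hact
    · have := hact n m
      simp only [map_sub, map_mul, map_sum, map_smul]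
      simpa only [actionDefect, Hz_natCast] using this
    · rw [cpow_zero, map_one]
    · intro m n; rw [cpow_add, map_mul]
    · intro m n; rw [← map_mul, cpow_comm, map_mul]
    · intro m n; rw [← map_mul, cpow_comm, map_mul]
    · intro k hk; rw [Hz_of_neg _ hk, map_zero]
  · simp only [exchange, map_sub, map_mul, map_smul]
    exact sub_eq_zero.2 (exchangeRel_deltaVia h (hs i j) n m)
  · exact deltaVia_serre hq0 hq h hA.diag hA.d_pos hs hij (hA.offDiag i j hij) n l

/-! ### Transport of the relations to the negative algebra -/

lemma theta_exchange {Q : ℂ} (hQ : Q ≠ 0) (i j : ι) (n m : ℤ) :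
    theta ι (exchange Q i j n m) = (-Q) • exchange Q⁻¹ i j (-n - 1) (-m - 1) := by
  simp only [exchange, map_sub, map_mul, map_smul, theta_X, smul_sub, smul_smul, neg_mul,
    mul_inv_cancel₀ hQ, sub_add_cancel, neg_smul, one_smul, neg_add']
  abel

lemma theta_serre (i j : ι) (n : Fin (1 - A i j).toNat → ℤ) (l : ℤ) :
    theta ι (serre A d q i j n l) = serre A d q i j (fun s => -n s) (-l) := by
  rw [serre_eq, serre_eq]
  have hn : ∀ a, letterMode (fun s => -n s) (-l) a = -letterMode n l a := by rintro (_ | a) <;> rfl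
  simp only [map_sum, map_smul, map_list_prod, List.map_map, Function.comp_def, theta_X, hn]

lemma theta_actionPlus {a : Borel ι} (ha : a ∈ actionPlusSet A d q) :
    theta ι a ∈ actionMinusSet A d q := by
  obtain ⟨i, n, j, m, rfl⟩ := ha
  refine ⟨i, n, j, -m, ?_⟩
  simp only [map_sub, map_mul, map_sum, map_smul, theta_X, theta_H, theta_cpow, neg_neg, neg_sub',
    sub_neg_eq_add]

lemma theta_actionMinus {a : Borel ι} (ha : a ∈ actionMinusSet A d q) :
    theta ι a ∈ actionPlusSet A d q := by
  obtain ⟨i, n, j, m, rfl⟩ := ha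
  refine ⟨i, n, j, -m, ?_⟩
  simp only [map_sub, map_mul, map_sum, map_smul, theta_X, theta_H, theta_cpow, neg_add']

lemma theta_cartan {a : Borel ι} (ha : a ∈ cartanSet ι) : theta ι a = a := by
  obtain ⟨i, k, j, l, rfl⟩ := ha
  simp only [map_sub, map_mul, theta_H]

lemma theta_idealPlus (hq0 : q ≠ 0) {a : Borel ι} (ha : a ∈ idealPlus A d q) :
    theta ι a ∈ idealMinus A d q := by
  suffices h : idealPlus A d q ≤ TwoSidedIdeal.comap (theta ι) (idealMinus A d q) from
    (TwoSidedIdeal.mem_comap _).1 (h ha)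
  refine TwoSidedIdeal.span_le.2 fun a ha => (TwoSidedIdeal.mem_comap _).2 ?_
  rcases ha with ((ha | ha) | ha) | ha
  · rw [theta_cartan ha]
    exact TwoSidedIdeal.subset_span (Or.inl (Or.inl (Or.inl ha)))
  · exact TwoSidedIdeal.subset_span (Or.inl (Or.inl (Or.inr (theta_actionPlus ha))))
  · obtain ⟨i, j, n, m, rfl⟩ := ha
    rw [theta_exchange (qij_ne_zero A d hq0 i j)]
    exact smul_mem_ideal _ (TwoSidedIdeal.subset_span (Or.inl (Or.inr ⟨_, _, _, _, rfl⟩)))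
  · obtain ⟨i, j, hij, n, l, rfl⟩ := ha
    rw [theta_serre]
    exact TwoSidedIdeal.subset_span (Or.inr ⟨_, _, hij, _, _, rfl⟩)

lemma sub_mem_loopSpace {a b : Borel ι} {N : ℤ} (ha : a ∈ loopSpace ι N) (hb : b ∈ loopSpace ι N) :
    a - b ∈ loopSpace ι N := Submodule.sub_mem _ ha hb

lemma cartan_mem_loopSpace {a : Borel ι} (ha : a ∈ cartanSet ι) : ∃ N, a ∈ loopSpace ι N := by
  obtain ⟨i, k, j, l, rfl⟩ := ha
  refine ⟨-k + -l, sub_mem_loopSpace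
    (mul_mem_loopSpace (gen_mem_loopSpace (Gen.h i k)) (gen_mem_loopSpace (Gen.h j l))) ?_⟩
  rw [add_comm]
  exact mul_mem_loopSpace (gen_mem_loopSpace (Gen.h j l)) (gen_mem_loopSpace (Gen.h i k))

lemma action_mem_loopSpace {a : Borel ι} (ha : a ∈ actionPlusSet A d q) :
    ∃ N, a ∈ loopSpace ι N := by
  obtain ⟨i, n, j, m, rfl⟩ := ha
  refine ⟨-n + m, sub_mem_loopSpace
    (mul_mem_loopSpace (gen_mem_loopSpace (Gen.h i n)) (gen_mem_loopSpace (Gen.x j m))) ?_⟩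
  refine Submodule.sum_mem _ fun p hp => Submodule.smul_mem _ _ ?_
  rw [Finset.HasAntidiagonal.mem_antidiagonal] at hp
  have := mul_mem_loopSpace (mul_mem_loopSpace (cpow_mem_loopSpace (ι := ι) (-p.1))
    (gen_mem_loopSpace (Gen.x j (m - p.1)))) (gen_mem_loopSpace (Gen.h i p.2))
  rwa [show (0 : ℤ) + (Gen.x j (m - p.1)).loop + (Gen.h i p.2).loop = -n + m by
    simp only [Gen.loop]; omega] at this

lemma X_mul_X_mem_loopSpace (i j : ι) {n m N : ℤ} (h : n + m = N) : X i n * X j m ∈ loopSpace ι N :=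
  h ▸ mul_mem_loopSpace (gen_mem_loopSpace (Gen.x i n)) (gen_mem_loopSpace (Gen.x j m))

lemma exchange_mem_loopSpace (Q : ℂ) (i j : ι) (n m : ℤ) :
    exchange Q i j n m ∈ loopSpace ι (n + m + 1) := by
  refine sub_mem_loopSpace (sub_mem_loopSpace ?_ (Submodule.smul_mem _ _ ?_))
    (sub_mem_loopSpace (Submodule.smul_mem _ _ ?_) ?_) <;>
  exact X_mul_X_mem_loopSpace _ _ (by ring)

lemma serre_mem_loopSpace (i j : ι) (n : Fin (1 - A i j).toNat → ℤ) (l : ℤ) :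
    serre A d q i j n l ∈ loopSpace ι (∑ a, letterMode n l a) := by
  rw [serre_eq]
  refine Submodule.sum_mem _ fun r _ => Submodule.sum_mem _ fun σ _ => Submodule.smul_mem _ _ ?_
  have h : ((serreWord σ r).map fun a => X (letter i j a) (letterMode n l a)).prod =
      word ((serreWord σ r).map fun a => Gen.x (letter i j a) (letterMode n l a)) := by
    rw [word, List.map_map]
    rfl
  have h2 :
      ((serreWord σ r).map (Gen.loop ∘ fun a => Gen.x (letter i j a) (letterMode n l a))).sum =
      ∑ a, letterMode n l a := by
    rw [((mem_serreWord σ r).map _).sum_eq, Finset.sum_map_toList]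
    rfl
  rw [h, ← h2, ← List.map_map]
  exact word_mem_loopSpace _

/-- The symmetry `theta` carries the coideal property over to the negative algebra. It
is applied to the generators of the ideal, which are homogeneous for the loop degree. -/
theorem coideal_minus [Fintype ι] (hA : IsSimpleCartan A d) (hq0 : q ≠ 0)
    (hq : ∀ n : ℕ, 0 < n → q ^ n ≠ 1) :
    ∀ a ∈ idealMinus A d q, ∀ m, (deltaMinus ι a).coeff m ∈ tensorIdeal (idealMinus A d q) := by
  have hswap : ∀ t ∈ tensorIdeal (idealPlus A d q),
      thetaSwap ι t ∈ tensorIdeal (idealMinus A d q) := by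
    intro t ht
    induction ht using Submodule.span_induction with
    | zero => rw [map_zero]; exact Submodule.zero_mem _
    | add x y _ _ hx hy => rw [map_add]; exact Submodule.add_mem _ hx hy
    | smul r x _ hx => rw [map_smul]; exact Submodule.smul_mem _ _ hx
    | mem x hx =>
      obtain ⟨u, v, h, rfl⟩ := hx
      rw [thetaSwap_tmul]
      exact Submodule.subset_span
        ⟨_, _, (h.imp (theta_idealPlus hq0) (theta_idealPlus hq0)).symm, rfl⟩
  have key : ∀ b, theta ι b ∈ idealPlus A d q → (∃ N, theta ι b ∈ loopSpace ι N) →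
      ∀ m, (deltaMinus ι b).coeff m ∈ tensorIdeal (idealMinus A d q) := by
    rintro b hb ⟨N, hN⟩ m
    have := deltaMinus_theta_coeff hN m
    rw [theta_theta] at this
    rw [this]
    exact hswap _ (coideal_plus hA hq0 hq _ hb _)
  refine coideal_of_generators _ _ fun b hb => key b ?_ ?_
  · rcases hb with ((hb | hb) | hb) | hb
    · rw [theta_cartan hb]
      exact TwoSidedIdeal.subset_span (Or.inl (Or.inl (Or.inl hb)))
    · exact TwoSidedIdeal.subset_span (Or.inl (Or.inl (Or.inr (theta_actionMinus hb))))
    · obtain ⟨i, j, n, m, rfl⟩ := hb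
      rw [theta_exchange (inv_ne_zero (qij_ne_zero A d hq0 i j)), inv_inv]
      exact smul_mem_ideal _ (TwoSidedIdeal.subset_span (Or.inl (Or.inr ⟨_, _, _, _, rfl⟩)))
    · obtain ⟨i, j, hij, n, l, rfl⟩ := hb
      rw [theta_serre]
      exact TwoSidedIdeal.subset_span (Or.inr ⟨_, _, hij, _, _, rfl⟩)
  · rcases hb with ((hb | hb) | hb) | hb
    · rw [theta_cartan hb]
      exact cartan_mem_loopSpace hb
    · exact action_mem_loopSpace (theta_actionMinus hb)
    · obtain ⟨i, j, n, m, rfl⟩ := hb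
      rw [theta_exchange (inv_ne_zero (qij_ne_zero A d hq0 i j)), inv_inv]
      exact ⟨_, Submodule.smul_mem _ _ (exchange_mem_loopSpace _ _ _ _ _)⟩
    · obtain ⟨i, j, hij, n, l, rfl⟩ := hb
      rw [theta_serre]
      exact ⟨_, serre_mem_loopSpace _ _ _ _⟩

end Ideals

/-! ### Counit and antipode on the ideals of relations -/

section Antipode
variable {ι : Type u}

/-- The two-sided ideal generated by the coefficients of the currents `x_i(z)`. -/
def xIdeal (ι : Type u) : TwoSidedIdeal (Borel ι) :=
  TwoSidedIdeal.span {a | ∃ i n, a = X i n}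

lemma X_mem_xIdeal (i : ι) (n : ℤ) : X i n ∈ xIdeal ι := TwoSidedIdeal.subset_span ⟨i, n, rfl⟩

variable {A : Matrix ι ι ℤ} {d : ι → ℕ} {q : ℂ}

lemma actionPlus_mem_xIdeal {a : Borel ι} (ha : a ∈ actionPlusSet A d q) : a ∈ xIdeal ι := by
  obtain ⟨i, n, j, m, rfl⟩ := ha
  refine sub_mem ((xIdeal ι).mul_mem_left _ _ (X_mem_xIdeal j m)) (sum_mem fun p _ => ?_)
  exact smul_mem_ideal _ ((xIdeal ι).mul_mem_right _ _ ((xIdeal ι).mul_mem_left _ _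
    (X_mem_xIdeal _ _)))

lemma actionMinus_mem_xIdeal {a : Borel ι} (ha : a ∈ actionMinusSet A d q) : a ∈ xIdeal ι := by
  obtain ⟨i, n, j, m, rfl⟩ := ha
  refine sub_mem ((xIdeal ι).mul_mem_left _ _ (X_mem_xIdeal j m)) (sum_mem fun p _ => ?_)
  exact smul_mem_ideal _ ((xIdeal ι).mul_mem_right _ _ ((xIdeal ι).mul_mem_left _ _
    (X_mem_xIdeal _ _)))

lemma exchange_mem_xIdeal (Q : ℂ) (i j : ι) (n m : ℤ) : exchange Q i j n m ∈ xIdeal ι :=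
  have h : ∀ i j n m, X i n * X j m ∈ xIdeal ι := fun _ _ _ _ =>
    (xIdeal ι).mul_mem_left _ _ (X_mem_xIdeal _ _)
  sub_mem (sub_mem (h _ _ _ _) (smul_mem_ideal _ (h _ _ _ _)))
    (sub_mem (smul_mem_ideal _ (h _ _ _ _)) (h _ _ _ _))

lemma serre_mem_xIdeal {a : Borel ι} (ha : a ∈ serreSet A d q) : a ∈ xIdeal ι := by
  obtain ⟨i, j, -, n, l, rfl⟩ := ha
  refine sum_mem fun r _ => smul_mem_ideal _ (sum_mem fun σ _ => ?_)
  exact (xIdeal ι).mul_mem_right _ _ ((xIdeal ι).mul_mem_left _ _ (X_mem_xIdeal _ _))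

lemma counit_X (i : ι) (n : ℤ) : counit ι (X i n) = 0 := counit_gen _

lemma counit_H (i : ι) (k : ℕ) : counit ι (H i k) = if k = 0 then 1 else 0 := counit_gen _

lemma counit_xIdeal {a : Borel ι} (ha : a ∈ xIdeal ι) : counit ι a = 0 := by
  have h : xIdeal ι ≤ TwoSidedIdeal.ker (counit ι) := TwoSidedIdeal.span_le.2 <| by
    rintro _ ⟨i, n, rfl⟩
    exact (TwoSidedIdeal.mem_ker _).2 (counit_X i n)
  exact (TwoSidedIdeal.mem_ker _).1 (h ha)

/-- The counit vanishes on an ideal that is generated by relations between the Cartan currents and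
elements of `xIdeal`. -/
lemma counit_eq_zero_of_generators {s : Set (Borel ι)}
    (hs : ∀ a ∈ s, a ∈ cartanSet ι ∨ a ∈ xIdeal ι) :
    ∀ a ∈ TwoSidedIdeal.span s, counit ι a = 0 := by
  have h : TwoSidedIdeal.span s ≤ TwoSidedIdeal.ker (counit ι) := TwoSidedIdeal.span_le.2 <| by
    intro a ha
    refine (TwoSidedIdeal.mem_ker _).2 ?_
    rcases hs a ha with ⟨i, k, j, l, rfl⟩ | ha
    · rw [map_sub, map_mul, map_mul, mul_comm, sub_self]
    · exact counit_xIdeal ha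
  exact fun a ha => (TwoSidedIdeal.mem_ker _).1 (h ha)

/-- The span of the words of degree `N` for `Gen.hDeg`. -/
def hSpace (ι : Type u) (N : ℕ) : Submodule ℂ (Borel ι) :=
  Submodule.span ℂ {a | ∃ w : List (Gen ι), (w.map Gen.hDeg).sum = N ∧ a = word w}

lemma mul_mem_hSpace {a b : Borel ι} {M N : ℕ} (ha : a ∈ hSpace ι M)
    (hb : b ∈ hSpace ι N) : a * b ∈ hSpace ι (M + N) := by
  induction ha using Submodule.span_induction with
  | zero => rw [zero_mul]; exact Submodule.zero_mem _
  | add x y _ _ hx hy => rw [add_mul]; exact Submodule.add_mem _ hx hy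
  | smul r x _ hx => rw [smul_mul_assoc]; exact Submodule.smul_mem _ _ hx
  | mem x hx =>
    obtain ⟨w, rfl, rfl⟩ := hx
    induction hb using Submodule.span_induction with
    | zero => rw [mul_zero]; exact Submodule.zero_mem _
    | add x y _ _ hx hy => rw [mul_add]; exact Submodule.add_mem _ hx hy
    | smul r x _ hx => rw [mul_smul_comm]; exact Submodule.smul_mem _ _ hx
    | mem y hy =>
      obtain ⟨w', rfl, rfl⟩ := hy
      exact Submodule.subset_span ⟨w ++ w', by simp, (word_append _ _).symm⟩

lemma gen_mem_hSpace (g : Gen ι) : gen g ∈ hSpace ι g.hDeg :=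
  Submodule.subset_span ⟨[g], by simp, (word_singleton g).symm⟩

lemma hInvCoeff_mem_hSpace (i : ι) (k : ℕ) : hInvCoeff i k ∈ hSpace ι k := by
  induction k using Nat.strong_induction_on with
  | _ k ih =>
    rcases k with _ | k
    · rw [hInvCoeff]; exact gen_mem_hSpace (Gen.hinv i)
    · rw [hInvCoeff]
      have h1 : ∑ r : Fin (k + 1), H i ((r : ℕ) + 1) * hInvCoeff i (k - (r : ℕ)) ∈
          hSpace ι (k + 1) := by
        refine Submodule.sum_mem _ fun r _ => ?_
        have := mul_mem_hSpace (gen_mem_hSpace (Gen.h i ((r : ℕ) + 1))) (ih (k - r) (by omega))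
        rwa [show (Gen.h i ((r : ℕ) + 1)).hDeg + (k - (r : ℕ)) = k + 1 by
          simp only [Gen.hDeg]; omega] at this
      have := mul_mem_hSpace (gen_mem_hSpace (Gen.hinv i)) h1
      rw [show (Gen.hinv i).hDeg + (k + 1) = k + 1 from Nat.zero_add _] at this
      exact Submodule.neg_mem _ this

lemma mem_hIdeal_of_mem_hSpace {a : Borel ι} {k N : ℕ} (h : N < k) (ha : a ∈ hSpace ι k) :
    a ∈ hIdeal ι N := by
  induction ha using Submodule.span_induction with
  | zero => exact zero_mem _
  | add x y _ _ hx hy => exact add_mem hx hy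
  | smul r x _ hx => exact smul_mem_ideal r hx
  | mem x hx =>
    obtain ⟨w, rfl, rfl⟩ := hx
    exact TwoSidedIdeal.subset_span ⟨w, h, rfl⟩

lemma sum_H_mul_hInvCoeff (i : ι) (n : ℕ) : ∑ p ∈ Finset.HasAntidiagonal.antidiagonal n,
    H i p.1 * hInvCoeff i p.2 = if n = 0 then 1 else 0 := by
  rcases n with _ | n
  · simp [hInvCoeff, H_mul_Hinv]
  · rw [Finset.Nat.sum_antidiagonal_succ, hInvCoeff, mul_neg, ← mul_assoc, H_mul_Hinv, one_mul,
      Finset.Nat.sum_antidiagonal_eq_sum_range_succ_mk,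
      ← Fin.sum_univ_eq_sum_range (fun r => H i (r + 1) * hInvCoeff i (n - r))]
    simp

lemma coeff_gSeries_ne_zero {Q : ℂ} (hQ : Q ≠ 0) (hQ2 : Q ^ 2 ≠ 1) (p : ℕ) :
    PowerSeries.coeff (p + 1) (gSeries Q) ≠ 0 := by
  induction p with
  | zero =>
    intro h
    have h0 := coeff_zero_gSeries hQ
    have h1 := coeff_succ_gSeries hQ 0
    rw [h, if_pos rfl, mul_zero, sub_zero] at h1
    rw [h1] at h0
    exact hQ2 (by rw [sq, h0])
  | succ p ih =>
    intro h
    have h1 := coeff_succ_gSeries hQ (p + 1)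
    rw [h, if_neg (Nat.succ_ne_zero p), mul_zero, sub_zero] at h1
    exact ih h1

/-- If `h(t) y = a(t) h(t)` for an invertible series `h` such that `h` and its inverse are
polynomials of degree at most `N`, then `a` is a polynomial of degree at most `2 N`. -/
lemma eq_zero_of_conjugation {R : Type*} [Ring R] (h k : ℕ → R) (a : ℕ → R) (y : R) (N : ℕ)
    (hk : ∀ n, ∑ p ∈ Finset.HasAntidiagonal.antidiagonal n, h p.1 * k p.2 = if n = 0 then 1 else 0)
    (hN : ∀ n, N < n → h n = 0) (kN : ∀ n, N < n → k n = 0)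
    (hy : ∀ n, h n * y = ∑ p ∈ Finset.HasAntidiagonal.antidiagonal n, a p.1 * h p.2) :
    a (2 * N + 1) = 0 := by
  have h1 : PowerSeries.mk h * PowerSeries.mk k = 1 := by
    ext n
    rw [PowerSeries.coeff_mul, PowerSeries.coeff_one]
    simpa only [PowerSeries.coeff_mk] using hk n
  have h2 : PowerSeries.mk a * PowerSeries.mk h = PowerSeries.mk fun n => h n * y := by
    ext n
    rw [PowerSeries.coeff_mul, PowerSeries.coeff_mk]
    simpa only [PowerSeries.coeff_mk] using (hy n).symm
  have h3 : PowerSeries.mk a = (PowerSeries.mk fun n => h n * y) * PowerSeries.mk k := by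
    rw [← h2, mul_assoc, h1, mul_one]
  rw [← PowerSeries.coeff_mk (2 * N + 1) a, h3, PowerSeries.coeff_mul]
  refine Finset.sum_eq_zero fun p hp => ?_
  rw [Finset.HasAntidiagonal.mem_antidiagonal] at hp
  rw [PowerSeries.coeff_mk, PowerSeries.coeff_mk]
  rcases lt_or_ge N p.1 with h | h
  · rw [hN _ h, zero_mul, zero_mul]
  · rw [kN _ (by omega), mul_zero]

/-- The relation between `φ_i(z)` and `x_i(w)` puts the elements `X i n` into the closure of the
ideal. Modulo the words of large degree in the Cartan currents, `φ_i` and its inverse are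
polynomials. Hence the conjugate of `x_i` by `φ_i` is a polynomial as well, although it is given by
the series `g_{ii}`, none of whose coefficients vanishes. The sign `s` distinguishes the
positive and the negative algebra. -/
lemma X_mem_closure {I : TwoSidedIdeal (Borel ι)} {Q : ℂ} (hQ : Q ≠ 0) (hQ2 : Q ^ 2 ≠ 1) (i : ι)
    (s : ℤ) (hI : ∀ (n : ℕ) (m : ℤ), H i n * X i m - ∑ p ∈ Finset.HasAntidiagonal.antidiagonal n,
      PowerSeries.coeff p.1 (gSeries Q) • (cpow (s * p.1) * X i (m + s * p.1) * H i p.2) ∈ I)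
    (n : ℤ) (N : ℕ) : X i n ∈ I ⊔ hIdeal ι N := by
  set J := I ⊔ hIdeal ι N
  have hN : ∀ {a : Borel ι} {k : ℕ}, N < k → a ∈ hSpace ι k → quotientMap J a = 0 := fun h ha =>
    quotientMap_eq_zero.2 (TwoSidedIdeal.mem_sup_right (mem_hIdeal_of_mem_hSpace h ha))
  set M : ℕ := 2 * N + 1 with hM
  have key := eq_zero_of_conjugation (fun k => quotientMap J (H i k))
    (fun k => quotientMap J (hInvCoeff i k))
    (fun p => quotientMap J (PowerSeries.coeff p (gSeries Q) •
      (cpow (s * p) * X i (n - s * M + s * p)))) (quotientMap J (X i (n - s * M))) N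
    (fun k => by
      have := congrArg (quotientMap J) (sum_H_mul_hInvCoeff i k)
      rw [map_sum, apply_ite (quotientMap J), map_one, map_zero] at this
      simpa only [map_mul] using this)
    (fun k hk => hN hk (gen_mem_hSpace (Gen.h i k)))
    (fun k hk => hN hk (hInvCoeff_mem_hSpace i k))
    (fun k => by
      have := quotientMap_eq_zero.2
        (TwoSidedIdeal.mem_sup_left (J := hIdeal ι N) (hI k (n - s * M)))
      rw [map_sub, sub_eq_zero, map_mul, map_sum] at this
      simpa only [← smul_mul_assoc, map_mul] using this)
  rw [← hM, map_smul, sub_add_cancel] at key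
  have h2 := (smul_eq_zero_iff_right (coeff_gSeries_ne_zero hQ hQ2 (2 * N))).1 key
  rw [quotientMap_eq_zero] at h2
  have := J.mul_mem_left (cpow (-(s * M))) _ h2
  rwa [← mul_assoc, cpow_mul_cpow, neg_add_cancel, cpow_zero, one_mul] at this

lemma commute_hInvCoeff {R : Type*} [Ring R] [Algebra ℂ R] (π : Borel ι →ₐ[ℂ] R) (i : ι) {b : R}
    (hb : ∀ k, Commute b (π (H i k))) (k : ℕ) : Commute b (π (hInvCoeff i k)) := by
  have h0 : Commute b (π (Hinv i)) := by
    let v : Rˣ := ⟨π (H i 0), π (Hinv i), by rw [← map_mul, H_mul_Hinv, map_one],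
      by rw [← map_mul, Hinv_mul_H, map_one]⟩
    exact Commute.units_inv_right (u := v) (hb 0)
  induction k using Nat.strong_induction_on with
  | _ k ih =>
    rcases k with _ | k
    · rw [hInvCoeff]; exact h0
    · rw [hInvCoeff, map_neg, map_mul, map_sum]
      refine (h0.mul_right (Commute.sum_right _ _ _ fun r _ => ?_)).neg_right
      rw [map_mul]
      exact (hb _).mul_right (ih _ (by omega))

/-- The condition on the antipode, for an ideal that is generated by the relations of the Cartan
currents and by elements of `xIdeal`, and whose closure contains `xIdeal`. -/
lemma antipode_of_generators {s : Set (Borel ι)} (S : Borel ι →ₐ[ℂ] (PowerSeries (Borel ι))ᵐᵒᵖ)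
    (hc : cartanSet ι ⊆ s) (hs : ∀ a ∈ s, a ∈ cartanSet ι ∨ a ∈ xIdeal ι)
    (hX : ∀ i n N, X i n ∈ TwoSidedIdeal.span s ⊔ hIdeal ι N)
    (SX : ∀ i n k, PowerSeries.coeff k (S (X i n)).unop ∈ xIdeal ι)
    (SH : ∀ i k, (S (H i k)).unop = PowerSeries.monomial k (hInvCoeff i k)) :
    ∀ a ∈ TwoSidedIdeal.span s, ∀ N : ℕ, ∃ b ∈ TwoSidedIdeal.span s,
      (∑ k ∈ Finset.range (N + 1), PowerSeries.coeff k (S a).unop) - b ∈ hIdeal ι N := by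
  set I := TwoSidedIdeal.span s with hI
  intro a ha N
  set J := I ⊔ hIdeal ι N with hJ
  let K : TwoSidedIdeal (Borel ι) := TwoSidedIdeal.mk'
    {a | ∀ k, PowerSeries.coeff k (S a).unop ∈ J}
    (fun k => by rw [map_zero, MulOpposite.unop_zero, map_zero]; exact zero_mem J)
    (fun {x y} hx hy k => by
      rw [map_add, MulOpposite.unop_add, map_add]; exact add_mem (hx k) (hy k))
    (fun {x} hx k => by rw [map_neg, MulOpposite.unop_neg, map_neg]; exact neg_mem (hx k))
    (fun {x y} hy k => by
      rw [map_mul, MulOpposite.unop_mul, PowerSeries.coeff_mul]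
      exact sum_mem fun p _ => J.mul_mem_right _ _ (hy _))
    (fun {x y} hx k => by
      rw [map_mul, MulOpposite.unop_mul, PowerSeries.coeff_mul]
      exact sum_mem fun p _ => J.mul_mem_left _ _ (hx _))
  have hK : ∀ a, a ∈ K ↔ ∀ k, PowerSeries.coeff k (S a).unop ∈ J := fun a =>
    TwoSidedIdeal.mem_mk' _ _ _ _ _ _ _
  have hxJ : xIdeal ι ≤ J := TwoSidedIdeal.span_le.2 <| by
    rintro _ ⟨i, n, rfl⟩
    exact hX i n N
  have hxK : xIdeal ι ≤ K := TwoSidedIdeal.span_le.2 <| by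
    rintro _ ⟨i, n, rfl⟩
    exact (hK _).2 fun k => hxJ (SX i n k)
  have hIK : I ≤ K := TwoSidedIdeal.span_le.2 fun a ha => by
    rcases hs a ha with ⟨i, k, j, l, rfl⟩ | ha
    · refine (hK _).2 fun n => TwoSidedIdeal.mem_sup_left ?_
      have hcomm : ∀ i k j l, Commute (quotientMap I (H i k)) (quotientMap I (H j l)) := by
        intro i k j l
        have := quotientMap_eq_zero.2 (TwoSidedIdeal.subset_span (hc ⟨i, k, j, l, rfl⟩) : _ ∈ I)
        rw [map_sub, map_mul, map_mul, sub_eq_zero] at this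
        exact this
      have h1 : Commute (quotientMap I (hInvCoeff i k)) (quotientMap I (hInvCoeff j l)) :=
        commute_hInvCoeff _ _ (fun l => (commute_hInvCoeff _ _ (fun k => hcomm j l i k) k).symm) l
      rw [map_sub, map_mul, map_mul, MulOpposite.unop_sub, MulOpposite.unop_mul,
        MulOpposite.unop_mul, SH, SH, PowerSeries.monomial_mul_monomial,
        PowerSeries.monomial_mul_monomial,
        add_comm l,
        ← map_sub, PowerSeries.coeff_monomial]
      split_ifs
      · rw [← quotientMap_eq_zero, map_sub, map_mul, map_mul, h1.eq, sub_self]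
      · exact zero_mem I
    · exact hxK ha
  have hsum : ∑ k ∈ Finset.range (N + 1), PowerSeries.coeff k (S a).unop ∈ J :=
    sum_mem fun k _ => (hK a).1 (hIK ha) k
  obtain ⟨b, hb, z, hz, hbz⟩ := TwoSidedIdeal.mem_sup.1 hsum
  exact ⟨b, hb, by rw [← hbz, add_sub_cancel_left]; exact hz⟩

theorem isWeakHopfIdeal_plus [Fintype ι] (hA : IsSimpleCartan A d) (hq0 : q ≠ 0)
    (hq : ∀ n : ℕ, 0 < n → q ^ n ≠ 1) :
    IsWeakHopfIdeal (deltaPlus ι) (antipodePlus ι) (idealPlus A d q) := by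
  have hs : ∀ a ∈ cartanSet ι ∪ actionPlusSet A d q ∪ exchangePlusSet A d q ∪ serreSet A d q,
      a ∈ cartanSet ι ∨ a ∈ xIdeal ι := by
    rintro a (((ha | ha) | ⟨i, j, n, m, rfl⟩) | ha)
    · exact Or.inl ha
    · exact Or.inr (actionPlus_mem_xIdeal ha)
    · exact Or.inr (exchange_mem_xIdeal _ _ _ _ _)
    · exact Or.inr (serre_mem_xIdeal ha)
  refine ⟨counit_eq_zero_of_generators hs, coideal_plus hA hq0 hq,
    antipode_of_generators _ (fun a ha => Or.inl (Or.inl (Or.inl ha))) hs ?_ ?_ ?_⟩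
  · intro i n N
    refine X_mem_closure (qij_ne_zero A d hq0 i i) ?_ i (-1) (fun n m => ?_) n N
    · rw [qij, hA.diag, ← zpow_natCast, ← zpow_mul]
      have := hq (d i * 4) (Nat.mul_pos (hA.d_pos i) (by norm_num))
      rw [← zpow_natCast] at this
      convert this using 2
      push_cast
      ring
    · refine TwoSidedIdeal.subset_span (Or.inl (Or.inl (Or.inr ⟨i, n, i, m, ?_⟩)))
      simp only [neg_one_mul, ← sub_eq_add_neg]
  · intro i n k
    have : antipodePlus ι (X i n) = antipodePlusGen (Gen.x i n) := lift_gen _ _ _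
    rw [this, antipodePlusGen, MulOpposite.unop_op, map_neg, PowerSeries.coeff_mk]
    exact neg_mem ((xIdeal ι).mul_mem_right _ _ ((xIdeal ι).mul_mem_left _ _ (X_mem_xIdeal _ _)))
  · intro i k
    have : antipodePlus ι (H i k) = antipodePlusGen (Gen.h i k) := lift_gen _ _ _
    rw [this, antipodePlusGen, MulOpposite.unop_op]

theorem isWeakHopfIdeal_minus [Fintype ι] (hA : IsSimpleCartan A d) (hq0 : q ≠ 0)
    (hq : ∀ n : ℕ, 0 < n → q ^ n ≠ 1) :
    IsWeakHopfIdeal (deltaMinus ι) (antipodeMinus ι) (idealMinus A d q) := by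
  have hs : ∀ a ∈ cartanSet ι ∪ actionMinusSet A d q ∪ exchangeMinusSet A d q ∪ serreSet A d q,
      a ∈ cartanSet ι ∨ a ∈ xIdeal ι := by
    rintro a (((ha | ha) | ⟨i, j, n, m, rfl⟩) | ha)
    · exact Or.inl ha
    · exact Or.inr (actionMinus_mem_xIdeal ha)
    · exact Or.inr (exchange_mem_xIdeal _ _ _ _ _)
    · exact Or.inr (serre_mem_xIdeal ha)
  refine ⟨counit_eq_zero_of_generators hs, coideal_minus hA hq0 hq,
    antipode_of_generators _ (fun a ha => Or.inl (Or.inl (Or.inl ha))) hs ?_ ?_ ?_⟩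
  · intro i n N
    refine X_mem_closure (qij_ne_zero A d hq0 i i) ?_ i 1 (fun n m => ?_) n N
    · rw [qij, hA.diag, ← zpow_natCast, ← zpow_mul]
      have := hq (d i * 4) (Nat.mul_pos (hA.d_pos i) (by norm_num))
      rw [← zpow_natCast] at this
      convert this using 2
      push_cast
      ring
    · refine TwoSidedIdeal.subset_span (Or.inl (Or.inl (Or.inr ⟨i, n, i, m, ?_⟩)))
      simp only [one_mul]
  · intro i n k
    have : antipodeMinus ι (X i n) = antipodeMinusGen (Gen.x i n) := lift_gen _ _ _
    rw [this, antipodeMinusGen, MulOpposite.unop_op, map_neg, PowerSeries.coeff_mk]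
    exact neg_mem ((xIdeal ι).mul_mem_right _ _ ((xIdeal ι).mul_mem_right _ _ (X_mem_xIdeal _ _)))
  · intro i k
    have : antipodeMinus ι (H i k) = antipodeMinusGen (Gen.h i k) := lift_gen _ _ _
    rw [this, antipodeMinusGen, MulOpposite.unop_op]

end Antipode

/-! ### Skew derivations and the operators dual to left multiplication -/

section Operators
variable {ι : Type u}

/-- The generators that carry an index of the Dynkin diagram, with `true` for currents and `false`
for the inverses of their constant terms. -/
def Gen.kind : Gen ι → Option (ι × Bool)
  | Gen.x i _ => some (i, true)
  | Gen.h i _ => some (i, true)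
  | Gen.hinv i => some (i, false)
  | _ => none

/-- The modes `k` of the structure function of the exchange of two generators. -/
def structCoeff (A : Matrix ι ι ℤ) (d : ι → ℕ) (q : ℂ) (g g' : Gen ι) (k : ℕ) : ℂ :=
  match g.kind, g'.kind with
  | some (i, true), some (j, true) => PowerSeries.coeff k (gSeries (qij A d q i j))
  | some (i, false), some (j, false) => PowerSeries.coeff 0 (gSeries (qij A d q i j))
  | some (i, _), some (j, _) => (PowerSeries.coeff 0 (gSeries (qij A d q i j)))⁻¹
  | _, _ => 1

/-- The generators with their mode moved by `k`, in the direction of the current on the left. -/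
def Gen.raise : Gen ι → ℕ → Borel ι
  | Gen.x i n, k => X i (n + k)
  | Gen.h i l, k => Hz i (l - k)
  | g, k => if k = 0 then gen g else 0

/-- The generators with their mode moved by `k`, in the direction of the current on the right. -/
def Gen.lower : Gen ι → ℕ → Borel ι
  | Gen.x i n, k => X i (n - k)
  | Gen.h i l, k => Hz i (l - k)
  | g, k => if k = 0 then gen g else 0

lemma theta_raise (g : Gen ι) (k : ℕ) : theta ι (g.raise k) = g.flip.lower k := by
  cases g with
  | x i n => rw [Gen.raise, theta_X, neg_add]; rfl
  | h i l => exact theta_Hz i _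
  | hinv i => simp only [Gen.raise, apply_ite (theta ι), map_zero]; rw [theta_gen]; rfl
  | c => simp only [Gen.raise, apply_ite (theta ι), map_zero]; rw [theta_gen]; rfl
  | cinv => simp only [Gen.raise, apply_ite (theta ι), map_zero]; rw [theta_gen]; rfl

lemma flip_kind (g : Gen ι) : g.flip.kind = g.kind := by cases g <;> rfl

variable (A : Matrix ι ι ℤ) (d : ι → ℕ) (q κ : ℂ)

lemma structCoeff_flip (hs : ∀ i j, qij A d q i j = qij A d q j i) (g g' : Gen ι) (k : ℕ) :
    structCoeff A d q g'.flip g.flip k = structCoeff A d q g g' k := by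
  simp only [structCoeff, flip_kind]
  rcases g.kind with _ | ⟨i, _ | _⟩ <;> rcases g'.kind with _ | ⟨j, _ | _⟩ <;>
    dsimp only <;> rw [hs]

/-- The image of a generator under the algebra morphism dual to multiplication by the Cartan current
`ψ_j`; the formal variable records the mode of the current. -/
def cartanShiftGen (j : ι) (g : Gen ι) : HahnSeries ℤ (Borel ι) :=
  HahnSeries.ofPowerSeries ℤ (Borel ι) (PowerSeries.mk fun k =>
    structCoeff A d q g (Gen.h j 0) k • g.raise k)

/-- The pairing of two root currents. -/
def rootPairing [DecidableEq ι] : Gen ι → Gen ι → ℂ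
  | Gen.x i n, Gen.x j m => if i = j ∧ n = -m then κ else 0
  | _, _ => 0

/-- The image of a generator under the skew derivation dual to multiplication by `x_j(z)`. -/
def derivGen [DecidableEq ι] (j : ι) : Gen ι → HahnSeries ℤ (Borel ι)
  | Gen.x i n => HahnSeries.single (-n) (if i = j then algebraMap ℂ (Borel ι) κ else 0)
  | _ => 0

lemma cartanShiftGen_coeff (j : ι) (g : Gen ι) (k : ℕ) :
    (cartanShiftGen A d q j g).coeff k = structCoeff A d q g (Gen.h j 0) k • g.raise k := by
  rw [cartanShiftGen, HahnSeries.ofPowerSeries_apply_coeff, PowerSeries.coeff_mk]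

lemma cartanShiftGen_coeff_of_neg (j : ι) (g : Gen ι) :
    ∀ N < 0, (cartanShiftGen A d q j g).coeff N = 0 := by
  intro N hN
  rw [cartanShiftGen, ofPowerSeries_mk_coeff, if_neg (not_le.2 hN)]

lemma cartanShiftGen_eq_single (j : ι) {g : Gen ι} (hg : ∀ k, k ≠ 0 → g.raise k = 0)
    (hg0 : g.raise 0 = gen g) : cartanShiftGen A d q j g =
      HahnSeries.single 0 (structCoeff A d q g (Gen.h j 0) 0 • gen g) := by
  ext N
  rcases lt_or_ge N 0 with hN | hN
  · rw [cartanShiftGen_coeff_of_neg _ _ _ _ _ N hN, HahnSeries.coeff_single_of_ne hN.ne]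
  · lift N to ℕ using hN
    rw [cartanShiftGen_coeff]
    rcases eq_or_ne N 0 with rfl | hN
    · rw [hg0]
      exact (HahnSeries.coeff_single_same 0 _).symm
    · rw [hg N hN, smul_zero, HahnSeries.coeff_single_of_ne (by exact_mod_cast hN)]

lemma cartanShiftGen_h_zero (j i : ι) : cartanShiftGen A d q j (Gen.h i 0) = HahnSeries.single 0
    (PowerSeries.coeff 0 (gSeries (qij A d q i j)) • H i 0) := by
  rw [cartanShiftGen_eq_single]
  · rfl
  · intro k hk
    exact Hz_of_neg i (by push_cast; omega)
  · simp only [Gen.raise]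
    exact Hz_natCast i 0

lemma cartanShiftGen_hinv (j i : ι) : cartanShiftGen A d q j (Gen.hinv i) = HahnSeries.single 0
    ((PowerSeries.coeff 0 (gSeries (qij A d q i j)))⁻¹ • Hinv i) := by
  rw [cartanShiftGen_eq_single]
  · rfl
  · intro k hk
    exact if_neg hk
  · rfl

lemma cartanShiftGen_c (j : ι) :
    cartanShiftGen A d q j Gen.c = HahnSeries.single 0 (gen Gen.c) := by
  rw [cartanShiftGen_eq_single]
  · simp [structCoeff, Gen.kind]
  · intro k hk
    exact if_neg hk
  · rfl

lemma cartanShiftGen_cinv (j : ι) :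
    cartanShiftGen A d q j Gen.cinv = HahnSeries.single 0 (gen Gen.cinv) := by
  rw [cartanShiftGen_eq_single]
  · simp [structCoeff, Gen.kind]
  · intro k hk
    exact if_neg hk
  · rfl

variable [DecidableEq ι]

/-- The skew derivation as a representation by triangular matrices. -/
def skewGen (j : ι) (g : Gen ι) : Matrix (Fin 2) (Fin 2) (HahnSeries ℤ (Borel ι)) :=
  !![cartanShiftGen A d q j g, derivGen κ j g; 0, HahnSeries.single 0 (gen g)]

variable {A d q}

omit [DecidableEq ι] in
lemma coeff_zero_gSeries_ne_zero (hq0 : q ≠ 0) (i j : ι) :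
    PowerSeries.coeff 0 (gSeries (qij A d q i j)) ≠ 0 :=
  right_ne_zero_of_mul (a := qij A d q i j)
    (by rw [coeff_zero_gSeries (qij_ne_zero A d hq0 i j)]; exact one_ne_zero)

/-- The free algebra has so few relations that it acts by skew derivations with arbitrary values on
the currents. -/
lemma skewGen_admissible (hq0 : q ≠ 0) (j : ι) : Admissible (skewGen A d q κ j) := by
  have hone : (!![1, 0; 0, 1] : Matrix (Fin 2) (Fin 2) (HahnSeries ℤ (Borel ι))) = 1 :=
    Matrix.one_fin_two.symm
  have h0 := fun i => coeff_zero_gSeries_ne_zero (A := A) (d := d) hq0 i j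
  constructor
  · rw [← hone]
    simp only [skewGen, derivGen, cartanShiftGen_c, cartanShiftGen_cinv, Matrix.mul_fin_two,
      HahnSeries.single_mul_single, c_mul_cinv, mul_zero, zero_mul, add_zero, zero_add]
    rfl
  · rw [← hone]
    simp only [skewGen, derivGen, cartanShiftGen_c, cartanShiftGen_cinv, Matrix.mul_fin_two,
      HahnSeries.single_mul_single, cinv_mul_c, mul_zero, zero_mul, add_zero, zero_add]
    rfl
  · intro g
    have hc : ∀ x : HahnSeries ℤ (Borel ι),
        HahnSeries.single 0 (gen Gen.c) * x = x * HahnSeries.single 0 (gen Gen.c) := by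
      intro x
      ext N
      rw [HahnSeries.coeff_single_zero_mul, HahnSeries.coeff_mul_single_zero, c_comm]
    rw [skewGen, cartanShiftGen_c, skewGen, derivGen, Matrix.mul_fin_two, Matrix.mul_fin_two]
    simp only [mul_zero, zero_mul, add_zero, zero_add, hc]
    all_goals simp
  · intro i
    rw [← hone]
    simp only [skewGen, derivGen, cartanShiftGen_h_zero, cartanShiftGen_hinv, Matrix.mul_fin_two,
      HahnSeries.single_mul_single, mul_zero, zero_mul, add_zero, zero_add, smul_mul_smul_comm,
      mul_inv_cancel₀ (h0 i), one_smul]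
    erw [H_mul_Hinv]
    rfl
  · intro i
    rw [← hone]
    simp only [skewGen, derivGen, cartanShiftGen_h_zero, cartanShiftGen_hinv, Matrix.mul_fin_two,
      HahnSeries.single_mul_single, mul_zero, zero_mul, add_zero, zero_add, smul_mul_smul_comm,
      inv_mul_cancel₀ (h0 i), one_smul]
    erw [Hinv_mul_H]
    rfl
  · intro i i'
    simp only [skewGen, derivGen, cartanShiftGen_h_zero, Matrix.mul_fin_two,
      HahnSeries.single_mul_single, mul_zero, zero_mul, add_zero, zero_add, smul_mul_smul_comm]
    have := H_comm i i'
    simp only [H] at this ⊢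
    rw [this, mul_comm (PowerSeries.coeff 0 _)]

/-- The representation by triangular matrices whose diagonal entries are the morphism dual to the
Cartan current `ψ_j` and the identity, and whose off-diagonal entry is the skew derivation dual to
the root current `x_j`. -/
def skewRep (hq0 : q ≠ 0) (j : ι) :
    Borel ι →ₐ[ℂ] Matrix (Fin 2) (Fin 2) (HahnSeries ℤ (Borel ι)) :=
  lift _ (skewGen_admissible (A := A) (d := d) κ hq0 j)

variable (A d)

/-- The dual of multiplication by the mode `k` of the Cartan current `ψ_j`. -/
def cartanShift (hq0 : q ≠ 0) (j : ι) (k : ℤ) : Module.End ℂ (Borel ι) where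
  toFun a := (skewRep (A := A) (d := d) κ hq0 j a 0 0).coeff k
  map_add' a b := by rw [map_add]; rfl
  map_smul' r a := by
    rw [map_smul, RingHom.id_apply]
    exact HahnSeries.coeff_smul

/-- The dual of multiplication by the mode `m` of the root current `x_j`. -/
def skewDeriv (hq0 : q ≠ 0) (j : ι) (m : ℤ) : Module.End ℂ (Borel ι) where
  toFun a := (skewRep (A := A) (d := d) κ hq0 j a 0 1).coeff m
  map_add' a b := by rw [map_add]; rfl
  map_smul' r a := by
    rw [map_smul, RingHom.id_apply]
    exact HahnSeries.coeff_smul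

variable (q)

omit [DecidableEq ι] in
lemma scaleGen_admissible (hq0 : q ≠ 0) (j : ι) :
    Admissible fun g : Gen ι => structCoeff A d q g (Gen.hinv j) 0 • (gen g : Borel ι) := by
  have h0 := fun i => coeff_zero_gSeries_ne_zero (A := A) (d := d) hq0 i j
  constructor
  · simp [structCoeff, Gen.kind, c_mul_cinv]
  · simp [structCoeff, Gen.kind, cinv_mul_c]
  · intro g
    simp [structCoeff, Gen.kind, c_comm]
  · intro i
    have := H_mul_Hinv i
    simp only [H, Hinv] at this
    simp [structCoeff, Gen.kind, smul_smul, this]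
    rw [mul_inv_cancel₀ (by simpa using h0 i), one_smul]
  · intro i
    have := Hinv_mul_H i
    simp only [H, Hinv] at this
    simp [structCoeff, Gen.kind, smul_smul, this]
    rw [inv_mul_cancel₀ (by simpa using h0 i), one_smul]
  · intro i i'
    have := H_comm i i'
    simp only [H] at this
    simp [structCoeff, Gen.kind, smul_smul, this, mul_comm]

/-- The dual of multiplication by the inverse of the constant term of `ψ_j`. -/
def cartanScale (hq0 : q ≠ 0) (j : ι) : Borel ι →ₐ[ℂ] Borel ι :=
  lift _ (scaleGen_admissible A d q hq0 j)

variable {q}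

lemma skewRep_gen (hq0 : q ≠ 0) (j : ι) (g : Gen ι) :
    skewRep (A := A) (d := d) κ hq0 j (gen g) = skewGen A d q κ j g := lift_gen _ _ g

lemma skewRep_lower_left (hq0 : q ≠ 0) (j : ι) (a : Borel ι) :
    skewRep (A := A) (d := d) κ hq0 j a 1 0 = 0 ∧
      skewRep (A := A) (d := d) κ hq0 j a 1 1 = HahnSeries.single 0 a := by
  induction a using Borel.induction with
  | one => rw [map_one]; exact ⟨rfl, rfl⟩
  | smul r a ha =>
    rw [map_smul, Matrix.smul_apply, Matrix.smul_apply, ha.1, ha.2, smul_zero]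
    refine ⟨rfl, ?_⟩
    ext N
    simp only [HahnSeries.coeff_smul, HahnSeries.coeff_single]
    split_ifs <;> simp
  | add a b ha hb =>
    rw [map_add, Matrix.add_apply, Matrix.add_apply, ha.1, ha.2, hb.1, hb.2, add_zero]
    refine ⟨rfl, ?_⟩
    ext N
    simp only [HahnSeries.coeff_add, HahnSeries.coeff_single]
    split_ifs <;> simp
  | mul g a ha =>
    rw [map_mul, skewRep_gen, Matrix.mul_apply, Matrix.mul_apply, Fin.sum_univ_two,
      Fin.sum_univ_two, ha.1, ha.2]
    simp [skewGen]

lemma skewRep_mul_diag (hq0 : q ≠ 0) (j : ι) (a b : Borel ι) :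
    skewRep (A := A) (d := d) κ hq0 j (a * b) 0 0 =
      skewRep (A := A) (d := d) κ hq0 j a 0 0 * skewRep (A := A) (d := d) κ hq0 j b 0 0 := by
  rw [map_mul, Matrix.mul_apply, Fin.sum_univ_two, (skewRep_lower_left A d κ hq0 j b).1, mul_zero,
    add_zero]

lemma skewRep_mul_off (hq0 : q ≠ 0) (j : ι) (a b : Borel ι) :
    skewRep (A := A) (d := d) κ hq0 j (a * b) 0 1 =
      skewRep (A := A) (d := d) κ hq0 j a 0 0 * skewRep (A := A) (d := d) κ hq0 j b 0 1 +
      skewRep (A := A) (d := d) κ hq0 j a 0 1 * HahnSeries.single 0 b := by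
  rw [map_mul, Matrix.mul_apply, Fin.sum_univ_two, (skewRep_lower_left A d κ hq0 j b).2]

lemma cartanShift_of_neg (hq0 : q ≠ 0) (j : ι) {k : ℤ} (hk : k < 0) :
    cartanShift A d κ hq0 j k = 0 := by
  ext a
  change (skewRep (A := A) (d := d) κ hq0 j a 0 0).coeff k = 0
  revert k
  induction a using Borel.induction with
  | one =>
    intro k hk
    rw [map_one]
    exact HahnSeries.coeff_single_of_ne hk.ne
  | smul r a ha =>
    intro k hk
    rw [map_smul, Matrix.smul_apply, HahnSeries.coeff_smul, ha hk, smul_zero]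
  | add a b ha hb =>
    intro k hk
    rw [map_add, Matrix.add_apply, HahnSeries.coeff_add, ha hk, hb hk, add_zero]
  | mul g a ha =>
    intro k hk
    rw [skewRep_mul_diag, skewRep_gen]
    refine coeff_mul_eq_zero (a := 0) (b := 0) ?_ (fun N hN => ha hN) (by simpa using hk)
    exact cartanShiftGen_coeff_of_neg A d q j g

end Operators

lemma coeff_ofPowerSeries_mul {R : Type*} [Ring R] (f : ℕ → R) (y : HahnSeries ℤ R) (m : ℤ) (n : ℕ)
    (hy : ∀ N ≤ m - n, y.coeff N = 0) :
    (HahnSeries.ofPowerSeries ℤ R (PowerSeries.mk f) * y).coeff m =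
      ∑ p ∈ Finset.range n, f p * y.coeff (m - p) := by
  have hf : ∀ N < 0, (HahnSeries.ofPowerSeries ℤ R (PowerSeries.mk f)).coeff N = 0 := by
    intro N hN
    rw [ofPowerSeries_mk_coeff, if_neg (not_le.2 hN)]
  rw [coeff_mul_eq_sum_Icc (b := m - n + 1) hf (fun N hN => hy N (by omega))]
  symm
  refine Finset.sum_nbij' (fun p => (p : ℤ)) (fun p => p.toNat) ?_ ?_ ?_ ?_ ?_
  · intro p hp
    rw [Finset.mem_range] at hp
    rw [Finset.mem_Icc]
    omega
  · intro p hp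
    rw [Finset.mem_Icc] at hp
    rw [Finset.mem_range]
    omega
  · intro p _
    simp
  · intro p hp
    rw [Finset.mem_Icc] at hp
    exact Int.toNat_of_nonneg hp.1
  · intro p _
    rw [HahnSeries.ofPowerSeries_apply_coeff, PowerSeries.coeff_mk]

lemma exists_coeff_bound {R : Type*} [Ring R] (y : HahnSeries ℤ R) :
    ∃ b : ℤ, ∀ N < b, y.coeff N = 0 :=
  ⟨y.order, fun _ hN => HahnSeries.coeff_eq_zero_of_lt_order hN⟩

section Dual
variable {ι : Type u} [DecidableEq ι] (A : Matrix ι ι ℤ) (d : ι → ℕ) {q : ℂ} (κ : ℂ) (hq0 : q ≠ 0)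

lemma cartanShift_gen_mul (j : ι) (k : ℤ) (g : Gen ι) (a : Borel ι) (n : ℕ) (hn : k < n) :
    cartanShift A d κ hq0 j k (gen g * a) = ∑ p ∈ Finset.range n,
      structCoeff A d q g (Gen.h j 0) p • (g.raise p * cartanShift A d κ hq0 j (k - p) a) := by
  change (skewRep (A := A) (d := d) κ hq0 j (gen g * a) 0 0).coeff k = _
  rw [skewRep_mul_diag, skewRep_gen]
  refine (coeff_ofPowerSeries_mul _ _ k n fun N hN => ?_).trans ?_
  · exact LinearMap.congr_fun (cartanShift_of_neg A d κ hq0 j (by omega : N < 0)) a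
  · exact Finset.sum_congr rfl fun p _ => smul_mul_assoc _ _ _

lemma skewDeriv_gen_mul (j : ι) (m : ℤ) (g : Gen ι) (a : Borel ι) :
    ∃ n₀ : ℕ, ∀ n ≥ n₀, skewDeriv A d κ hq0 j m (gen g * a) =
      rootPairing κ g (Gen.x j m) • a + ∑ p ∈ Finset.range n,
        structCoeff A d q g (Gen.h j 0) p • (g.raise p * skewDeriv A d κ hq0 j (m - p) a) := by
  obtain ⟨b, hb⟩ := exists_coeff_bound (skewRep (A := A) (d := d) κ hq0 j a 0 1)
  refine ⟨(m - b + 1).toNat, fun n hn => ?_⟩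
  change (skewRep (A := A) (d := d) κ hq0 j (gen g * a) 0 1).coeff m = _
  rw [skewRep_mul_off, skewRep_gen, HahnSeries.coeff_add, add_comm]
  refine congrArg₂ _ ?_ ?_
  · rw [HahnSeries.coeff_mul_single_zero]
    change (derivGen κ j g).coeff m * a = _
    cases g with
    | x i n =>
      rw [derivGen, rootPairing, HahnSeries.coeff_single]
      by_cases h : m = -n
      · rw [if_pos h]
        by_cases hij : i = j
        · rw [if_pos hij, if_pos ⟨hij, by omega⟩, Algebra.smul_def]
        · rw [if_neg hij, if_neg fun h => hij h.1, zero_mul, zero_smul]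
      · rw [if_neg h, if_neg fun h' => h (by omega), zero_mul, zero_smul]
    | _ => simp [derivGen, rootPairing]
  · refine (coeff_ofPowerSeries_mul _ _ m n fun N hN => hb N (by omega)).trans ?_
    exact Finset.sum_congr rfl fun p _ => smul_mul_assoc _ _ _

omit [DecidableEq ι] in
lemma cartanScale_gen_mul (j : ι) (g : Gen ι) (a : Borel ι) : cartanScale A d q hq0 j (gen g * a) =
    structCoeff A d q g (Gen.hinv j) 0 • (gen g * cartanScale A d q hq0 j a) := by
  rw [map_mul, cartanScale, lift_gen, smul_mul_assoc]

omit [DecidableEq ι] in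
lemma raise_zero (g : Gen ι) : g.raise 0 = gen g := by
  cases g with
  | x i n => simp only [Gen.raise, Nat.cast_zero, add_zero]; rfl
  | h i l => simp only [Gen.raise, Nat.cast_zero, sub_zero]; exact Hz_natCast i l
  | _ => rfl

lemma cartanShift_zero_gen_mul (j : ι) (g : Gen ι) (a : Borel ι) :
    cartanShift A d κ hq0 j 0 (gen g * a) =
      structCoeff A d q g (Gen.h j 0) 0 • (gen g * cartanShift A d κ hq0 j 0 a) := by
  rw [cartanShift_gen_mul A d κ hq0 j 0 g a 1 (by norm_num), Finset.sum_range_one, raise_zero]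
  simp

include hq0 in
omit [DecidableEq ι] in
lemma structCoeff_mul_inv (j : ι) (g : Gen ι) :
    structCoeff A d q g (Gen.h j 0) 0 * structCoeff A d q g (Gen.hinv j) 0 = 1 := by
  have h0 := fun i => coeff_zero_gSeries_ne_zero (A := A) (d := d) hq0 i j
  rcases hk : g.kind with _ | ⟨i, _ | _⟩
  · simp only [structCoeff, hk, one_mul]
  · simp only [structCoeff, hk]
    exact inv_mul_cancel₀ (h0 i)
  · simp only [structCoeff, hk]
    exact mul_inv_cancel₀ (h0 i)

lemma cartanShift_one (j : ι) (k : ℤ) :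
    cartanShift A d κ hq0 j k 1 = if k = 0 then 1 else 0 := by
  change (skewRep (A := A) (d := d) κ hq0 j (1 : Borel ι) 0 0).coeff k = _
  rw [map_one, Matrix.one_apply_eq, HahnSeries.coeff_one]
  split_ifs <;> rfl

lemma skewDeriv_one (j : ι) (k : ℤ) : skewDeriv A d κ hq0 j k 1 = 0 := by
  change (skewRep (A := A) (d := d) κ hq0 j (1 : Borel ι) 0 1).coeff k = _
  rw [map_one]
  rfl

/-- The operator on the positive algebra that is dual to left multiplication by a generator of the
negative algebra. -/
def dualGen : Gen ι → Module.End ℂ (Borel ι)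
  | Gen.x j m => skewDeriv A d κ hq0 j m
  | Gen.h j k => cartanShift A d κ hq0 j k
  | Gen.hinv j => (cartanScale A d q hq0 j).toLinearMap
  | _ => 1

lemma dualGen_admissible : Admissible fun g => MulOpposite.op (dualGen A d κ hq0 g) where
  c_cinv := rfl
  cinv_c := rfl
  c_comm g := (one_mul _).trans (mul_one _).symm
  h_hinv j := by
    rw [← MulOpposite.op_mul]
    refine congrArg MulOpposite.op (LinearMap.ext fun a => ?_)
    change cartanScale A d q hq0 j (cartanShift A d κ hq0 j 0 a) = a
    induction a using Borel.induction with
    | one => rw [cartanShift_one, if_pos rfl, map_one]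
    | smul r a ha => rw [map_smul, map_smul, ha]
    | add a b ha hb => rw [map_add, map_add, ha, hb]
    | mul g a ha =>
      rw [cartanShift_zero_gen_mul, map_smul, cartanScale_gen_mul, ha, smul_smul,
        structCoeff_mul_inv A d hq0, one_smul]
  hinv_h j := by
    rw [← MulOpposite.op_mul]
    refine congrArg MulOpposite.op (LinearMap.ext fun a => ?_)
    change cartanShift A d κ hq0 j 0 (cartanScale A d q hq0 j a) = a
    induction a using Borel.induction with
    | one => rw [map_one, cartanShift_one, if_pos rfl]
    | smul r a ha => rw [map_smul, map_smul, ha]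
    | add a b ha hb => rw [map_add, map_add, ha, hb]
    | mul g a ha =>
      rw [cartanScale_gen_mul, map_smul, cartanShift_zero_gen_mul, ha, smul_smul, mul_comm,
        structCoeff_mul_inv A d hq0, one_smul]
  h_comm i j := by
    rw [← MulOpposite.op_mul, ← MulOpposite.op_mul]
    refine congrArg MulOpposite.op (LinearMap.ext fun a => ?_)
    change cartanShift A d κ hq0 j 0 (cartanShift A d κ hq0 i 0 a) =
      cartanShift A d κ hq0 i 0 (cartanShift A d κ hq0 j 0 a)
    induction a using Borel.induction with
    | one =>
      rw [cartanShift_one, if_pos rfl, cartanShift_one, if_pos rfl, cartanShift_one, if_pos rfl]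
    | smul r a ha => rw [map_smul, map_smul, map_smul, map_smul, ha]
    | add a b ha hb => rw [map_add, map_add, map_add, map_add, ha, hb]
    | mul g a ha =>
      rw [cartanShift_zero_gen_mul, map_smul, cartanShift_zero_gen_mul, cartanShift_zero_gen_mul,
        map_smul, cartanShift_zero_gen_mul, ha, smul_smul, smul_smul, mul_comm]

/-- The action of the negative algebra on the positive one that is dual to left multiplication. It
reverses products. -/
def dualHom : Borel ι →ₐ[ℂ] (Module.End ℂ (Borel ι))ᵐᵒᵖ := lift _ (dualGen_admissible A d κ hq0)

/-- The operator dual to left multiplication by `b`. -/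
def dual (b : Borel ι) : Module.End ℂ (Borel ι) := (dualHom A d κ hq0 b).unop

lemma dual_gen (g : Gen ι) : dual A d κ hq0 (gen g) = dualGen A d κ hq0 g := by
  rw [dual, dualHom, lift_gen, MulOpposite.unop_op]

lemma dual_one (a : Borel ι) : dual A d κ hq0 1 a = a := by
  rw [dual, map_one]
  rfl

lemma dual_zero : dual A d κ hq0 0 = 0 := by
  rw [dual, map_zero]
  rfl

lemma dual_mul (b b' a : Borel ι) :
    dual A d κ hq0 (b * b') a = dual A d κ hq0 b' (dual A d κ hq0 b a) := by
  rw [dual, map_mul]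
  rfl

lemma dual_X (j : ι) (m : ℤ) : dual A d κ hq0 (X j m) = skewDeriv A d κ hq0 j m :=
  dual_gen A d κ hq0 _

lemma dual_Hz (j : ι) (k : ℤ) : dual A d κ hq0 (Hz j k) = cartanShift A d κ hq0 j k := by
  rcases lt_or_ge k 0 with h | h
  · rw [Hz_of_neg _ h, dual_zero, cartanShift_of_neg _ _ _ _ _ h]
  · lift k to ℕ using h
    rw [Hz_natCast]
    exact dual_gen A d κ hq0 _

lemma dual_cpow (s : ℤ) : dual A d κ hq0 (cpow s) = 1 := by
  have := map_cpow_eq (dualHom A d κ hq0) (fun _ => 1) rfl (fun m => by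
    rw [dualHom, lift_gen]
    rfl) s
  rw [dual, this]
  rfl

lemma dual_gen_one (g : Gen ι) : dual A d κ hq0 (gen g) 1 = counit ι (gen g) • 1 := by
  rw [dual_gen, counit_gen]
  cases g with
  | x j m =>
    rw [counitGen, zero_smul]
    exact skewDeriv_one A d κ hq0 j m
  | h j k =>
    rw [counitGen, ite_smul, one_smul, zero_smul]
    refine (cartanShift_one A d κ hq0 j k).trans ?_
    norm_cast
  | hinv j =>
    rw [counitGen, one_smul]
    exact map_one (cartanScale A d q hq0 j)
  | c => exact (one_smul _ _).symm
  | cinv => exact (one_smul _ _).symm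

/-- The action of a generator of the negative algebra on a product that begins with a generator of
the positive algebra. -/
lemma dual_gen_gen_mul (g g' : Gen ι) (a : Borel ι) : ∃ n₀ : ℕ, ∀ n ≥ n₀,
    dual A d κ hq0 (gen g') (gen g * a) = rootPairing κ g g' • a + ∑ p ∈ Finset.range n,
      structCoeff A d q g g' p • (g.raise p * dual A d κ hq0 (g'.lower p) a) := by
  -- only the term without shift contributes for the generators that are not currents
  have hsingle : ∀ g' : Gen ι, (∀ g, rootPairing κ g g' = 0) → (∀ p, p ≠ 0 → g'.lower p = 0) →
      g'.lower 0 = gen g' → dual A d κ hq0 (gen g') (gen g * a) =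
        structCoeff A d q g g' 0 • (gen g * dual A d κ hq0 (gen g') a) → ∃ n₀ : ℕ, ∀ n ≥ n₀,
      dual A d κ hq0 (gen g') (gen g * a) = rootPairing κ g g' • a + ∑ p ∈ Finset.range n,
        structCoeff A d q g g' p • (g.raise p * dual A d κ hq0 (g'.lower p) a) := by
    intro g' hr hl hl0 h
    refine ⟨1, fun n hn => ?_⟩
    rw [hr, zero_smul, zero_add, Finset.sum_eq_single 0, hl0, raise_zero, h]
    · intro p _ hp
      rw [hl p hp, dual_zero, LinearMap.zero_apply, mul_zero, smul_zero]
    · intro h0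
      exact absurd (Finset.mem_range.2 (by omega)) h0
  have hr0 : ∀ g' : Gen ι, (∀ j m, g' ≠ Gen.x j m) → ∀ g, rootPairing κ g g' = 0 := by
    intro g' hg' g
    cases g <;> cases g' <;> first | rfl | exact absurd rfl (hg' _ _)
  cases g' with
  | x j m =>
    obtain ⟨n₀, h⟩ := skewDeriv_gen_mul A d κ hq0 j m g a
    refine ⟨n₀, fun n hn => ?_⟩
    rw [dual_gen]
    refine (h n hn).trans ?_
    simp only [Gen.lower, dual_X]
    rfl
  | h j k =>
    refine ⟨k + 1, fun n hn => ?_⟩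
    rw [hr0 (Gen.h j k) (by simp), zero_smul, zero_add, dual_gen]
    refine (cartanShift_gen_mul A d κ hq0 j k g a n (by exact_mod_cast hn)).trans ?_
    simp only [Gen.lower, dual_Hz]
    rfl
  | hinv j =>
    refine hsingle _ (hr0 _ (by simp)) (fun p hp => if_neg hp) rfl ?_
    rw [dual_gen]
    exact cartanScale_gen_mul A d hq0 j g a
  | c =>
    refine hsingle _ (hr0 _ (by simp)) (fun p hp => if_neg hp) rfl ?_
    have : structCoeff A d q g Gen.c 0 = 1 := by
      unfold structCoeff
      rcases g.kind with _ | ⟨i, _ | _⟩ <;> rfl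
    rw [this, one_smul, dual_gen]
    rfl
  | cinv =>
    refine hsingle _ (hr0 _ (by simp)) (fun p hp => if_neg hp) rfl ?_
    have : structCoeff A d q g Gen.cinv 0 = 1 := by
      unfold structCoeff
      rcases g.kind with _ | ⟨i, _ | _⟩ <;> rfl
    rw [this, one_smul, dual_gen]
    rfl

/-! ### The pairing and its symmetry -/

/-- The weak Hopf pairing. The element `b` acts on the positive algebra by the operators dual to
left multiplication, and the counit evaluates the result. -/
def pairing : Borel ι →ₗ[ℂ] Borel ι →ₗ[ℂ] ℂ :=
  LinearMap.mk₂ ℂ (fun a b => counit ι (dual A d κ hq0 b a))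
    (fun a a' b => by rw [map_add, map_add])
    (fun r a b => by rw [map_smul, map_smul])
    (fun a b b' => by simp only [dual, map_add, MulOpposite.unop_add, LinearMap.add_apply])
    (fun r a b => by simp only [dual, map_smul, MulOpposite.unop_smul, LinearMap.smul_apply])

lemma pairing_apply (a b : Borel ι) : pairing A d κ hq0 a b = counit ι (dual A d κ hq0 b a) := rfl

lemma pairing_mul_right (a b b' : Borel ι) :
    pairing A d κ hq0 a (b * b') = pairing A d κ hq0 (dual A d κ hq0 b a) b' := by
  rw [pairing_apply, dual_mul, pairing_apply]

lemma pairing_one_right (a : Borel ι) : pairing A d κ hq0 a 1 = counit ι a := by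
  rw [pairing_apply, dual_one]

lemma pairing_one_left (b : Borel ι) : pairing A d κ hq0 1 b = counit ι b := by
  induction b using Borel.induction with
  | one => rw [pairing_one_right]
  | smul r a ha => rw [map_smul, map_smul, ha]
  | add a b ha hb => rw [map_add, map_add, ha, hb]
  | mul g b hb => rw [pairing_mul_right, dual_gen_one, map_smul, LinearMap.smul_apply, hb, map_mul,
      smul_eq_mul]

lemma raise_eq (g : Gen ι) (p : ℕ) :
    g.raise p = 0 ∨ ∃ g' : Gen ι, g'.weight = g.weight ∧ g.raise p = gen g' := by
  cases g with
  | x i n => exact Or.inr ⟨Gen.x i (n + p), rfl, rfl⟩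
  | h i l =>
    rcases lt_or_ge ((l : ℤ) - p) 0 with h | h
    · exact Or.inl (Hz_of_neg i h)
    · refine Or.inr ⟨Gen.h i ((l : ℤ) - p).toNat, rfl, ?_⟩
      simp only [Gen.raise, Hz, if_pos h]
      rfl
  | hinv i => by_cases hp : p = 0; exacts [Or.inr ⟨_, rfl, if_pos hp⟩, Or.inl (if_neg hp)]
  | c => by_cases hp : p = 0; exacts [Or.inr ⟨_, rfl, if_pos hp⟩, Or.inl (if_neg hp)]
  | cinv => by_cases hp : p = 0; exacts [Or.inr ⟨_, rfl, if_pos hp⟩, Or.inl (if_neg hp)]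

lemma rootPairing_flip (g g' : Gen ι) : rootPairing κ g'.flip g.flip = rootPairing κ g g' := by
  cases g <;> cases g' <;> simp only [Gen.flip, rootPairing]
  refine if_congr ⟨fun h => ⟨h.1.symm, ?_⟩, fun h => ⟨h.1.symm, ?_⟩⟩ rfl rfl <;>
    have := h.2 <;> omega

/-- The operators dual to left multiplication in the positive algebra are the conjugates under
`theta` of those for the negative algebra. -/
lemma pairing_gen_mul (hs : ∀ i j, qij A d q i j = qij A d q j i) (b : Borel ι) :
    ∀ (g : Gen ι) (a : Borel ι), pairing A d κ hq0 (gen g * a) b =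
      pairing A d κ hq0 a (theta ι (dual A d κ hq0 (theta ι (gen g)) (theta ι b))) := by
  induction b using Borel.induction with
  | one =>
    intro g a
    rw [map_one (theta ι), theta_gen, dual_gen_one, map_smul, map_one (theta ι), map_smul,
      pairing_one_right, pairing_one_right, map_mul, ← theta_gen, counit_theta, smul_eq_mul]
  | smul r b hb => intro g a; simp only [map_smul, hb]
  | add b b' hb hb' => intro g a; simp only [map_add, hb, hb']
  | mul g' b hb =>
    intro g a
    have hb' : ∀ (u a : Borel ι), (u = 0 ∨ ∃ g, u = gen g) → pairing A d κ hq0 (u * a) b =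
        pairing A d κ hq0 a (theta ι (dual A d κ hq0 (theta ι u) (theta ι b))) := by
      rintro _ a (rfl | ⟨g, rfl⟩)
      · rw [zero_mul, map_zero (pairing A d κ hq0), map_zero (theta ι), dual_zero,
          LinearMap.zero_apply, LinearMap.zero_apply, map_zero, map_zero]
      · exact hb g a
    obtain ⟨n₁, h₁⟩ := dual_gen_gen_mul A d κ hq0 g g' a
    obtain ⟨n₂, h₂⟩ := dual_gen_gen_mul A d κ hq0 g'.flip g.flip (theta ι b)
    rw [pairing_mul_right, h₁ (max n₁ n₂) (le_max_left _ _), map_mul, theta_gen, theta_gen,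
      h₂ (max n₁ n₂) (le_max_right _ _)]
    simp only [map_add, map_sum, map_smul, LinearMap.add_apply, LinearMap.sum_apply,
      LinearMap.smul_apply, theta_theta, rootPairing_flip, structCoeff_flip A d q hs, map_mul]
    refine congrArg _ (Finset.sum_congr rfl fun p _ => congrArg _ ?_)
    rw [hb' _ _ ((raise_eq g p).imp_right fun ⟨g', _, h⟩ => ⟨g', h⟩), ← pairing_mul_right,
      theta_raise, theta_raise, Gen.flip_flip]

/-- The pairing is symmetric under the exchange of the positive and the negative algebra. -/
theorem pairing_theta (hs : ∀ i j, qij A d q i j = qij A d q j i) (a : Borel ι) :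
    ∀ b, pairing A d κ hq0 a b = pairing A d κ hq0 (theta ι b) (theta ι a) := by
  induction a using Borel.induction with
  | one => intro b; rw [pairing_one_left, map_one, pairing_one_right, counit_theta]
  | smul r a ha => intro b; simp only [map_smul, LinearMap.smul_apply, ha]
  | add a a' ha ha' => intro b; simp only [map_add, LinearMap.add_apply, ha, ha']
  | mul g a ha =>
    intro b
    rw [pairing_gen_mul A d κ hq0 hs, ha, theta_theta, map_mul, pairing_mul_right]

end Dual

/-! ### The coproduct is dual to the product -/

section Summation

lemma finsum_coeff_mul {R : Type*} [Ring R] [Algebra ℂ R] (φ : R →ₗ[ℂ] ℂ) (x y : HahnSeries ℤ R)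
    (S : Finset ℤ) (hS : ∀ N ∉ S, ∀ t, φ (x.coeff N * t) = 0)
    (hfin : ∀ N ∈ S, (Function.support fun M => φ (x.coeff N * y.coeff M)).Finite) :
    (Function.support fun M => φ ((x * y).coeff M)).Finite ∧
      ∑ᶠ M, φ ((x * y).coeff M) = ∑ N ∈ S, ∑ᶠ M, φ (x.coeff N * y.coeff M) := by
  obtain ⟨a, ha⟩ := exists_coeff_bound x
  obtain ⟨b, hb⟩ := exists_coeff_bound y
  have h : ∀ M, φ ((x * y).coeff M) = ∑ N ∈ S, φ (x.coeff N * y.coeff (M - N)) := by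
    intro M
    rw [coeff_mul_eq_sum_Icc ha hb, map_sum, Finset.sum_subset
      (Finset.subset_union_left (s₂ := S)), ← Finset.sum_subset
      (Finset.subset_union_right (s₁ := Finset.Icc a (M - b)))]
    · exact fun N _ hN => hS N hN _
    · intro N _ hN
      rw [Finset.mem_Icc, not_and_or, not_le, not_le] at hN
      rcases hN with hN | hN
      · rw [ha N hN, zero_mul, map_zero]
      · rw [hb (M - N) (by omega), mul_zero, map_zero]
  have hfin' : ∀ N ∈ S, (Function.support fun M => φ (x.coeff N * y.coeff (M - N))).Finite := by
    intro N hN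
    exact (hfin N hN).preimage (f := fun M => M - N) (sub_left_injective.injOn)
  simp only [h]
  refine ⟨(Finset.finite_toSet S).biUnion hfin' |>.subset ?_, ?_⟩
  · intro M hM
    obtain ⟨N, hN, hne⟩ := Finset.exists_ne_zero_of_sum_ne_zero hM
    exact Set.mem_biUnion (Finset.mem_coe.2 hN) hne
  · rw [finsum_sum_comm _ _ hfin']
    refine Finset.sum_congr rfl fun N _ => ?_
    exact finsum_comp_equiv (Equiv.subRight N) (f := fun M => φ (x.coeff N * y.coeff M))

end Summation

section Axioms
variable {ι : Type u} [DecidableEq ι] (A : Matrix ι ι ℤ) (d : ι → ℕ) {q : ℂ} (κ : ℂ) (hq0 : q ≠ 0)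

omit [DecidableEq ι] in
lemma evalTensor_tmul (f g : Borel ι →ₗ[ℂ] ℂ) (u v : Borel ι) :
    evalTensor f g (u ⊗ₜ v) = f u * g v := rfl

/-- The action of a tensor on a product by the operators dual to its factors, the second factor
acting on the first element. -/
def dualTensor (a a' : Borel ι) : Borel ι ⊗[ℂ] Borel ι →ₗ[ℂ] Borel ι :=
  TensorProduct.lift (LinearMap.mk₂ ℂ (fun u v => dual A d κ hq0 v a * dual A d κ hq0 u a')
    (fun u u' v => by simp only [dual, map_add, MulOpposite.unop_add, LinearMap.add_apply, mul_add])
    (fun r u v => by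
      simp only [dual, map_smul, MulOpposite.unop_smul, LinearMap.smul_apply, mul_smul_comm])
    (fun u v v' => by simp only [dual, map_add, MulOpposite.unop_add, LinearMap.add_apply, add_mul])
    (fun r u v => by
      simp only [dual, map_smul, MulOpposite.unop_smul, LinearMap.smul_apply, smul_mul_assoc]))

lemma dualTensor_tmul (a a' u v : Borel ι) : dualTensor A d κ hq0 a a' (u ⊗ₜ v) =
    dual A d κ hq0 v a * dual A d κ hq0 u a' := rfl

lemma evalTensor_tmul_mul (a a' u v : Borel ι) (t : Borel ι ⊗[ℂ] Borel ι) :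
    evalTensor (pairing A d κ hq0 a') (pairing A d κ hq0 a) ((u ⊗ₜ v) * t) =
      evalTensor (pairing A d κ hq0 (dual A d κ hq0 u a'))
        (pairing A d κ hq0 (dual A d κ hq0 v a)) t := by
  induction t using TensorProduct.induction_on with
  | zero => simp only [mul_zero, map_zero]
  | add x y hx hy => simp only [mul_add, map_add, hx, hy]
  | tmul b b' =>
    rw [Algebra.TensorProduct.tmul_mul_tmul, evalTensor_tmul, evalTensor_tmul, pairing_mul_right,
      pairing_mul_right]

lemma dual_mul_cpow (b a : Borel ι) (s : ℤ) :
    dual A d κ hq0 (b * cpow s) a = dual A d κ hq0 b a := by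
  rw [dual_mul, dual_cpow]
  rfl

lemma dualTensor_deltaMinus_H (a a' : Borel ι) (j : ι) (k : ℕ) (N : ℤ) :
    dualTensor A d κ hq0 a a' ((deltaMinus ι (H j k)).coeff N) =
      cartanShift A d κ hq0 j (k + N) a * cartanShift A d κ hq0 j (-N) a' := by
  rw [deltaMinus_H_coeff, dualTensor_tmul, dual_mul_cpow, dual_mul_cpow, dual_Hz, dual_Hz]

lemma evalTensor_deltaMinus_H (a a' : Borel ι) (j : ι) (k : ℕ) (N : ℤ)
    (t : Borel ι ⊗[ℂ] Borel ι) :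
    evalTensor (pairing A d κ hq0 a') (pairing A d κ hq0 a) ((deltaMinus ι (H j k)).coeff N * t) =
      evalTensor (pairing A d κ hq0 (cartanShift A d κ hq0 j (-N) a'))
        (pairing A d κ hq0 (cartanShift A d κ hq0 j (k + N) a)) t := by
  rw [deltaMinus_H_coeff, evalTensor_tmul_mul, dual_mul_cpow, dual_mul_cpow, dual_Hz, dual_Hz]

omit [DecidableEq ι] in
lemma evalTensor_zero_left (f : Borel ι →ₗ[ℂ] ℂ) (t : Borel ι ⊗[ℂ] Borel ι) :
    evalTensor 0 f t = 0 := by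
  rw [evalTensor, TensorProduct.map_zero_left, LinearMap.comp_zero, LinearMap.zero_apply]

omit [DecidableEq ι] in
lemma evalTensor_zero_right (f : Borel ι →ₗ[ℂ] ℂ) (t : Borel ι ⊗[ℂ] Borel ι) :
    evalTensor f 0 t = 0 := by
  rw [evalTensor, TensorProduct.map_zero_right, LinearMap.comp_zero, LinearMap.zero_apply]

/-- The Leibniz rule: the operators dual to left multiplication by a generator act on products
through the coproduct. -/
lemma dual_gen_mul (g : Gen ι) (a a' : Borel ι) : ∃ S : Finset ℤ,
    (∀ N ∉ S, ∀ t, evalTensor (pairing A d κ hq0 a') (pairing A d κ hq0 a)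
      ((deltaMinus ι (gen g)).coeff N * t) = 0) ∧
    dual A d κ hq0 (gen g) (a * a') =
      ∑ N ∈ S, dualTensor A d κ hq0 a a' ((deltaMinus ι (gen g)).coeff N) := by
  have hneg : ∀ (j : ι) (a : Borel ι), ∀ N < 0,
      (skewRep (A := A) (d := d) κ hq0 j a 0 0).coeff N = 0 := fun j a N hN =>
    LinearMap.congr_fun (cartanShift_of_neg A d κ hq0 j hN) a
  have hsingle : ∀ (g : Gen ι) (u : Borel ι),
      deltaMinus ι (gen g) = HahnSeries.single 0 (u ⊗ₜ[ℂ] u) →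
      dual A d κ hq0 (gen g) (a * a') = dual A d κ hq0 u a * dual A d κ hq0 u a' →
      ∃ S : Finset ℤ,
      (∀ N ∉ S, ∀ t, evalTensor (pairing A d κ hq0 a') (pairing A d κ hq0 a)
        ((deltaMinus ι (gen g)).coeff N * t) = 0) ∧
      dual A d κ hq0 (gen g) (a * a') =
        ∑ N ∈ S, dualTensor A d κ hq0 a a' ((deltaMinus ι (gen g)).coeff N) := by
    intro g u hg hu
    refine ⟨{0}, fun N hN t => ?_, ?_⟩
    · rw [hg, HahnSeries.coeff_single_of_ne (by simpa using hN), zero_mul, map_zero]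
    · rw [Finset.sum_singleton, hg, HahnSeries.coeff_single_same, dualTensor_tmul, hu]
  cases g with
  | x j m =>
    change ∃ S : Finset ℤ, (∀ N ∉ S, ∀ t, evalTensor (pairing A d κ hq0 a') (pairing A d κ hq0 a)
        ((deltaMinus ι (X j m)).coeff N * t) = 0) ∧ dual A d κ hq0 (X j m) (a * a') =
        ∑ N ∈ S, dualTensor A d κ hq0 a a' ((deltaMinus ι (X j m)).coeff N)
    obtain ⟨b, hb⟩ := exists_coeff_bound (skewRep (A := A) (d := d) κ hq0 j a' 0 1)
    have hb' : ∀ N < b, skewDeriv A d κ hq0 j N a' = 0 := hb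
    refine ⟨Finset.Icc (min (-m) 0) (max (-b) 0), fun N hN t => ?_, ?_⟩
    · rw [Finset.mem_Icc] at hN
      rw [deltaMinus_X_coeff, if_neg (by omega), zero_add, evalTensor_tmul_mul, dual_mul_cpow,
        dual_Hz, dual_X]
      rcases le_or_gt (-b + 1) N with h | h
      · rw [hb' _ (by omega), map_zero, evalTensor_zero_left]
      · rw [cartanShift_of_neg A d κ hq0 j (by omega), LinearMap.zero_apply, map_zero,
          evalTensor_zero_right]
    · have h0 : (0 : ℤ) ∈ Finset.Icc (min (-m) 0) (max (-b) 0) := by rw [Finset.mem_Icc]; omega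
      simp only [deltaMinus_X_coeff, map_add, apply_ite (dualTensor A d κ hq0 a a'), map_zero,
        dualTensor_tmul, Finset.sum_add_distrib, dual_mul_cpow, dual_Hz, dual_X, dual_one]
      rw [Finset.sum_ite_eq_of_mem' _ _ _ h0]
      change (skewRep (A := A) (d := d) κ hq0 j (a * a') 0 1).coeff m = _
      rw [skewRep_mul_off, HahnSeries.coeff_add, HahnSeries.coeff_mul_single_zero, add_comm,
        coeff_mul_eq_sum_Icc (a := min 0 m) (b := -max (-b) 0)
          (fun N hN => hneg j a N (by omega)) (fun N hN => hb N (by omega))]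
      refine congrArg₂ _ rfl (Finset.sum_nbij' (fun p => p - m) (fun p => p + m) ?_ ?_ ?_ ?_ ?_)
      · intro p hp
        rw [Finset.mem_Icc] at hp ⊢
        omega
      · intro p hp
        rw [Finset.mem_Icc] at hp ⊢
        omega
      · intro p _
        omega
      · intro p _
        omega
      · intro p _
        rw [sub_add_cancel, neg_sub]
        rfl
  | h j k =>
    change ∃ S : Finset ℤ, (∀ N ∉ S, ∀ t, evalTensor (pairing A d κ hq0 a') (pairing A d κ hq0 a)
        ((deltaMinus ι (H j k)).coeff N * t) = 0) ∧ dual A d κ hq0 (H j k) (a * a') =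
        ∑ N ∈ S, dualTensor A d κ hq0 a a' ((deltaMinus ι (H j k)).coeff N)
    refine ⟨Finset.Icc (-k) 0, fun N hN t => ?_, ?_⟩
    · rw [Finset.mem_Icc] at hN
      rw [evalTensor_deltaMinus_H]
      rcases le_or_gt 1 N with h | h
      · rw [cartanShift_of_neg A d κ hq0 j (by omega : -N < 0), LinearMap.zero_apply, map_zero,
          evalTensor_zero_left]
      · rw [cartanShift_of_neg A d κ hq0 j (by omega : k + N < 0), LinearMap.zero_apply, map_zero,
          evalTensor_zero_right]
    · simp only [dualTensor_deltaMinus_H]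
      rw [← Hz_natCast, dual_Hz]
      change (skewRep (A := A) (d := d) κ hq0 j (a * a') 0 0).coeff k = _
      rw [skewRep_mul_diag, coeff_mul_eq_sum_Icc (hneg j a) (hneg j a')]
      refine Finset.sum_nbij' (fun p => p - k) (fun p => k + p) ?_ ?_ ?_ ?_ ?_
      · intro p hp
        rw [Finset.mem_Icc] at hp ⊢
        omega
      · intro p hp
        rw [Finset.mem_Icc] at hp ⊢
        omega
      · intro p _
        omega
      · intro p _
        omega
      · intro p _
        rw [add_sub_cancel, neg_sub]
        rfl
  | hinv j =>
    refine hsingle _ (gen (Gen.hinv j)) ?_ ?_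
    · rw [deltaMinus, lift_gen]; rfl
    · rw [dual_gen]
      exact map_mul (cartanScale A d q hq0 j) a a'
  | c =>
    refine hsingle _ (gen Gen.c) ?_ ?_
    · rw [deltaMinus, lift_gen]; rfl
    · rw [dual_gen]
      rfl
  | cinv =>
    refine hsingle _ (gen Gen.cinv) ?_ ?_
    · rw [deltaMinus, lift_gen]; rfl
    · rw [dual_gen]
      rfl

lemma finsum_evalTensor_mul {y : ℤ → Borel ι ⊗[ℂ] Borel ι} {b : Borel ι}
    (hy : ∀ a a' : Borel ι, (Function.support fun M =>
        evalTensor (pairing A d κ hq0 a') (pairing A d κ hq0 a) (y M)).Finite ∧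
      pairing A d κ hq0 (a * a') b =
        ∑ᶠ M, evalTensor (pairing A d κ hq0 a') (pairing A d κ hq0 a) (y M))
    (a a' : Borel ι) (x : Borel ι ⊗[ℂ] Borel ι) : (Function.support fun M =>
        evalTensor (pairing A d κ hq0 a') (pairing A d κ hq0 a) (x * y M)).Finite ∧
      pairing A d κ hq0 (dualTensor A d κ hq0 a a' x) b =
        ∑ᶠ M, evalTensor (pairing A d κ hq0 a') (pairing A d κ hq0 a) (x * y M) := by
  induction x using TensorProduct.induction_on with
  | zero => simp
  | tmul u v =>
    simp only [evalTensor_tmul_mul, dualTensor_tmul]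
    exact hy _ _
  | add x x' hx hx' =>
    simp only [add_mul, map_add, LinearMap.add_apply]
    refine ⟨(hx.1.union hx'.1).subset (Function.support_add _ _), ?_⟩
    rw [hx.2, hx'.2, finsum_add_distrib hx.1 hx'.1]

/-- The coproduct of the negative algebra is dual to the product of the positive one. -/
theorem pairing_mul_left (b : Borel ι) : ∀ a a' : Borel ι, (Function.support fun M =>
        evalTensor (pairing A d κ hq0 a') (pairing A d κ hq0 a) ((deltaMinus ι b).coeff M)).Finite ∧
      pairing A d κ hq0 (a * a') b =
        ∑ᶠ M, evalTensor (pairing A d κ hq0 a') (pairing A d κ hq0 a)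
          ((deltaMinus ι b).coeff M) := by
  induction b using Borel.induction with
  | one =>
    intro a a'
    have h : ∀ M : ℤ, M ≠ 0 → (deltaMinus ι 1).coeff M = 0 := by
      intro M hM
      rw [map_one]
      exact HahnSeries.coeff_single_of_ne hM
    refine ⟨(Set.finite_singleton (0 : ℤ)).subset fun M hM => ?_, ?_⟩
    · by_contra h0
      exact hM (by simp only [h M h0, map_zero])
    · rw [finsum_eq_single _ 0 fun M hM => by rw [h M hM, map_zero], map_one (deltaMinus ι),
        pairing_one_right, map_mul, mul_comm, HahnSeries.coeff_one, if_pos rfl,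
        Algebra.TensorProduct.one_def, evalTensor_tmul, pairing_one_right, pairing_one_right]
  | smul r b hb =>
    intro a a'
    simp only [map_smul, HahnSeries.coeff_smul]
    refine ⟨(hb a a').1.subset (fun M hM h => hM (by simp only [h, smul_zero])), ?_⟩
    rw [(hb a a').2, smul_finsum]
  | add b b' hb hb' =>
    intro a a'
    simp only [map_add, HahnSeries.coeff_add]
    refine ⟨((hb a a').1.union (hb' a a').1).subset (Function.support_add _ _), ?_⟩
    rw [(hb a a').2, (hb' a a').2, finsum_add_distrib (hb a a').1 (hb' a a').1]
  | mul g b hb =>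
    intro a a'
    obtain ⟨S, hS, hg⟩ := dual_gen_mul A d κ hq0 g a a'
    have hx := fun x => finsum_evalTensor_mul A d κ hq0 hb a a' x
    have h := finsum_coeff_mul (evalTensor (pairing A d κ hq0 a') (pairing A d κ hq0 a))
      (deltaMinus ι (gen g)) (deltaMinus ι b) S hS fun N _ => (hx _).1
    rw [map_mul]
    refine ⟨h.1, ?_⟩
    rw [h.2, pairing_mul_right, hg, map_sum, LinearMap.sum_apply]
    exact Finset.sum_congr rfl fun N _ => (hx _).2

lemma evalTensor_flip (hs : ∀ i j, qij A d q i j = qij A d q j i) (b b' : Borel ι)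
    (t : Borel ι ⊗[ℂ] Borel ι) :
    evalTensor ((pairing A d κ hq0).flip b) ((pairing A d κ hq0).flip b') t =
      evalTensor (pairing A d κ hq0 (theta ι b')) (pairing A d κ hq0 (theta ι b))
        (thetaSwap ι t) := by
  induction t using TensorProduct.induction_on with
  | zero => simp only [map_zero]
  | add x y hx hy => simp only [map_add, hx, hy]
  | tmul u v =>
    rw [thetaSwap_tmul, evalTensor_tmul, evalTensor_tmul, LinearMap.flip_apply,
      LinearMap.flip_apply, pairing_theta A d κ hq0 hs, pairing_theta A d κ hq0 hs v, mul_comm]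

/-- The coproduct of the positive algebra is dual to the product of the negative one. -/
theorem pairing_mul_right_eq_finsum (hs : ∀ i j, qij A d q i j = qij A d q j i) (a b b' : Borel ι) :
    (Function.support fun M => evalTensor ((pairing A d κ hq0).flip b)
      ((pairing A d κ hq0).flip b') ((deltaPlus ι a).coeff M)).Finite ∧
    pairing A d κ hq0 a (b * b') = ∑ᶠ M, evalTensor ((pairing A d κ hq0).flip b)
      ((pairing A d κ hq0).flip b') ((deltaPlus ι a).coeff M) := by
  have ha : a ∈ Submodule.span ℂ (Set.range (word (ι := ι))) := by
    rw [span_range_word]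
    trivial
  induction ha using Submodule.span_induction with
  | zero => simp
  | smul r a _ ha =>
    simp only [map_smul, HahnSeries.coeff_smul, LinearMap.smul_apply]
    refine ⟨ha.1.subset (fun M hM h => hM (by simp only [h, smul_zero])), ?_⟩
    rw [ha.2, smul_finsum]
  | add a a' _ _ ha ha' =>
    simp only [map_add, HahnSeries.coeff_add, LinearMap.add_apply]
    refine ⟨(ha.1.union ha'.1).subset (Function.support_add _ _), ?_⟩
    rw [ha.2, ha'.2, finsum_add_distrib ha.1 ha'.1]
  | mem a ha =>
    obtain ⟨w, rfl⟩ := ha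
    obtain ⟨hf, h⟩ := pairing_mul_left A d κ hq0 (theta ι (word w)) (theta ι b) (theta ι b')
    have hM : ∀ M, evalTensor ((pairing A d κ hq0).flip b) ((pairing A d κ hq0).flip b')
        ((deltaPlus ι (word w)).coeff M) = evalTensor (pairing A d κ hq0 (theta ι b'))
          (pairing A d κ hq0 (theta ι b))
          ((deltaMinus ι (theta ι (word w))).coeff (M + (w.map Gen.loop).sum)) := by
      intro M
      rw [evalTensor_flip A d κ hq0 hs, deltaMinus_theta_coeff (word_mem_loopSpace w),
        add_sub_cancel_right]
    simp only [hM]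
    refine ⟨hf.preimage (f := fun M => M + (w.map Gen.loop).sum) (add_left_injective _).injOn, ?_⟩
    rw [pairing_theta A d κ hq0 hs, map_mul, h]
    exact (finsum_comp_equiv (Equiv.addRight (w.map Gen.loop).sum)).symm

end Axioms

/-! ### The root grading and the values on generators -/

section Values
variable {ι : Type u} [DecidableEq ι]

lemma weight_flip (g : Gen ι) : g.flip.weight = g.weight := by cases g <;> rfl

lemma lower_eq (g : Gen ι) (p : ℕ) :
    g.lower p = 0 ∨ ∃ g' : Gen ι, g'.weight = g.weight ∧ g.lower p = gen g' := by
  rw [← Gen.flip_flip g, ← theta_raise]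
  refine (raise_eq g.flip p).imp (fun h => by rw [h, map_zero]) ?_
  rintro ⟨g', h, h'⟩
  exact ⟨g'.flip, by rw [weight_flip, weight_flip, h], by rw [h', theta_gen]⟩

/-- The span of the words whose weight is `α` after adding `δ`. This stands for the weight `α - δ`,
which need not be defined for weights with natural coordinates. -/
def shiftedWeightSpace (α δ : ι → ℕ) : Submodule ℂ (Borel ι) :=
  Submodule.span ℂ {a | ∃ w : List (Gen ι), (w.map Gen.weight).sum + δ = α ∧ a = word w}

lemma gen_mul_mem_shiftedWeightSpace {α δ : ι → ℕ} (g : Gen ι) {a : Borel ι}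
    (ha : a ∈ shiftedWeightSpace α δ) : gen g * a ∈ shiftedWeightSpace (g.weight + α) δ := by
  induction ha using Submodule.span_induction with
  | zero => rw [mul_zero]; exact Submodule.zero_mem _
  | add x y _ _ hx hy => rw [mul_add]; exact Submodule.add_mem _ hx hy
  | smul r x _ hx => rw [mul_smul_comm]; exact Submodule.smul_mem _ _ hx
  | mem x hx =>
    obtain ⟨w, rfl, rfl⟩ := hx
    refine Submodule.subset_span ⟨g :: w, ?_, (word_cons g w).symm⟩
    rw [List.map_cons, List.sum_cons, add_assoc]

lemma weight_eq_zero_of_counit {g : Gen ι} (h : counit ι (gen g) ≠ 0) : g.weight = 0 := by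
  cases g with
  | x i n => exact absurd (counit_X i n) h
  | _ => rfl

lemma weight_eq_of_rootPairing {κ : ℂ} {g g' : Gen ι} (h : rootPairing κ g g' ≠ 0) :
    g'.weight = g.weight := by
  cases g <;> cases g' <;> try exact absurd rfl h
  rename_i i n j m
  by_cases hij : i = j
  · rw [hij]
    rfl
  · exact absurd (if_neg fun h => hij h.1) h

variable (A : Matrix ι ι ℤ) (d : ι → ℕ) {q : ℂ} (κ : ℂ) (hq0 : q ≠ 0)

lemma dual_gen_word_mem (w : List (Gen ι)) : ∀ g' : Gen ι, dual A d κ hq0 (gen g') (word w) ∈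
    shiftedWeightSpace (w.map Gen.weight).sum g'.weight := by
  induction w with
  | nil =>
    intro g'
    rw [word_nil, dual_gen_one]
    by_cases h : counit ι (gen g') = 0
    · rw [h, zero_smul]
      exact Submodule.zero_mem _
    · refine Submodule.smul_mem _ _ (Submodule.subset_span ⟨[], ?_, rfl⟩)
      rw [weight_eq_zero_of_counit h, add_zero]
  | cons g w ih =>
    intro g'
    obtain ⟨n₀, h⟩ := dual_gen_gen_mul A d κ hq0 g g' (word w)
    rw [word_cons, h n₀ le_rfl, List.map_cons, List.sum_cons]
    refine Submodule.add_mem _ ?_ (Submodule.sum_mem _ fun p _ => Submodule.smul_mem _ _ ?_)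
    · by_cases h : rootPairing κ g g' = 0
      · rw [h, zero_smul]
        exact Submodule.zero_mem _
      · refine Submodule.smul_mem _ _ (Submodule.subset_span ⟨w, ?_, rfl⟩)
        rw [weight_eq_of_rootPairing h, add_comm]
    · rcases raise_eq g p with h | ⟨x, hx, h⟩
      · rw [h, zero_mul]
        exact Submodule.zero_mem _
      rcases lower_eq g' p with h' | ⟨x', hx', h'⟩
      · rw [h', dual_zero, LinearMap.zero_apply, mul_zero]
        exact Submodule.zero_mem _
      · rw [h, h', ← hx, ← hx']
        exact gen_mul_mem_shiftedWeightSpace x (ih x')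

lemma counit_word_eq_zero (w : List (Gen ι)) (hw : (w.map Gen.weight).sum ≠ 0) :
    counit ι (word w) = 0 := by
  induction w with
  | nil => exact absurd rfl hw
  | cons g w ih =>
    rw [word_cons, map_mul]
    by_cases h : counit ι (gen g) = 0
    · rw [h, zero_mul]
    · rw [List.map_cons, List.sum_cons, weight_eq_zero_of_counit h, zero_add] at hw
      rw [ih hw, mul_zero]

lemma pairing_word_word (w' : List (Gen ι)) : ∀ w : List (Gen ι),
    (w.map Gen.weight).sum ≠ (w'.map Gen.weight).sum →
      pairing A d κ hq0 (word w) (word w') = 0 := by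
  induction w' with
  | nil =>
    intro w hw
    rw [word_nil, pairing_one_right, counit_word_eq_zero w hw]
  | cons g' w' ih =>
    intro w hw
    rw [word_cons, pairing_mul_right]
    have h := dual_gen_word_mem A d κ hq0 w g'
    generalize dual A d κ hq0 (gen g') (word w) = a at h
    induction h using Submodule.span_induction with
    | zero => rw [map_zero, LinearMap.zero_apply]
    | add x y _ _ hx hy => rw [map_add, LinearMap.add_apply, hx, hy, add_zero]
    | smul r x _ hx => rw [map_smul, LinearMap.smul_apply, hx, smul_zero]
    | mem x hx =>
      obtain ⟨v, hv, rfl⟩ := hx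
      refine ih v fun h => hw ?_
      rw [← hv, h, List.map_cons, List.sum_cons, add_comm]

lemma pairing_graded {α β : ι → ℕ} (hαβ : α ≠ β) {a b : Borel ι} (ha : a ∈ weightSpace α)
    (hb : b ∈ weightSpace β) : pairing A d κ hq0 a b = 0 := by
  induction ha using Submodule.span_induction with
  | zero => rw [map_zero, LinearMap.zero_apply]
  | add x y _ _ hx hy => rw [map_add, LinearMap.add_apply, hx, hy, add_zero]
  | smul r x _ hx => rw [map_smul, LinearMap.smul_apply, hx, smul_zero]
  | mem x hx =>
    obtain ⟨w, rfl, rfl⟩ := hx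
    induction hb using Submodule.span_induction with
    | zero => rw [map_zero]
    | add x y _ _ hx hy => rw [map_add, hx, hy, add_zero]
    | smul r x _ hx => rw [map_smul, hx, smul_zero]
    | mem x hx =>
      obtain ⟨w', rfl, rfl⟩ := hx
      exact pairing_word_word A d κ hq0 w' w hαβ

lemma pairing_cpow_right (a : Borel ι) (s : ℤ) : pairing A d κ hq0 a (cpow s) = counit ι a := by
  rw [pairing_apply, dual_cpow]
  rfl

lemma pairing_cpow_left (hs : ∀ i j, qij A d q i j = qij A d q j i) (s : ℤ) (b : Borel ι) :
    pairing A d κ hq0 (cpow s) b = counit ι b := by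
  rw [pairing_theta A d κ hq0 hs, theta_cpow, pairing_cpow_right, counit_theta]

lemma pairing_gen_gen (g g' : Gen ι) : ∃ n₀ : ℕ, ∀ n ≥ n₀,
    pairing A d κ hq0 (gen g) (gen g') = rootPairing κ g g' + ∑ p ∈ Finset.range n,
      structCoeff A d q g g' p * (counit ι (g.raise p) * counit ι (g'.lower p)) := by
  obtain ⟨n₀, h⟩ := dual_gen_gen_mul A d κ hq0 g g' 1
  refine ⟨n₀, fun n hn => ?_⟩
  rw [pairing_apply, ← mul_one (gen g), h n hn, map_add, map_sum, map_smul, map_one, smul_eq_mul,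
    mul_one]
  refine congrArg _ (Finset.sum_congr rfl fun p _ => ?_)
  rw [map_smul, smul_eq_mul, map_mul, ← pairing_apply, pairing_one_left]

omit [DecidableEq ι] in
lemma counit_Hz (i : ι) (k : ℤ) : counit ι (Hz i k) = if k = 0 then 1 else 0 := by
  rcases lt_or_ge k 0 with h | h
  · rw [Hz_of_neg _ h, map_zero, if_neg h.ne]
  · lift k to ℕ using h
    rw [Hz_natCast, counit_H]
    norm_cast

lemma pairing_X_X (i : ι) (n : ℤ) (j : ι) (m : ℤ) :
    pairing A d κ hq0 (X i n) (X j m) = if i = j ∧ n = -m then κ else 0 := by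
  obtain ⟨n₀, h⟩ := pairing_gen_gen A d κ hq0 (Gen.x i n) (Gen.x j m)
  refine (h n₀ le_rfl).trans ?_
  simp only [Gen.raise, counit_X, zero_mul, mul_zero, Finset.sum_const_zero, add_zero]
  rfl

lemma pairing_X_H (i : ι) (n : ℤ) (j : ι) (k : ℕ) :
    pairing A d κ hq0 (X i n) (H j k) = 0 := by
  obtain ⟨n₀, h⟩ := pairing_gen_gen A d κ hq0 (Gen.x i n) (Gen.h j k)
  refine (h n₀ le_rfl).trans ?_
  simp only [Gen.raise, counit_X, zero_mul, mul_zero, Finset.sum_const_zero, add_zero]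
  rfl

lemma pairing_H_X (i : ι) (k : ℕ) (j : ι) (m : ℤ) :
    pairing A d κ hq0 (H i k) (X j m) = 0 := by
  obtain ⟨n₀, h⟩ := pairing_gen_gen A d κ hq0 (Gen.h i k) (Gen.x j m)
  refine (h n₀ le_rfl).trans ?_
  simp only [Gen.lower, counit_X, mul_zero, Finset.sum_const_zero, add_zero]
  rfl

lemma pairing_H_H (i : ι) (k : ℕ) (j : ι) (l : ℕ) : pairing A d κ hq0 (H i k) (H j l) =
    if k = l then PowerSeries.coeff k (gSeries (qij A d q i j)) else 0 := by
  obtain ⟨n₀, h⟩ := pairing_gen_gen A d κ hq0 (Gen.h i k) (Gen.h j l)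
  refine (h (max n₀ (k + 1)) (le_max_left _ _)).trans ?_
  rw [Finset.sum_eq_single k]
  · simp only [rootPairing, Gen.raise, Gen.lower, counit_Hz, sub_self, if_true, zero_add,
      sub_eq_zero, Nat.cast_inj, structCoeff, Gen.kind, eq_comm (a := l), mul_ite, mul_one,
      mul_zero]
  · intro p _ hp
    simp only [Gen.raise, counit_Hz, sub_eq_zero, Nat.cast_inj]
    rw [if_neg hp.symm, zero_mul, mul_zero]
  · intro h
    exact absurd (Finset.mem_range.2 (lt_of_lt_of_le (Nat.lt_succ_self k) (le_max_right _ _))) h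

lemma pairing_Hinv_H (i j : ι) : pairing A d κ hq0 (Hinv i) (H j 0) =
    (PowerSeries.coeff 0 (gSeries (qij A d q i j)))⁻¹ := by
  obtain ⟨n₀, h⟩ := pairing_gen_gen A d κ hq0 (Gen.hinv i) (Gen.h j 0)
  refine (h (n₀ + 1) (Nat.le_succ _)).trans ?_
  rw [Finset.sum_eq_single 0]
  · simp [rootPairing, Gen.raise, Gen.lower, counit_Hz, counit_gen, counitGen, structCoeff,
      Gen.kind]
  · intro p _ hp
    simp [Gen.raise, hp]
  · intro h
    exact absurd (Finset.mem_range.2 (Nat.succ_pos _)) h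

lemma pairing_H_Hinv (i j : ι) : pairing A d κ hq0 (H i 0) (Hinv j) =
    (PowerSeries.coeff 0 (gSeries (qij A d q i j)))⁻¹ := by
  obtain ⟨n₀, h⟩ := pairing_gen_gen A d κ hq0 (Gen.h i 0) (Gen.hinv j)
  refine (h (n₀ + 1) (Nat.le_succ _)).trans ?_
  rw [Finset.sum_eq_single 0]
  · simp [rootPairing, Gen.raise, Gen.lower, counit_Hz, counit_gen, counitGen, structCoeff,
      Gen.kind]
  · intro p _ hp
    simp [Gen.lower, hp]
  · intro h
    exact absurd (Finset.mem_range.2 (Nat.succ_pos _)) h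

omit [DecidableEq ι] in
lemma counit_Hinv (i : ι) : counit ι (Hinv i) = 1 := counit_gen _

/-- The existence of the weak Hopf pairing. -/
theorem isWeakHopfPairing_pairing (hs : ∀ i j, qij A d q i j = qij A d q j i) :
    IsWeakHopfPairing A d q κ (pairing A d κ hq0) where
  finite_right a b b' := (pairing_mul_right_eq_finsum A d κ hq0 hs a b b').1
  mul_right a b b' := (pairing_mul_right_eq_finsum A d κ hq0 hs a b b').2
  finite_left a a' b := (pairing_mul_left A d κ hq0 b a a').1
  mul_left a a' b := (pairing_mul_left A d κ hq0 b a a').2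
  one_right := pairing_one_right A d κ hq0
  one_left := pairing_one_left A d κ hq0
  graded _ _ h _ ha _ hb := pairing_graded A d κ hq0 h ha hb
  c_c s t _ _ := by rw [pairing_cpow_right, counit_cpow]
  c_h s _ i k := by rw [pairing_cpow_left A d κ hq0 hs, counit_H]
  h_c s _ i k := by rw [pairing_cpow_right, counit_H]
  c_hinv s _ i := by rw [pairing_cpow_left A d κ hq0 hs, counit_Hinv]
  hinv_c s _ i := by rw [pairing_cpow_right, counit_Hinv]
  c_x s _ i n := by rw [pairing_cpow_left A d κ hq0 hs, counit_X]
  x_c s _ i n := by rw [pairing_cpow_right, counit_X]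
  h_x := pairing_H_X A d κ hq0
  x_h := pairing_X_H A d κ hq0
  h_h := pairing_H_H A d κ hq0
  hinv_h := pairing_Hinv_H A d κ hq0
  h_hinv := pairing_H_Hinv A d κ hq0
  x_x := pairing_X_X A d κ hq0

end Values

/-! ### Uniqueness of the pairing -/

section Uniqueness
variable {ι : Type u}

/-- The contraction of the second tensor factor by the counit. -/
def counitRight (ι : Type u) : Borel ι ⊗[ℂ] Borel ι →ₐ[ℂ] Borel ι :=
  (Algebra.TensorProduct.rid ℂ ℂ (Borel ι)).toAlgHom.comp
    (Algebra.TensorProduct.map (AlgHom.id ℂ (Borel ι)) (counit ι))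

lemma counitRight_tmul (a b : Borel ι) : counitRight ι (a ⊗ₜ b) = counit ι b • a :=
  Algebra.TensorProduct.rid_tmul ..

lemma counitRight_deltaPlus_gen (g : Gen ι) :
    hahnMap (counitRight ι) (deltaPlus ι (gen g)) = HahnSeries.single (-g.loop) (gen g) := by
  have hsingle : ∀ (g : Gen ι) (u v : Borel ι), deltaPlus ι (gen g) = HahnSeries.single 0 (u ⊗ₜ v) →
      counit ι v • u = gen g → g.loop = 0 →
      hahnMap (counitRight ι) (deltaPlus ι (gen g)) = HahnSeries.single (-g.loop) (gen g) := by
    intro g u v h hv h0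
    rw [h, hahnMap_single, counitRight_tmul, hv, h0, neg_zero]
  cases g with
  | x i n =>
    ext N
    change counitRight ι ((deltaPlus ι (X i n)).coeff N) = _
    rw [deltaPlus_X_coeff, map_add, counitRight_tmul, counit_X, zero_smul, add_zero,
      HahnSeries.coeff_single, Gen.loop]
    by_cases h : N = -n
    · rw [if_pos h, if_pos h, counitRight_tmul, map_one, one_smul]
      rfl
    · rw [if_neg h, if_neg h, map_zero]
  | h i k =>
    ext N
    change counitRight ι ((deltaPlus ι (H i k)).coeff N) = _
    rw [deltaPlus_H_coeff, counitRight_tmul, map_mul, counit_cpow, mul_one, counit_Hz,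
      HahnSeries.coeff_single, Gen.loop, neg_neg]
    by_cases h : N = k
    · rw [if_pos h, if_pos (by omega), one_smul, h, sub_self, cpow_zero, mul_one, Hz_natCast]
      rfl
    · rw [if_neg h, if_neg (by omega), zero_smul]
  | hinv i =>
    refine hsingle _ (Hinv i) (Hinv i) ?_ ?_ rfl
    · rw [deltaPlus, lift_gen]
      rfl
    · rw [counit_Hinv, one_smul]
      rfl
  | c =>
    refine hsingle _ (gen Gen.c) (gen Gen.c) ?_ ?_ rfl
    · rw [deltaPlus, lift_gen]
      rfl
    · rw [counit_gen]
      exact one_smul _ _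
  | cinv =>
    refine hsingle _ (gen Gen.cinv) (gen Gen.cinv) ?_ ?_ rfl
    · rw [deltaPlus, lift_gen]
      rfl
    · rw [counit_gen]
      exact one_smul _ _

/-- The counit axiom, graded by the loop degree. -/
lemma counitRight_deltaPlus_word (w : List (Gen ι)) :
    hahnMap (counitRight ι) (deltaPlus ι (word w)) =
      HahnSeries.single (-(w.map Gen.loop).sum) (word w) := by
  induction w with
  | nil =>
    rw [word_nil, map_one (deltaPlus ι), map_one (hahnMap _)]
    rfl
  | cons g w ih =>
    rw [word_cons, map_mul, map_mul, ih, counitRight_deltaPlus_gen, HahnSeries.single_mul_single,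
      List.map_cons, List.sum_cons, neg_add]

variable [DecidableEq ι]

lemma X_mem_weightSpace (i : ι) (n : ℤ) : X i n ∈ weightSpace (Pi.single i 1 : ι → ℕ) :=
  Submodule.subset_span ⟨[Gen.x i n], by simp [Gen.weight], (word_singleton _).symm⟩

lemma Hinv_mem_weightSpace (i : ι) : Hinv i ∈ weightSpace (0 : ι → ℕ) :=
  Submodule.subset_span ⟨[Gen.hinv i], by simp [Gen.weight], (word_singleton _).symm⟩

namespace IsWeakHopfPairing
variable {A : Matrix ι ι ℤ} {d : ι → ℕ} {q κ : ℂ} {P P' : Borel ι →ₗ[ℂ] Borel ι →ₗ[ℂ] ℂ}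

lemma mul_left_single (hP : IsWeakHopfPairing A d q κ P) {b u v : Borel ι} {N : ℤ}
    (a a' : Borel ι) (hN : evalTensor (P a') (P a) ((deltaMinus ι b).coeff N) = P a' u * P a v)
    (h : ∀ M, M ≠ N → evalTensor (P a') (P a) ((deltaMinus ι b).coeff M) = 0) :
    P (a * a') b = P a' u * P a v := by
  rw [hP.mul_left, finsum_eq_single _ N h, hN]

lemma mul_left_of_grouplike (hP : IsWeakHopfPairing A d q κ P) {b : Borel ι}
    (hb : deltaMinus ι b = HahnSeries.single 0 (b ⊗ₜ b)) (a a' : Borel ι) :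
    P (a * a') b = P a' b * P a b := by
  refine hP.mul_left_single (N := 0) a a' ?_ ?_
  · rw [hb, HahnSeries.coeff_single_same, evalTensor_tmul]
  · intro M hM
    rw [hb, HahnSeries.coeff_single_of_ne hM, map_zero]

lemma gen_cpow (hP : IsWeakHopfPairing A d q κ P) {s : ℤ} (hs : s = 1 ∨ s = -1) (g : Gen ι) :
    P (gen g) (cpow s) = counit ι (gen g) := by
  rw [counit_gen]
  cases g with
  | x i n => exact hP.x_c s hs i n
  | h i k => exact hP.h_c s hs i k
  | hinv i => exact hP.hinv_c s hs i
  | c => rw [← cpow_one]; exact hP.c_c 1 s (Or.inl rfl) hs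
  | cinv => rw [← cpow_neg_one]; exact hP.c_c (-1) s (Or.inr rfl) hs

lemma cpow_gen (hP : IsWeakHopfPairing A d q κ P) {s : ℤ} (hs : s = 1 ∨ s = -1) (g : Gen ι) :
    P (cpow s) (gen g) = counit ι (gen g) := by
  rw [counit_gen]
  cases g with
  | x i n => exact hP.c_x s hs i n
  | h i k => exact hP.c_h s hs i k
  | hinv i => exact hP.c_hinv s hs i
  | c => rw [← cpow_one]; exact hP.c_c s 1 hs (Or.inl rfl)
  | cinv => rw [← cpow_neg_one]; exact hP.c_c s (-1) hs (Or.inr rfl)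

lemma apply_cpow (hP : IsWeakHopfPairing A d q κ P) {s : ℤ} (hs : s = 1 ∨ s = -1) (a : Borel ι) :
    P a (cpow s) = counit ι a := by
  induction a using Borel.induction with
  | one => rw [hP.one_left, counit_cpow, map_one]
  | smul r a ha => rw [map_smul, map_smul, LinearMap.smul_apply, ha]
  | add a b ha hb => rw [map_add, map_add, LinearMap.add_apply, ha, hb]
  | mul g a ha =>
    rw [hP.mul_left_of_grouplike (deltaMinus_cpow s), ha, hP.gen_cpow hs, map_mul, mul_comm]

lemma mul_cpow_of_unit (hP : IsWeakHopfPairing A d q κ P) {s : ℤ} (hs : s = 1 ∨ s = -1)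
    (a b : Borel ι) : P a (b * cpow s) = P a b := by
  suffices h : P.flip (b * cpow s) = P.flip b from LinearMap.congr_fun h a
  refine Borel.linearMap_ext fun w => ?_
  have h : ∀ t, evalTensor (P.flip b) (P.flip (cpow s)) t = P.flip b (counitRight ι t) := by
    intro t
    induction t using TensorProduct.induction_on with
    | zero => simp only [map_zero]
    | add x y hx hy => simp only [map_add, hx, hy]
    | tmul u v =>
      rw [evalTensor_tmul, counitRight_tmul, map_smul, smul_eq_mul, mul_comm]
      exact congrArg (· * _) (hP.apply_cpow hs v)
  rw [LinearMap.flip_apply, hP.mul_right]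
  simp only [h, ← hahnMap_coeff, counitRight_deltaPlus_word]
  rw [finsum_eq_single _ (-(w.map Gen.loop).sum), HahnSeries.coeff_single_same]
  intro N hN
  rw [HahnSeries.coeff_single_of_ne hN, map_zero]

/-- Powers of the central element of the negative algebra do not change the pairing. -/
lemma mul_cpow (hP : IsWeakHopfPairing A d q κ P) (a b : Borel ι) (s : ℤ) :
    P a (b * cpow s) = P a b := by
  induction s using Int.induction_on with
  | zero => rw [cpow_zero, mul_one]
  | succ i ih => rw [cpow_add, ← mul_assoc, hP.mul_cpow_of_unit (Or.inl rfl), ih]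
  | pred i ih => rw [sub_eq_add_neg, cpow_add, ← mul_assoc, hP.mul_cpow_of_unit (Or.inr rfl), ih]

lemma evalTensor_deltaMinus_H (hP : IsWeakHopfPairing A d q κ P) (a a' : Borel ι) (i : ι) (k : ℕ)
    (N : ℤ) : evalTensor (P a') (P a) ((deltaMinus ι (H i k)).coeff N) =
      P a' (Hz i (-N)) * P a (Hz i (k + N)) := by
  rw [deltaMinus_H_coeff, evalTensor_tmul, hP.mul_cpow, hP.mul_cpow]

lemma evalTensor_deltaMinus_X (hP : IsWeakHopfPairing A d q κ P) (a a' : Borel ι) (i : ι)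
    (n N : ℤ) : evalTensor (P a') (P a) ((deltaMinus ι (X i n)).coeff N) =
      (if N = 0 then counit ι a' * P a (X i n) else 0) +
        P a' (X i (-N)) * P a (Hz i (N + n)) := by
  rw [deltaMinus_X_coeff, map_add, evalTensor_tmul, hP.mul_cpow, apply_ite (evalTensor _ _),
    map_zero, evalTensor_tmul, hP.one_right]

lemma mul_H_zero (hP : IsWeakHopfPairing A d q κ P) (a a' : Borel ι) (i : ι) :
    P (a * a') (H i 0) = P a' (H i 0) * P a (H i 0) := by
  refine hP.mul_left_single (N := 0) a a' ?_ fun N hN => ?_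
  · rw [hP.evalTensor_deltaMinus_H, neg_zero, Nat.cast_zero, zero_add]
    rfl
  · rw [hP.evalTensor_deltaMinus_H]
    rcases lt_or_gt_of_ne hN with h | h
    · rw [Hz_of_neg i (k := (0 : ℕ) + N) (by simpa using h), map_zero, mul_zero]
    · rw [Hz_of_neg i (k := -N) (by omega), map_zero, zero_mul]

omit [DecidableEq ι] in
lemma deltaMinus_Hinv (i : ι) :
    deltaMinus ι (Hinv i) = HahnSeries.single 0 (Hinv i ⊗ₜ[ℂ] Hinv i) := lift_gen _ _ _

lemma mul_Hinv (hP : IsWeakHopfPairing A d q κ P) (a a' : Borel ι) (i : ι) :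
    P (a * a') (Hinv i) = P a' (Hinv i) * P a (Hinv i) :=
  hP.mul_left_of_grouplike (deltaMinus_Hinv i) a a'

omit [DecidableEq ι] in
/-- Powers of the central element of the positive algebra do not change the pairing with an element
on which the pairing is multiplicative. -/
lemma _root_.QAffine.apply_mul_cpow_of_character {b : Borel ι}
    (hb : ∀ a a', P (a * a') b = P a' b * P a b) (hc : P (gen Gen.c) b = 1)
    (hc' : P (gen Gen.cinv) b = 1) (s : ℤ) (a : Borel ι) :
    P (a * cpow s) b = P a b := by
  induction s using Int.induction_on with
  | zero => rw [cpow_zero, mul_one]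
  | succ i ih => rw [cpow_add, ← mul_assoc, hb, cpow_one, hc, one_mul, ih]
  | pred i ih => rw [sub_eq_add_neg, cpow_add, ← mul_assoc, hb, cpow_neg_one, hc', one_mul, ih]

lemma mul_cpow_Hinv (hP : IsWeakHopfPairing A d q κ P) (s : ℤ) (a : Borel ι) (i : ι) :
    P (a * cpow s) (Hinv i) = P a (Hinv i) := by
  refine apply_mul_cpow_of_character (fun a a' => hP.mul_Hinv a a' i) ?_ ?_ s a
  · rw [← cpow_one]
    exact hP.c_hinv 1 (Or.inl rfl) i
  · rw [← cpow_neg_one]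
    exact hP.c_hinv (-1) (Or.inr rfl) i

lemma mul_cpow_H_zero (hP : IsWeakHopfPairing A d q κ P) (s : ℤ) (a : Borel ι) (i : ι) :
    P (a * cpow s) (H i 0) = P a (H i 0) := by
  refine apply_mul_cpow_of_character (fun a a' => hP.mul_H_zero a a' i) ?_ ?_ s a
  · rw [← cpow_one]
    exact hP.c_h 1 (Or.inl rfl) i 0
  · rw [← cpow_neg_one]
    exact hP.c_h (-1) (Or.inr rfl) i 0

lemma Hz_H_zero (hP : IsWeakHopfPairing A d q κ P) (i j : ι) (k : ℤ) : P (Hz i k) (H j 0) =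
    if k = 0 then PowerSeries.coeff 0 (gSeries (qij A d q i j)) else 0 := by
  rcases lt_or_ge k 0 with h | h
  · rw [Hz_of_neg i h, map_zero, LinearMap.zero_apply, if_neg h.ne]
  · lift k to ℕ using h
    rw [Hz_natCast, hP.h_h]
    norm_cast
    split_ifs with h
    · rw [h]
    · rfl

lemma H_zero_Hz (hP : IsWeakHopfPairing A d q κ P) (i j : ι) (k : ℤ) : P (H i 0) (Hz j k) =
    if k = 0 then PowerSeries.coeff 0 (gSeries (qij A d q i j)) else 0 := by
  rcases lt_or_ge k 0 with h | h
  · rw [Hz_of_neg j h, map_zero, if_neg h.ne]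
  · lift k to ℕ using h
    rw [Hz_natCast, hP.h_h]
    norm_cast
    simp only [eq_comm (a := 0)]

lemma Hinv_Hinv (hP : IsWeakHopfPairing A d q κ P) (hq0 : q ≠ 0) (i j : ι) :
    P (Hinv i) (Hinv j) = PowerSeries.coeff 0 (gSeries (qij A d q i j)) := by
  have h0 := coeff_zero_gSeries_ne_zero (A := A) (d := d) hq0 i j
  have h := hP.mul_Hinv (H i 0) (Hinv i) j
  rw [H_mul_Hinv, hP.one_left, counit_Hinv, hP.h_hinv] at h
  rw [← mul_one (P (Hinv i) (Hinv j)), ← inv_mul_cancel₀ h0, ← mul_assoc, ← h, one_mul]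

lemma Hinv_H (hP : IsWeakHopfPairing A d q κ P) (hq0 : q ≠ 0) (i j : ι) {k : ℕ} (hk : k ≠ 0) :
    P (Hinv i) (H j k) = 0 := by
  have h0 := coeff_zero_gSeries_ne_zero (A := A) (d := d) hq0 i j
  have h : P (H i 0 * Hinv i) (H j k) =
      P (Hinv i) (H j k) * P (H i 0) (H j 0) := by
    refine hP.mul_left_single (N := -k) _ _ ?_ fun N hN => ?_
    · rw [hP.evalTensor_deltaMinus_H, neg_neg, Hz_natCast, add_neg_cancel]
      rfl
    · rw [hP.evalTensor_deltaMinus_H, hP.H_zero_Hz, if_neg (by omega), mul_zero]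
  rw [H_mul_Hinv, hP.one_left, counit_H, if_neg hk, hP.h_h, if_pos rfl] at h
  exact (mul_eq_zero.1 h.symm).resolve_right h0

lemma H_Hinv (hP : IsWeakHopfPairing A d q κ P) (hq0 : q ≠ 0) (i j : ι) {k : ℕ} (hk : k ≠ 0) :
    P (H i k) (Hinv j) = 0 := by
  have h0 := coeff_zero_gSeries_ne_zero (A := A) (d := d) hq0 i j
  have hN : ∀ N, evalTensor (P.flip (Hinv j)) (P.flip (H j 0)) ((deltaPlus ι (H i k)).coeff N) =
      P (Hz i N) (Hinv j) * if k - N = 0 then PowerSeries.coeff 0 (gSeries (qij A d q i j))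
        else 0 := by
    intro N
    rw [deltaPlus_H_coeff, evalTensor_tmul, LinearMap.flip_apply, LinearMap.flip_apply,
      hP.mul_cpow_Hinv, hP.mul_cpow_H_zero, hP.Hz_H_zero]
  have h := hP.mul_right (H i k) (Hinv j) (H j 0)
  rw [Hinv_mul_H, hP.one_right, counit_H, if_neg hk, finsum_eq_single _ (k : ℤ), hN, sub_self,
    if_pos rfl, Hz_natCast] at h
  · exact (mul_eq_zero.1 h.symm).resolve_right h0
  · intro N hN'
    rw [hN, if_neg (by omega), mul_zero]

lemma X_Hinv (hP : IsWeakHopfPairing A d q κ P) (i j : ι) (n : ℤ) : P (X i n) (Hinv j) = 0 :=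
  hP.graded (Pi.single i 1) 0 (by simp) _ (X_mem_weightSpace i n) _ (Hinv_mem_weightSpace j)

lemma Hinv_X (hP : IsWeakHopfPairing A d q κ P) (i j : ι) (n : ℤ) : P (Hinv i) (X j n) = 0 :=
  hP.graded 0 (Pi.single j 1) (by simp [eq_comm]) _ (Hinv_mem_weightSpace i) _
    (X_mem_weightSpace j n)

lemma gen_gen_eq (hP : IsWeakHopfPairing A d q κ P) (hP' : IsWeakHopfPairing A d q κ P')
    (hq0 : q ≠ 0) (g g' : Gen ι) : P (gen g) (gen g') = P' (gen g) (gen g') := by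
  have hc : ∀ {s : ℤ}, s = 1 ∨ s = -1 → P (cpow s) (gen g') = P' (cpow s) (gen g') := fun hs => by
    rw [hP.cpow_gen hs, hP'.cpow_gen hs]
  have hc' : ∀ {s : ℤ}, s = 1 ∨ s = -1 → P (gen g) (cpow s) = P' (gen g) (cpow s) := fun hs => by
    rw [hP.gen_cpow hs, hP'.gen_cpow hs]
  rcases g' with ⟨j, m⟩ | ⟨j, l⟩ | j | _ | _
  case c => rw [← cpow_one]; exact hc' (Or.inl rfl)
  case cinv => rw [← cpow_neg_one]; exact hc' (Or.inr rfl)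
  all_goals
    rcases g with ⟨i, n⟩ | ⟨i, k⟩ | i | _ | _
    case c => rw [← cpow_one]; exact hc (Or.inl rfl)
    case cinv => rw [← cpow_neg_one]; exact hc (Or.inr rfl)
  · exact (hP.x_x i n j m).trans (hP'.x_x i n j m).symm
  · exact (hP.h_x i k j m).trans (hP'.h_x i k j m).symm
  · exact (hP.Hinv_X i j m).trans (hP'.Hinv_X i j m).symm
  · exact (hP.x_h i n j l).trans (hP'.x_h i n j l).symm
  · exact (hP.h_h i k j l).trans (hP'.h_h i k j l).symm
  · rcases eq_or_ne l 0 with rfl | hl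
    · exact (hP.hinv_h i j).trans (hP'.hinv_h i j).symm
    · exact (hP.Hinv_H hq0 i j hl).trans (hP'.Hinv_H hq0 i j hl).symm
  · exact (hP.X_Hinv i j n).trans (hP'.X_Hinv i j n).symm
  · rcases eq_or_ne k 0 with rfl | hk
    · exact (hP.h_hinv i j).trans (hP'.h_hinv i j).symm
    · exact (hP.H_Hinv hq0 i j hk).trans (hP'.H_Hinv hq0 i j hk).symm
  · exact (hP.Hinv_Hinv hq0 i j).trans (hP'.Hinv_Hinv hq0 i j).symm

/-- The pairing with the generators of the negative algebra is determined by its values on pairs of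
generators: the coproduct of a generator contains only currents and powers of the central element,
and the latter do not change the pairing. -/
lemma apply_gen_eq (hP : IsWeakHopfPairing A d q κ P) (hP' : IsWeakHopfPairing A d q κ P')
    (hq0 : q ≠ 0) (a : Borel ι) : ∀ g, P a (gen g) = P' a (gen g) := by
  induction a using Borel.induction with
  | one => intro g; rw [hP.one_left, hP'.one_left]
  | smul r a ha => intro g; simp only [map_smul, LinearMap.smul_apply, ha]
  | add a b ha hb => intro g; simp only [map_add, LinearMap.add_apply, ha, hb]
  | mul x a ha =>
    have hx := hP.gen_gen_eq hP' hq0 x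
    have hHz : ∀ {a}, (∀ g, P a (gen g) = P' a (gen g)) → ∀ i k, P a (Hz i k) = P' a (Hz i k) := by
      intro a h i k
      rcases lt_or_ge k 0 with hk | hk
      · rw [Hz_of_neg i hk, map_zero, map_zero]
      · lift k to ℕ using hk
        rw [Hz_natCast]
        exact h _
    have hX : ∀ {a}, (∀ g, P a (gen g) = P' a (gen g)) → ∀ i n, P a (X i n) = P' a (X i n) :=
      fun h i n => h _
    intro g
    cases g with
    | x i n =>
      refine ((hP.mul_left _ _ (X i n)).trans (finsum_congr fun N => ?_)).trans
        (hP'.mul_left _ _ (X i n)).symm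
      rw [hP.evalTensor_deltaMinus_X, hP'.evalTensor_deltaMinus_X, hX hx, hX ha, hHz hx]
    | h i k =>
      refine ((hP.mul_left _ _ (H i k)).trans (finsum_congr fun N => ?_)).trans
        (hP'.mul_left _ _ (H i k)).symm
      rw [hP.evalTensor_deltaMinus_H, hP'.evalTensor_deltaMinus_H, hHz hx, hHz ha]
    | hinv i =>
      refine (hP.mul_Hinv _ _ i).trans (Eq.trans ?_ (hP'.mul_Hinv _ _ i).symm)
      exact congrArg₂ _ (ha _) (hx _)
    | c => rw [← cpow_one, hP.apply_cpow (Or.inl rfl), hP'.apply_cpow (Or.inl rfl)]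
    | cinv => rw [← cpow_neg_one, hP.apply_cpow (Or.inr rfl), hP'.apply_cpow (Or.inr rfl)]

/-- The uniqueness of the weak Hopf pairing. -/
theorem unique (hP : IsWeakHopfPairing A d q κ P) (hP' : IsWeakHopfPairing A d q κ P')
    (hq0 : q ≠ 0) : P = P' := by
  suffices h : ∀ b, P.flip b = P'.flip b from
    LinearMap.ext₂ fun a b => LinearMap.congr_fun (h b) a
  intro b
  induction b using Borel.induction with
  | one => ext a; exact (hP.one_right a).trans (hP'.one_right a).symm
  | smul r b hb => rw [map_smul, map_smul, hb]
  | add b b' hb hb' => rw [map_add, map_add, hb, hb']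
  | mul g b hb =>
    have hg : P.flip (gen g) = P'.flip (gen g) :=
      LinearMap.ext fun a => hP.apply_gen_eq hP' hq0 a g
    ext a
    rw [LinearMap.flip_apply, LinearMap.flip_apply, hP.mul_right, hP'.mul_right, hg, hb]

end IsWeakHopfPairing
end Uniqueness

/-! ### The relations lie in the kernel of the pairing -/

section Kernel
variable {ι : Type u} {A : Matrix ι ι ℤ} {d : ι → ℕ} {q : ℂ}

/-- A morphism under which products of two root currents vanish respects the exchange and the Serre
relations, so that only the relations with a Cartan current need to be checked. -/
lemma map_idealPlus_eq_zero [Fintype ι] (hA : IsSimpleCartan A d) {T : Type*} [Ring T] [Algebra ℂ T]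
    (f : Borel ι →ₐ[ℂ] T) (hXX : ∀ i n j m, f (X i n) * f (X j m) = 0)
    (hHH : ∀ i k j l, f (H i k) * f (H j l) = f (H j l) * f (H i k))
    (hHX : ∀ i k j m, f (H i k) * f (X j m) = ∑ p ∈ Finset.HasAntidiagonal.antidiagonal k,
      PowerSeries.coeff p.1 (gSeries (qij A d q i j)) •
        (f (cpow (-p.1)) * f (X j (m - p.1)) * f (H i p.2)))
    {a : Borel ι} (ha : a ∈ idealPlus A d q) : f a = 0 := by
  suffices h : idealPlus A d q ≤ TwoSidedIdeal.ker f from (TwoSidedIdeal.mem_ker _).1 (h ha)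
  refine TwoSidedIdeal.span_le.2 fun a ha => (TwoSidedIdeal.mem_ker _).2 ?_
  rcases ha with ((⟨i, k, j, l, rfl⟩ | ⟨i, n, j, m, rfl⟩) | ⟨i, j, n, m, rfl⟩) |
    ⟨i, j, hij, n, l, rfl⟩
  · rw [map_sub, map_mul, map_mul, hHH, sub_self]
  · simp only [map_sub, map_mul, map_sum, map_smul, hHX, sub_self]
  · simp only [exchange, map_sub, map_mul, map_smul, hXX, smul_zero, sub_zero]
  · rw [serre_eq, map_sum]
    refine Finset.sum_eq_zero fun r _ => ?_
    rw [map_sum]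
    refine Finset.sum_eq_zero fun σ _ => ?_
    rw [map_smul, map_list_prod, List.map_map]
    have hlen : 2 ≤ (serreWord σ r).length := by
      have h := hA.offDiag i j hij
      rw [(mem_serreWord σ r).length_eq, Finset.length_toList, Finset.card_univ,
        Fintype.card_option, Fintype.card_fin]
      omega
    rcases hw : serreWord σ r with _ | ⟨x, _ | ⟨y, w⟩⟩
    · rw [hw] at hlen; simp at hlen
    · rw [hw] at hlen; simp at hlen
    · simp only [List.map_cons, List.prod_cons, Function.comp_apply]
      rw [← mul_assoc, hXX, zero_mul, smul_zero]

lemma IsSimpleCartan.qij_symm [Fintype ι] (hA : IsSimpleCartan A d) (q : ℂ) (i j : ι) :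
    qij A d q i j = qij A d q j i := by
  rw [qij, qij, hA.symm]

variable [DecidableEq ι] (A d) (κ : ℂ) (hq0 : q ≠ 0)

/-- The coefficientwise algebra structure. Without this instance, instance search finds the one that
restricts the algebra structure over power series, which is not definitionally the same. -/
instance hahnSeriesAlgebra : Algebra ℂ (HahnSeries ℤ ℂ) := HahnSeries.instAlgebra

/-- The representation by triangular matrices followed by the counit. Its entries are the functions
on the positive algebra given by the pairing with the generators. -/
def skewCounit (j : ι) : Borel ι →ₐ[ℂ] Matrix (Fin 2) (Fin 2) (HahnSeries ℤ ℂ) :=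
  (hahnMap (counit ι)).mapMatrix.comp (skewRep (A := A) (d := d) κ hq0 j)

lemma skewCounit_coeff (j : ι) (a : Borel ι) (r s : Fin 2) (N : ℤ) :
    (skewCounit A d κ hq0 j a r s).coeff N =
      counit ι ((skewRep (A := A) (d := d) κ hq0 j a r s).coeff N) := rfl

lemma skewCounit_gen (j : ι) (g : Gen ι) : skewCounit A d κ hq0 j (gen g) =
    !![hahnMap (counit ι) (cartanShiftGen A d q j g), hahnMap (counit ι) (derivGen κ j g); 0,
      HahnSeries.single 0 (counit ι (gen g))] := by
  rw [skewCounit, AlgHom.comp_apply, skewRep_gen]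
  refine Matrix.ext fun r s => ?_
  fin_cases r <;> fin_cases s
  · rfl
  · rfl
  · exact map_zero (hahnMap (counit ι))
  · exact hahnMap_single (counit ι) 0 (gen g)

lemma skewCounit_X (j i : ι) (n : ℤ) : skewCounit A d κ hq0 j (X i n) =
    !![0, HahnSeries.single (-n) (if i = j then κ else 0); 0, 0] := by
  refine (skewCounit_gen A d κ hq0 j (Gen.x i n)).trans ?_
  have h1 : hahnMap (counit ι) (cartanShiftGen A d q j (Gen.x i n)) = 0 := by
    ext N
    rw [hahnMap_coeff, cartanShiftGen, ofPowerSeries_mk_coeff]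
    split_ifs
    · rw [map_smul, Gen.raise, counit_X, smul_zero]
      rfl
    · exact map_zero _
  have h2 : hahnMap (counit ι) (derivGen κ j (Gen.x i n)) =
      HahnSeries.single (-n) (if i = j then κ else 0) := by
    rw [derivGen, hahnMap_single, apply_ite (counit ι), map_zero, AlgHom.commutes]
    rfl
  have h3 : counit ι (gen (Gen.x i n)) = 0 := counit_X i n
  rw [h1, h2, h3, map_zero]

lemma skewCounit_H (j i : ι) (k : ℕ) : skewCounit A d κ hq0 j (H i k) =
    !![HahnSeries.single (k : ℤ) (PowerSeries.coeff k (gSeries (qij A d q i j))), 0; 0,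
      HahnSeries.single 0 (if k = 0 then 1 else 0)] := by
  refine (skewCounit_gen A d κ hq0 j (Gen.h i k)).trans ?_
  have h1 : hahnMap (counit ι) (cartanShiftGen A d q j (Gen.h i k)) =
      HahnSeries.single (k : ℤ) (PowerSeries.coeff k (gSeries (qij A d q i j))) := by
    ext N
    rw [hahnMap_coeff, cartanShiftGen, ofPowerSeries_mk_coeff, HahnSeries.coeff_single]
    by_cases hN : 0 ≤ N
    · lift N to ℕ using hN
      rw [if_pos (Int.natCast_nonneg N), map_smul, Int.toNat_natCast, Gen.raise, counit_Hz]
      by_cases h : N = k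
      · rw [if_pos (by omega), if_pos (by omega), h]
        exact mul_one _
      · rw [if_neg (by omega), if_neg (by omega), smul_zero]
    · rw [if_neg hN, map_zero, if_neg (by omega)]
  have h2 : hahnMap (counit ι) (derivGen κ j (Gen.h i k)) = 0 := map_zero _
  have h3 : counit ι (gen (Gen.h i k)) = if k = 0 then 1 else 0 := counit_H i k
  rw [h1, h2, h3]

lemma skewCounit_cpow (j : ι) (s : ℤ) : skewCounit A d κ hq0 j (cpow s) = 1 := by
  refine map_cpow_eq (skewCounit A d κ hq0 j) (fun _ => 1) rfl (fun m => ?_) s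
  rw [one_mul, skewCounit_gen, cartanShiftGen_c, hahnMap_single, counit_gen,
    show derivGen κ j Gen.c = 0 from rfl, map_zero]
  exact (Matrix.one_fin_two (α := HahnSeries ℤ ℂ)).trans rfl

variable [Fintype ι] (hA : IsSimpleCartan A d)
include hA

lemma skewCounit_idealPlus (j : ι) {a : Borel ι} (ha : a ∈ idealPlus A d q) :
    skewCounit A d κ hq0 j a = 0 := by
  have hzero : (!![0, 0; 0, 0] : Matrix (Fin 2) (Fin 2) (HahnSeries ℤ ℂ)) = 0 := by
    ext r s
    fin_cases r <;> fin_cases s <;> rfl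
  refine map_idealPlus_eq_zero hA _ ?_ ?_ ?_ ha
  · intro i n i' m
    rw [skewCounit_X, skewCounit_X, Matrix.mul_fin_two]
    simp only [mul_zero, zero_mul, add_zero, hzero]
  · intro i k i' l
    rw [skewCounit_H, skewCounit_H, Matrix.mul_fin_two, Matrix.mul_fin_two]
    simp only [mul_zero, zero_mul, add_zero, zero_add, mul_comm]
  · intro i k i' m
    rw [Finset.sum_eq_single (k, 0)]
    · rw [skewCounit_cpow, one_mul, skewCounit_X, skewCounit_X, skewCounit_H, skewCounit_H,
        Matrix.mul_fin_two, Matrix.mul_fin_two, Matrix.smul_of]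
      simp only [mul_zero, zero_mul, add_zero, zero_add, if_true, HahnSeries.single_mul_single,
        mul_one]
      by_cases h : i' = j
      · subst h
        refine Matrix.ext fun r s => ?_
        fin_cases r <;> fin_cases s <;> simp
        rw [← sub_eq_add_neg]
        ext N
        refine Eq.trans ?_ (HahnSeries.coeff_smul (r := _) (x := _) (a := N)).symm
        rw [HahnSeries.coeff_single, HahnSeries.coeff_single, smul_ite, smul_zero, smul_eq_mul]
      · simp [if_neg h]
    · rintro ⟨p, r⟩ hp hne
      rw [Finset.HasAntidiagonal.mem_antidiagonal] at hp
      have hr : r ≠ 0 := by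
        rintro rfl
        exact hne (by rw [← hp, add_zero])
      rw [skewCounit_cpow, one_mul, skewCounit_X, skewCounit_H, Matrix.mul_fin_two, if_neg hr]
      simp only [map_zero, mul_zero, zero_mul, add_zero, hzero]
      exact smul_zero (M := ℂ) (A := Matrix (Fin 2) (Fin 2) (HahnSeries ℤ ℂ)) _
    · intro h
      exact absurd (Finset.HasAntidiagonal.mem_antidiagonal.2 (add_zero k)) h

omit [DecidableEq ι] in
lemma counit_cartanScale_idealPlus (j : ι) {a : Borel ι} (ha : a ∈ idealPlus A d q) :
    counit ι (cartanScale A d q hq0 j a) = 0 := by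
  have hX : ∀ i n, ((counit ι).comp (cartanScale A d q hq0 j)) (X i n) = 0 := by
    intro i n
    rw [AlgHom.comp_apply, ← mul_one (X i n)]
    refine (congrArg _ (cartanScale_gen_mul A d hq0 j (Gen.x i n) 1)).trans ?_
    rw [map_smul, map_mul]
    exact (congrArg _ (mul_eq_zero_of_left (counit_X i n) _)).trans (smul_zero _)
  refine map_idealPlus_eq_zero hA ((counit ι).comp (cartanScale A d q hq0 j)) ?_ ?_ ?_ ha
  · intro i n i' m
    rw [hX, zero_mul]
  · exact fun _ _ _ _ => mul_comm _ _
  · intro i k i' m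
    simp only [hX, mul_zero, zero_mul, smul_zero, Finset.sum_const_zero]

omit [DecidableEq ι] in
lemma counit_idealPlus {a : Borel ι} (ha : a ∈ idealPlus A d q) : counit ι a = 0 := by
  refine map_idealPlus_eq_zero hA (counit ι) ?_ ?_ ?_ ha
  · intro i n i' m
    rw [counit_X, zero_mul]
  · exact fun _ _ _ _ => mul_comm _ _
  · intro i k i' m
    simp only [counit_X, mul_zero, zero_mul, smul_zero, Finset.sum_const_zero]

lemma pairing_idealPlus_gen {a : Borel ι} (ha : a ∈ idealPlus A d q) (g : Gen ι) :
    pairing A d κ hq0 a (gen g) = 0 := by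
  rw [pairing_apply, dual_gen]
  cases g with
  | x j m =>
    have h := skewCounit_coeff A d κ hq0 j a 0 1 m
    rw [skewCounit_idealPlus A d κ hq0 hA j ha] at h
    exact h.symm
  | h j k =>
    have h := skewCounit_coeff A d κ hq0 j a 0 0 k
    rw [skewCounit_idealPlus A d κ hq0 hA j ha] at h
    exact h.symm
  | hinv j => exact counit_cartanScale_idealPlus A d hq0 hA j ha
  | c => exact counit_idealPlus A d hA ha
  | cinv => exact counit_idealPlus A d hA ha

variable (hq : ∀ n : ℕ, 0 < n → q ^ n ≠ 1)
include hq

/-- The ideal of the relations pairs to zero with the generators, and the coideal property extends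
this to products. -/
theorem pairing_idealPlus (b : Borel ι) :
    ∀ a ∈ idealPlus A d q, pairing A d κ hq0 a b = 0 := by
  have hs := isWeakHopfPairing_pairing A d κ hq0 (hA.qij_symm q)
  induction b using Borel.induction with
  | one => intro a ha; rw [pairing_one_right, counit_idealPlus A d hA ha]
  | smul r b hb => intro a ha; rw [map_smul, hb a ha, smul_zero]
  | add b b' hb hb' => intro a ha; rw [map_add, hb a ha, hb' a ha, add_zero]
  | mul g b hb =>
    intro a ha
    rw [hs.mul_right]
    refine finsum_eq_zero_of_forall_eq_zero fun N => ?_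
    have ht := coideal_plus hA hq0 hq a ha N
    generalize (deltaPlus ι a).coeff N = t at ht
    induction ht using Submodule.span_induction with
    | zero => rw [map_zero]
    | add x y _ _ hx hy => rw [map_add, hx, hy, add_zero]
    | smul r x _ hx => rw [map_smul, hx, smul_zero]
    | mem x hx =>
      obtain ⟨u, v, huv, rfl⟩ := hx
      rw [evalTensor_tmul, LinearMap.flip_apply, LinearMap.flip_apply]
      rcases huv with hu | hv
      · rw [pairing_idealPlus_gen A d κ hq0 hA hu, zero_mul]
      · rw [hb v hv, mul_zero]

lemma pairing_serre_left {i j : ι} (hij : i ≠ j) (n : Fin (1 - A i j).toNat → ℤ) (l : ℤ)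
    (b : Borel ι) : pairing A d κ hq0 (serre A d q i j n l) b = 0 :=
  pairing_idealPlus A d κ hq0 hA hq b _
    (TwoSidedIdeal.subset_span (Or.inr ⟨i, j, hij, n, l, rfl⟩))

lemma pairing_serre_right {i j : ι} (hij : i ≠ j) (n : Fin (1 - A i j).toNat → ℤ) (l : ℤ)
    (a : Borel ι) : pairing A d κ hq0 a (serre A d q i j n l) = 0 := by
  rw [pairing_theta A d κ hq0 (hA.qij_symm q), theta_serre]
  exact pairing_serre_left A d κ hq0 hA hq hij _ _ _

end Kernel

end QAffine

end

theorem proposition7 {ι : Type*} [Fintype ι] [DecidableEq ι] (A : Matrix ι ι ℤ) (d : ι → ℕ)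
    (hA : QAffine.IsSimpleCartan A d) (q κ : ℂ) (hq0 : q ≠ 0) (hq : ∀ n : ℕ, 0 < n → q ^ n ≠ 1)
    (hκ : κ ≠ 0) :
    (∃! P : QAffine.Borel ι →ₗ[ℂ] QAffine.Borel ι →ₗ[ℂ] ℂ,
      QAffine.IsWeakHopfPairing A d q κ P) ∧
    (∀ P : QAffine.Borel ι →ₗ[ℂ] QAffine.Borel ι →ₗ[ℂ] ℂ, QAffine.IsWeakHopfPairing A d q κ P →
      ∀ i j : ι, i ≠ j → ∀ (n : Fin (1 - A i j).toNat → ℤ) (l : ℤ),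
        (∀ b, P (QAffine.serre A d q i j n l) b = 0) ∧
        (∀ a, P a (QAffine.serre A d q i j n l) = 0)) ∧
    QAffine.IsWeakHopfIdeal (QAffine.deltaPlus ι) (QAffine.antipodePlus ι)
      (QAffine.idealPlus A d q) ∧
    QAffine.IsWeakHopfIdeal (QAffine.deltaMinus ι) (QAffine.antipodeMinus ι)
      (QAffine.idealMinus A d q) := by
  have hP := QAffine.isWeakHopfPairing_pairing A d κ hq0 (hA.qij_symm q)
  refine ⟨⟨_, hP, fun P' hP' => hP'.unique hP hq0⟩, fun P' hP' i j hij n l => ?_,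
    QAffine.isWeakHopfIdeal_plus hA hq0 hq, QAffine.isWeakHopfIdeal_minus hA hq0 hq⟩
  rw [hP'.unique hP hq0]
  exact ⟨QAffine.pairing_serre_left A d κ hq0 hA hq hij n l,
    QAffine.pairing_serre_right A d κ hq0 hA hq hij n l⟩
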